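/- **Definitions.** Write $[M]=\{0,\dots,M-1\}$. A *presented* compact metric space $(X,d,\xi,D)$ is a compact metric space $(X,d)$ of diameter at most $1$ with a partial dense enumeration $\xi:\subseteq\mathbb N\to X$ and a strictly increasing $D:\mathbb N\to\mathbb N$ such that for every $m$ each $x\in X$ has distance at most $2^{-m-1}$ to some $\xi(u)$, $u\in\mathrm{dom}(\xi)\cap[2^{D(m)}]$. It is *computably compact* if $\mathrm{dom}(\xi)$ and $D$ are recursive and $\{(a,b,n,u,v): u,v\in\mathrm{dom}(\xi),\ a/2^n<d(\xi(u),\xi(v))<b/2^n\}\subseteq\mathbb Z^2\times\mathbb N^3$ is semi-decidable. A *rounding function* is a map $R:\mathrm{dom}(\xi)\times\mathbb N\to\mathrm{dom}(\xi)$ with $R(u,m)\in[2^{D(m)}]$ and $d(\xi(R(u,m)),\xi(u))\le2^{-m-1}$. A *name* of $x\in X$ is a sequence $(u_m)$ with $u_m\in\mathrm{dom}(\xi)\cap[2^{D(m)}]$ and $d(\xi(u_m),x)\le2^{-m}$; $x$ is *computable* if it has a recursive name. For $W\subseteq X$ let $W^*_{\xi,D}$ be the set of finite initial segments of names of points of $W$.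 A *name* of a non-empty compact $W\subseteq X$ is a sequence of finite non-empty $A_m\subseteq\mathrm{dom}(\xi)\cap[2^{D(m)}]$ such that $\xi[A_m]$ has Hausdorff distance at most $2^{-m}$ to $W$; $W$ is *computable* (*co-computable*) if it has a name for which $\{(m,a):a\in A_m\}$ is decidable (co-r.e.). The empty set counts as computable and co-computable. Let $(X,d,\xi,D)$ and $(Y,e,\upsilon,E)$ be presented, $W\subseteq X$ and $\Lambda:W\to Y$. A *name* of $\Lambda$ is a map $\Lambda^*:X^*_{\xi,D}\to Y^*_{\upsilon,E}$, monotone with respect to initial segments, such that for every name $\bar u$ of a point $x\in W$ the sequences $\Lambda^*(u_0,\dots,u_{m-1})$ have unbounded length and converge to a name of $\Lambda(x)$. A Turing machine with one-way read-only input tape, one-way write-only output tape and finitely many work tapes *computes* $\Lambda$ if there is a name $\Lambda^*$ of $\Lambda$ such that on every input name $\bar u$ of a point of $X$ (entries written in binary and separated) the machine prints the supremum of the $\Lambda^*(u_0,\dots,u_{m-1})$. It *runs in time* $T:\mathbb N\to\mathbb N$ on $W$ if, for every name of a point of $W$ as input and every $n$, the output entries number $0,\dots,n$ have been printed after at most $T(n)$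 steps. $\Lambda$ is *computable* if some machine computes it. A *binary modulus of continuity* of $\Lambda$ is a non-decreasing $\mu:\mathbb N\to\mathbb N$ such that $d(x,x')\le2^{-\mu(n)}$ implies $e(\Lambda(x),\Lambda(x'))\le2^{-n}$ for all $n$ and all $x,x'\in W$. The product $X\times Y$ carries the maximum metric and is presented by $m\mapsto D(m)+E(m)$ and an enumeration whose first $2^{D(m)+E(m)}$ indices correspond, for every $m$, bijectively to $[2^{D(m)}]\times[2^{E(m)}]$, an index of $(u,v)$ denoting $(\xi(u),\upsilon(v))$. Explicitly, with $M_m=2^{D(m)}$ and $N_m=2^{E(m)}$, the pair $(u,v)$ has index $M_0v+u$ if $u<M_0$, $v<N_0$; index $M_mN_m+(M_{m+1}-M_m)v+(u-M_m)$ if $M_m\le u<M_{m+1}$, $v<N_m$; and index $M_{m+1}N_m+M_{m+1}(v-N_m)+u$ if $u<M_{m+1}$, $N_m\le v<N_{m+1}$. **Theorem.** Let $(X,d,\xi,D)$ and $(Y,e,\upsilon,E)$ be computably compact presented metric spaces with recursive rounding functions. (a) $X$ is a computable subset of itself. The union of two computable (co-computable) compact subsets of $X$ is computable (co-computable), and the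 intersection of two co-computable sets is co-computable. (b) For $x\in X$ the following are equivalent: $x$ is computable; $\{x\}$ is co-computable; $\{x\}$ is computable. Let moreover $W\subseteq X$ be non-empty and compact, and $\Lambda:W\to Y$. (c) If $W$ is computable, it contains a computable point. (d) Every machine computing $\Lambda$ runs on $W$ in some time $T=T(n)$ that depends only on the output precision $n$, and $T$ can be chosen non-decreasing. For every such time bound $T$, $d(x,x')\le2^{-T(n+1)-1}$ implies $e(\Lambda(x),\Lambda(x'))\le2^{-n}$ for all $n$ and all $x,x'\in W$; thus $n\mapsto T(n+1)+1$ is a binary modulus of continuity of $\Lambda$ if $T$ is non-decreasing. (e) If $W$ is co-computable, then $W^*_{\xi,D}$ is co-r.e., and for every machine computing $\Lambda$ there is a recursive $\mu:\mathbb N\to\mathbb N$ that is both a binary modulus of continuity of $\Lambda$ and a time bound of the machine on $W$. (f) If $\Lambda$ is computable and $W$ and $V\subseteq Y$ are co-computable, then $\Lambda^{-1}[V]\subseteq X$ is co-computable. (g) If $\Lambda$ and $W$ are computable, then $\Lambda[W]\subseteq Y$ is compact and computable. (h) If $W=\overline{W^\circ}$ and both $W$ and $X\setminus W^\circ$ are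 co-computable, then both are computable. (j) If $W$ and $\Lambda$ are computable, then $\mathrm{graph}(\Lambda)\subseteq X\times Y$ is compact and computable. Conversely, if $\mathrm{graph}(\Lambda)$ is compact and computable, then $\Lambda$ is computable. In particular, for computable $W$, $\Lambda$ is computable if and only if its graph is. -/

import Mathlib

/-! ### Names as sequences of indices -/

/-- The finite initial segment `(u₀, …, uₙ₋₁)` of an infinite sequence. -/
def seqPrefix (u : ℕ → ℕ) (n : ℕ) : List ℕ :=
  (List.range n).map u

/-- `S` is an `m`-covering of `X`: the closed balls of radius `2^(-m-1)` around `S` cover `X`. -/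
def IsMCovering {X : Type*} [MetricSpace X] (m : ℕ) (S : Set X) : Prop :=
  (Set.univ : Set X) ⊆ ⋃ x ∈ S, Metric.closedBall x ((2⁻¹ : ℝ) ^ (m + 1))

theorem IsMCovering.exists_mem {X : Type*} [MetricSpace X] {m : ℕ} {S : Set X}
    (h : IsMCovering m S) (x : X) : ∃ y ∈ S, dist x y ≤ (2⁻¹ : ℝ) ^ (m + 1) := by
  have hx := h (Set.mem_univ x)
  simp only [Set.mem_iUnion, Metric.mem_closedBall] at hx
  obtain ⟨y, hy, hd⟩ := hx
  exact ⟨y, hy, hd⟩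

/-- A presentation of a (compact) metric space `X` of diameter at most one: a partial dense
enumeration `enum` of points and a strictly increasing `D` such that the points with index
below `2^(D m)` form an `m`-covering. -/
structure Presentation (X : Type*) [MetricSpace X] where
  diam_le : ∀ x y : X, dist x y ≤ 1
  enum : ℕ →. X
  dense : Dense enum.ran
  D : ℕ → ℕ
  strictMono : StrictMono D
  covering : ∀ m : ℕ, IsMCovering m (enum.image {u | u < 2 ^ D m})

namespace Presentation

variable {X : Type*} [MetricSpace X]

/-- The presentation is computably compact: the domain of the enumeration and `D` are recursive,
and the distance of enumerated points can be enclosed between dyadic rationals semi-decidably. -/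
def ComputablyCompact (P : Presentation X) : Prop :=
  ComputablePred (fun u : ℕ => u ∈ P.enum.Dom) ∧
  Computable P.D ∧
  REPred (fun q : ℤ × ℤ × ℕ × ℕ × ℕ =>
    match q with
    | (a, b, n, u, v) => ∃ x ∈ P.enum u, ∃ y ∈ P.enum v,
        (a : ℝ) / 2 ^ n < dist x y ∧ dist x y < (b : ℝ) / 2 ^ n)

/-- `R` is a rounding function (its values matter only on `dom(enum) × ℕ`). -/
def IsRounding (P : Presentation X) (R : ℕ → ℕ → ℕ) : Prop :=
  ∀ u, ∀ x ∈ P.enum u, ∀ m, R u m < 2 ^ P.D m ∧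
    ∃ y ∈ P.enum (R u m), dist y x ≤ (2⁻¹ : ℝ) ^ (m + 1)

/-- There is a recursive rounding function. -/
def HasRecursiveRounding (P : Presentation X) : Prop :=
  ∃ R : ℕ → ℕ → ℕ, Computable₂ R ∧ P.IsRounding R

/-- The sequence of indices `u` is a name of the point `x`. -/
def IsPointName (P : Presentation X) (u : ℕ → ℕ) (x : X) : Prop :=
  ∀ m, u m < 2 ^ P.D m ∧ ∃ y ∈ P.enum (u m), dist y x ≤ (2⁻¹ : ℝ) ^ m

/-- The point `x` has a recursive name. -/
def IsComputablePoint (P : Presentation X) (x : X) : Prop :=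
  ∃ u : ℕ → ℕ, Computable u ∧ P.IsPointName u x

/-- The set of finite initial segments of names of points of `W`. -/
def initials (P : Presentation X) (W : Set X) : Set (List ℕ) :=
  {s | ∃ x ∈ W, ∃ u, P.IsPointName u x ∧ ∃ n, s = seqPrefix u n}

/-- The sequence `A` of finite non-empty sets of indices is a name of the non-empty compact
set `W`. -/
def IsSetName (P : Presentation X) (A : ℕ → Finset ℕ) (W : Set X) : Prop :=
  ∀ m, (A m).Nonempty ∧ (∀ a ∈ A m, a < 2 ^ P.D m ∧ a ∈ P.enum.Dom) ∧
    Metric.hausdorffDist (P.enum.image (A m : Set ℕ)) W ≤ (2⁻¹ : ℝ) ^ m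

/-- `W` is a computable compact set (the empty set is computable by convention). -/
def IsComputableSet (P : Presentation X) (W : Set X) : Prop :=
  IsCompact W ∧ (W.Nonempty → ∃ A : ℕ → Finset ℕ, P.IsSetName A W ∧
    ComputablePred (fun p : ℕ × ℕ => p.2 ∈ A p.1))

/-- `W` is a co-computable compact set (the empty set is co-computable by convention). -/
def IsCoComputableSet (P : Presentation X) (W : Set X) : Prop :=
  IsCompact W ∧ (W.Nonempty → ∃ A : ℕ → Finset ℕ, P.IsSetName A W ∧
    REPred (fun p : ℕ × ℕ => ¬ p.2 ∈ A p.1))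

end Presentation

/-! ### The product of two presented spaces -/

namespace Presentation

variable {X Y : Type*} [MetricSpace X] [MetricSpace Y]

theorem exists_stage (P : Presentation X) (Q : Presentation Y) (k : ℕ) :
    ∃ m, k < 2 ^ P.D m * 2 ^ Q.D m := by
  refine ⟨k, ?_⟩
  calc k < 2 ^ k := Nat.lt_two_pow_self
    _ ≤ 2 ^ P.D k := Nat.pow_le_pow_right (by norm_num) P.strictMono.le_apply
    _ ≤ 2 ^ P.D k * 2 ^ Q.D k := Nat.le_mul_of_pos_right _ (by positivity)

/-- The least `m` such that `k` is below the product of the two numbers of indices at level `m`. -/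
def stage (P : Presentation X) (Q : Presentation Y) (k : ℕ) : ℕ :=
  Nat.find (exists_stage P Q k)

/-- The bijection between indices and pairs of indices that underlies the enumeration of the
product space; it maps `[M m * N m]` onto `[M m] × [N m]` for every `m`, where `M m = 2^(P.D m)`
and `N m = 2^(Q.D m)`. The pairs that are new at level `m + 1` are listed in two blocks: first
those with `M m ≤ u < M (m+1)` and `v < N m`, then those with `u < M (m+1)` and
`N m ≤ v < N (m+1)`. -/
def unpairIndex (P : Presentation X) (Q : Presentation Y) (k : ℕ) : ℕ × ℕ :=
  let M : ℕ → ℕ := fun m => 2 ^ P.D m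
  let N : ℕ → ℕ := fun m => 2 ^ Q.D m
  match stage P Q k with
  | 0 => (k % M 0, k / M 0)
  | m + 1 =>
    if k < M (m + 1) * N m then
      (M m + (k - M m * N m) % (M (m + 1) - M m), (k - M m * N m) / (M (m + 1) - M m))
    else
      ((k - M (m + 1) * N m) % M (m + 1), N m + (k - M (m + 1) * N m) / M (m + 1))

theorem exists_unpairIndex (P : Presentation X) (Q : Presentation Y) (m : ℕ) {u v : ℕ}
    (hu : u < 2 ^ P.D m) (hv : v < 2 ^ Q.D m) :
    ∃ k < 2 ^ P.D m * 2 ^ Q.D m, unpairIndex P Q k = (u, v) := by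
  induction m with
  | zero =>
    have hk : v * 2 ^ P.D 0 + u < 2 ^ P.D 0 * 2 ^ Q.D 0 := by nlinarith
    refine ⟨v * 2 ^ P.D 0 + u, hk, ?_⟩
    have hs : stage P Q (v * 2 ^ P.D 0 + u) = 0 := (Nat.find_eq_zero _).2 hk
    simp only [unpairIndex, hs]
    have hpos : 0 < 2 ^ P.D 0 := by positivity
    rw [Nat.mul_comm v, Nat.mul_add_mod, Nat.mul_add_div hpos, Nat.mod_eq_of_lt hu,
      Nat.div_eq_of_lt hu, Nat.add_zero]
  | succ m ih =>
    have hM : 2 ^ P.D m < 2 ^ P.D (m + 1) :=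
      Nat.pow_lt_pow_right (by norm_num) (P.strictMono (Nat.lt_succ_self m))
    have hN : 2 ^ Q.D m < 2 ^ Q.D (m + 1) :=
      Nat.pow_lt_pow_right (by norm_num) (Q.strictMono (Nat.lt_succ_self m))
    have hstage : ∀ k, 2 ^ P.D m * 2 ^ Q.D m ≤ k → k < 2 ^ P.D (m + 1) * 2 ^ Q.D (m + 1) →
        stage P Q k = m + 1 := by
      intro k h1 h2
      refine (Nat.find_eq_iff _).2 ⟨h2, fun j hj => ?_⟩
      have hj' : j ≤ m := Nat.lt_succ_iff.1 hj
      have : 2 ^ P.D j * 2 ^ Q.D j ≤ 2 ^ P.D m * 2 ^ Q.D m :=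
        Nat.mul_le_mul (Nat.pow_le_pow_right (by norm_num) (P.strictMono.monotone hj'))
          (Nat.pow_le_pow_right (by norm_num) (Q.strictMono.monotone hj'))
      omega
    by_cases h1 : u < 2 ^ P.D m ∧ v < 2 ^ Q.D m
    · obtain ⟨k, hk, he⟩ := ih h1.1 h1.2
      exact ⟨k, lt_of_lt_of_le hk (Nat.mul_le_mul hM.le hN.le), he⟩
    generalize hMe : 2 ^ P.D m = M at *
    generalize hMe' : 2 ^ P.D (m + 1) = M' at *
    generalize hNe : 2 ^ Q.D m = N at *
    generalize hNe' : 2 ^ Q.D (m + 1) = N' at *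
    by_cases h2 : v < N
    · have hu' : M ≤ u := by
        by_contra hc
        exact h1 ⟨not_le.1 hc, h2⟩
      obtain ⟨d, rfl⟩ := Nat.exists_eq_add_of_lt hM
      obtain ⟨r, rfl⟩ := Nat.exists_eq_add_of_le hu'
      have hlt : M * N + ((d + 1) * v + r) < (M + d + 1) * N := by nlinarith
      have hlt' : M * N + ((d + 1) * v + r) < (M + d + 1) * N' :=
        lt_of_lt_of_le hlt (Nat.mul_le_mul le_rfl hN.le)
      refine ⟨M * N + ((d + 1) * v + r), hlt', ?_⟩
      have hr : r < d + 1 := by omega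
      have hd : M + d + 1 - M = d + 1 := by omega
      simp only [unpairIndex, hstage _ (Nat.le_add_right _ _) hlt', hMe, hMe', hNe, hlt, if_true,
        hd, Nat.add_sub_cancel_left]
      rw [Nat.mul_add_mod, Nat.mul_add_div (Nat.succ_pos d), Nat.mod_eq_of_lt hr,
        Nat.div_eq_of_lt hr, Nat.add_zero]
    · obtain ⟨w, rfl⟩ := Nat.exists_eq_add_of_le (not_lt.1 h2)
      have hlt' : M' * N + (M' * w + u) < M' * N' := by
        have : N + w + 1 ≤ N' := hv
        nlinarith
      refine ⟨M' * N + (M' * w + u), hlt', ?_⟩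
      have hge : M * N ≤ M' * N + (M' * w + u) := by nlinarith
      have hnot : ¬ M' * N + (M' * w + u) < M' * N := by omega
      have hpos : 0 < M' := by omega
      simp only [unpairIndex, hstage _ hge hlt', hMe', hNe, hnot, if_false,
        Nat.add_sub_cancel_left]
      rw [Nat.mul_add_mod, Nat.mul_add_div hpos, Nat.mod_eq_of_lt hu,
        Nat.div_eq_of_lt hu, Nat.add_zero]

/-- The enumeration of the product space. -/
def prodEnum (P : Presentation X) (Q : Presentation Y) : ℕ →. X × Y :=
  fun k => PFun.prodMap P.enum Q.enum (unpairIndex P Q k)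

theorem prodEnum_covering (P : Presentation X) (Q : Presentation Y) (m : ℕ) :
    IsMCovering m ((prodEnum P Q).image {u | u < 2 ^ (P.D m + Q.D m)}) := by
  rintro ⟨x, y⟩ -
  obtain ⟨x', ⟨u, hu, hux⟩, hx⟩ := (P.covering m).exists_mem x
  obtain ⟨y', ⟨v, hv, hvy⟩, hy⟩ := (Q.covering m).exists_mem y
  obtain ⟨k, hk, he⟩ := exists_unpairIndex P Q m hu hv
  simp only [Set.mem_iUnion, Metric.mem_closedBall]
  refine ⟨(x', y'), ⟨k, ?_, ?_⟩, ?_⟩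
  · simpa [pow_add] using hk
  · change (x', y') ∈ prodEnum P Q k
    rw [prodEnum, he, PFun.mem_prodMap]
    exact ⟨hux, hvy⟩
  · rw [Prod.dist_eq]
    exact max_le hx hy

/-- The presentation of `X × Y`, with the maximum metric. -/
def prod (P : Presentation X) (Q : Presentation Y) : Presentation (X × Y) where
  diam_le := fun p q => by
    rw [Prod.dist_eq]
    exact max_le (P.diam_le _ _) (Q.diam_le _ _)
  enum := prodEnum P Q
  dense := by
    rw [Metric.dense_iff]
    intro p r hr
    obtain ⟨m, hm⟩ := exists_pow_lt_of_lt_one hr (by norm_num : (2⁻¹ : ℝ) < 1)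
    obtain ⟨q, ⟨k, -, hk⟩, hq⟩ := (prodEnum_covering P Q m).exists_mem p
    refine ⟨q, ?_, ⟨k, hk⟩⟩
    rw [Metric.mem_ball, dist_comm]
    refine lt_of_le_of_lt hq (lt_of_le_of_lt ?_ hm)
    exact pow_le_pow_of_le_one (by norm_num) (by norm_num) (Nat.le_succ m)
  D := fun m => P.D m + Q.D m
  strictMono := P.strictMono.add Q.strictMono
  covering := prodEnum_covering P Q

end Presentation

/-! ### Turing machines on infinite sequences -/

/-- Sequences of natural numbers are written on tapes in binary, each entry being followed by
the separator `none`. -/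
def encodeSeq (s : List ℕ) : List (Option Bool) :=
  s.flatMap fun u => (Nat.bits u).map some ++ [none]

/-- The symbol in cell `p` of the input tape that holds the infinite sequence `u`; every entry
takes up at least one cell, so the first `p + 1` entries reach beyond cell `p`. -/
def inputSymbol (u : ℕ → ℕ) (p : ℕ) : Option Bool :=
  (encodeSeq (seqPrefix u (p + 1))).getD p none

/-- The effect of one step of a machine with `k` work tapes, states `0, …, q` and work symbols
`0, …, g`. -/
structure MachineAction (k q g : ℕ) where
  /-- the next state -/
  next : Fin (q + 1)
  /-- the symbol to be written on each work tape -/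
  write : Fin k → Fin (g + 1)
  /-- the subsequent move of the head on each work tape (`none`: stay) -/
  move : Fin k → Option Turing.Dir
  /-- whether the input head advances by one cell -/
  advance : Bool
  /-- the symbol (if any) to be printed on the output tape -/
  print : Option (Option Bool)

/-- A Turing machine with a one-way read-only input tape, a one-way write-only output tape,
and finitely many two-way work tapes. State `0` is initial, and the symbol `0` is blank. -/
structure StreamMachine where
  k : ℕ
  q : ℕ
  g : ℕ
  δ : Fin (q + 1) → Option Bool → (Fin k → Fin (g + 1)) → MachineAction k q g

/-- A work tape: the cells to the left of the head (nearest first), the scanned cell, and the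
cells to the right of the head (nearest first); cells that are not listed are blank. -/
abbrev WorkTape (g : ℕ) : Type :=
  List (Fin (g + 1)) × Fin (g + 1) × List (Fin (g + 1))

/-- Write a symbol and move the head. -/
def WorkTape.act {g : ℕ} (T : WorkTape g) (a : Fin (g + 1)) : Option Turing.Dir → WorkTape g
  | none => (T.1, a, T.2.2)
  | some Turing.Dir.left => (T.1.tail, T.1.headD 0, a :: T.2.2)
  | some Turing.Dir.right => (a :: T.1, T.2.2.headD 0, T.2.2.tail)

namespace StreamMachine

/-- A configuration: state, work tapes, position of the input head, output printed so far. -/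
structure Config (M : StreamMachine) where
  state : Fin (M.q + 1)
  tape : Fin M.k → WorkTape M.g
  pos : ℕ
  out : List (Option Bool)

/-- The initial configuration. -/
def init (M : StreamMachine) : M.Config where
  state := 0
  tape := fun _ => ([], 0, [])
  pos := 0
  out := []

/-- One step on the input `u`. -/
def step (M : StreamMachine) (u : ℕ → ℕ) (c : M.Config) : M.Config :=
  let a := M.δ c.state (inputSymbol u c.pos) (fun i => (c.tape i).2.1)
  { state := a.next
    tape := fun i => (c.tape i).act (a.write i) (a.move i)
    pos := if a.advance then c.pos + 1 else c.pos
    out := c.out ++ a.print.toList }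

/-- The configuration after `t` steps on the input `u`. -/
def run (M : StreamMachine) (u : ℕ → ℕ) : ℕ → M.Config
  | 0 => M.init
  | t + 1 => M.step u (M.run u t)

/-- After `t` steps on the input `u`, all entries of the finite sequence `s` have been printed
as the first entries of the output. -/
def Printed (M : StreamMachine) (u : ℕ → ℕ) (t : ℕ) (s : List ℕ) : Prop :=
  encodeSeq s <+: (M.run u t).out

end StreamMachine

/-! ### Computable maps -/

section Maps

variable {X Y : Type*} [MetricSpace X] [MetricSpace Y]

/-- `F` is a name of the partial map `Λ` with domain `W`: a monotone map from initial segments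
of names in `X` to initial segments of names in `Y` that converges, along every name of a point
`x ∈ W`, to a name of `Λ x`. (Its values elsewhere do not matter.) -/
def IsMapName (P : Presentation X) (Q : Presentation Y) {W : Set X} (Λ : W → Y)
    (F : List ℕ → List ℕ) : Prop :=
  (∀ s ∈ P.initials Set.univ, F s ∈ Q.initials Set.univ) ∧
  (∀ s ∈ P.initials Set.univ, ∀ t ∈ P.initials Set.univ, s <+: t → F s <+: F t) ∧
  ∀ (x : W) (u : ℕ → ℕ), P.IsPointName u x →
    (∀ n, ∃ m, n ≤ (F (seqPrefix u m)).length) ∧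
    ∃ v : ℕ → ℕ, Q.IsPointName v (Λ x) ∧
      ∀ m, F (seqPrefix u m) = seqPrefix v (F (seqPrefix u m)).length

/-- The machine `M` computes `F`: on every name in `X` as input, the sequence of entries that it
prints is the supremum of the values of `F` on the initial segments of the input. -/
def StreamMachine.ComputesName (M : StreamMachine) (P : Presentation X) (F : List ℕ → List ℕ) :
    Prop :=
  ∀ (x : X) (u : ℕ → ℕ), P.IsPointName u x →
    ∀ s : List ℕ, (∃ t, M.Printed u t s) ↔ ∃ m, s <+: F (seqPrefix u m)

/-- The machine `M` computes the map `Λ : W → Y`. -/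
def StreamMachine.ComputesMap (M : StreamMachine) (P : Presentation X) (Q : Presentation Y)
    {W : Set X} (Λ : W → Y) : Prop :=
  ∃ F : List ℕ → List ℕ, IsMapName P Q Λ F ∧ M.ComputesName P F

/-- `Λ : W → Y` is computable. -/
def IsComputableMap (P : Presentation X) (Q : Presentation Y) {W : Set X} (Λ : W → Y) : Prop :=
  ∃ M : StreamMachine, M.ComputesMap P Q Λ

/-- On every name of every point of `W`, the machine `M` has printed the entries number
`0, …, n` of its output after at most `T n` steps. -/
def StreamMachine.RunsInTime (M : StreamMachine) (P : Presentation X) (W : Set X)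
    (T : ℕ → ℕ) : Prop :=
  ∀ x ∈ W, ∀ u : ℕ → ℕ, P.IsPointName u x →
    ∀ n, ∃ s : List ℕ, s.length = n + 1 ∧ M.Printed u (T n) s

/-- The continuity estimate of a binary modulus. -/
def BinaryModulusEstimate {W : Set X} (Λ : W → Y) (μ : ℕ → ℕ) : Prop :=
  ∀ (n : ℕ) (x x' : W), dist x x' ≤ (2⁻¹ : ℝ) ^ μ n → dist (Λ x) (Λ x') ≤ (2⁻¹ : ℝ) ^ n

/-- `μ` is a binary modulus of continuity of `Λ`. -/
def IsBinaryModulus {W : Set X} (Λ : W → Y) (μ : ℕ → ℕ) : Prop :=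
  Monotone μ ∧ BinaryModulusEstimate Λ μ

/-- The graph of `Λ : W → Y` in `X × Y`. -/
def mapGraph {W : Set X} (Λ : W → Y) : Set (X × Y) :=
  Set.range fun x : W => ((x : X), Λ x)

end Maps

/-! ### Closure properties of semi-decidable predicates -/

section SemiDecidable

variable {α β : Type*} [Primcodable α] [Primcodable β]

/-! Everything is reduced to recursively enumerable statements about balls around indexed points.
With `Misses` (a closed ball is disjoint from `W`) and `Hits` (an open ball meets `W`), a compact
set is co-computable exactly if `Misses` is semi-decidable, and computable exactly if both relations
are (`ComputablyCompact.isCoComputableSet_iff`, `ComputablyCompact.isComputableSet_iff`). The set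
operations, regular sets and singletons then become closure properties of semi-decidable predicates.
The decisive input is compactness: if two closed sets and finitely many closed balls have no common
point, then this is already visible at some finite precision
(`ComputablyCompact.not_exists_mem_inter_re`). A computable point of a computable set is the limit
of a recursively chosen, rapidly converging sequence of indices from its name.

For maps, names form a finitely branching tree, since entry `m` is below `2^(D m)`. By König's
lemma, whatever a machine does after finitely many steps on every name of a point of a closed `C ⊆
W` it does after a uniform number of steps (`StreamMachine.ComputesMap.exists_level`). This yields
the time bounds. A time bound is a modulus of continuity because two nearby points share a long
initial segment of a name, on which the machine acts identically. For co-computable `W` the finite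
initial segments that leave the tree can be recognised, so that a uniform time can be found by
search. The same argument semi-decides that no point of `W` in given balls is mapped to a given
co-computable set (`StreamMachine.ComputesMap.preimage_re`), which gives preimages and the negative
information on images and graphs. The positive information comes from finite runs: a finite input
segment that fits all points of a small ball, together with the printed output, certifies that a
rectangle meets the graph (`StreamMachine.ComputesMap.hits_rectangle_re`).

Conversely, a map is recovered from its graph by search. An output entry `v` is admissible once
finitely many rectangles at some precision have been seen either to miss the graph or to have their
second centre close to `v`; compactness and single-valuedness of the graph guarantee success on
names of points of `W`. The search is a recursive monotone function on finite sequences, and a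
genuine machine for it is built from the compilation of recursive functions into stack programs: one
round of such a program per input symbol, with the stacks simulated on work tapes. -/

theorem REPred.of_exists_computable {f : α → ℕ → Bool} (hf : Computable₂ f) :
    REPred fun a => ∃ n, f a n = true := by
  have h : Partrec fun a => Nat.rfind fun n => (Part.some (f a n) : Part Bool) :=
    Partrec.rfind hf.partrec₂
  refine h.dom_re.of_eq fun a => Nat.rfind_dom'.trans ?_
  constructor
  · rintro ⟨n, hn, -⟩
    exact ⟨n, (Part.mem_some_iff.1 hn).symm⟩
  · rintro ⟨n, hn⟩
    exact ⟨n, Part.mem_some_iff.2 hn.symm, fun _ => trivial⟩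

/-- The witness is the amount of fuel that `evaln` needs. A primitive recursive matrix is what makes
dovetailing possible in the closure properties below. -/
theorem REPred.exists_primrec {p : α → Prop} (hp : REPred p) :
    ∃ f : α → ℕ → Bool, Primrec₂ f ∧ ∀ a, p a ↔ ∃ n, f a n = true := by
  obtain ⟨c, hc⟩ := Nat.Partrec.Code.exists_code.1 hp
  refine ⟨fun a n => (Nat.Partrec.Code.evaln n c (Encodable.encode a)).isSome, ?_, fun a => ?_⟩
  · exact Primrec.option_isSome.comp (Nat.Partrec.Code.primrec_evaln.comp
      (((Primrec.snd (α := α) (β := ℕ)).pair (Primrec.const c)).pair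
        (Primrec.encode.comp Primrec.fst)))
  · have h1 : p a ↔ (c.eval (Encodable.encode a)).Dom := by
      rw [hc]
      simp [Part.assert]
    rw [h1, Part.dom_iff_mem]
    simp only [Nat.Partrec.Code.evaln_complete, Option.isSome_iff_exists, Option.mem_def]
    exact exists_comm

theorem REPred.comp {p : β → Prop} (hp : REPred p) {f : α → β} (hf : Computable f) :
    REPred fun a => p (f a) :=
  Partrec.comp hp hf

/-- A single search runs through pairs consisting of a code of `b` and a witness for `p a b`; codes
that do not decode count as failures. -/
theorem REPred.exists {p : α → β → Prop} (hp : REPred fun x : α × β => p x.1 x.2) :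
    REPred fun a => ∃ b, p a b := by
  obtain ⟨f, hf, h⟩ := hp.exists_primrec
  have hg : Computable₂ fun (a : α) (n : ℕ) =>
      ((Encodable.decode (α := β) n.unpair.1).map fun b => f (a, b) n.unpair.2).getD false :=
    (Primrec.option_getD.comp
      (Primrec.option_map (Primrec.decode.comp (Primrec.fst.comp (Primrec.unpair.comp Primrec.snd)))
        (hf.comp₂ (Primrec₂.pair.comp₂ (Primrec.fst.comp₂ Primrec₂.left) Primrec₂.right)
          ((Primrec.snd.comp (Primrec.unpair.comp Primrec.snd)).comp₂ Primrec₂.left)))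
      (Primrec.const false)).to_comp
  refine (REPred.of_exists_computable hg).of_eq fun a => ⟨?_, ?_⟩
  · rintro ⟨n, hn⟩
    cases hd : Encodable.decode (α := β) n.unpair.1 with
    | none => simp [hd] at hn
    | some b => exact ⟨b, (h (a, b)).2 ⟨n.unpair.2, by simpa [hd] using hn⟩⟩
  · rintro ⟨b, hb⟩
    obtain ⟨n, hn⟩ := (h (a, b)).1 hb
    exact ⟨Nat.pair (Encodable.encode b) n, by simpa using hn⟩

theorem REPred.and {p q : α → Prop} (hp : REPred p) (hq : REPred q) :
    REPred fun a => p a ∧ q a := by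
  have := Partrec.bind hp (Partrec.comp hq Computable.fst : Partrec fun x : α × Unit => _).to₂
  refine this.dom_re.of_eq fun a => ?_
  simp [Part.bind_dom, Part.assert]

theorem REPred.or {p q : α → Prop} (hp : REPred p) (hq : REPred q) :
    REPred fun a => p a ∨ q a := by
  obtain ⟨f, hf, hfp⟩ := hp.exists_primrec
  obtain ⟨g, hg, hgq⟩ := hq.exists_primrec
  refine (REPred.of_exists_computable (f := fun a n => f a n || g a n)
    (Primrec.or.comp hf hg).to_comp).of_eq fun a => ?_
  simp [hfp, hgq, exists_or]

/-- Finitely many witnesses have a common bound, so a search for that bound with a decidable bounded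
matrix replaces the quantifier. -/
theorem REPred.forall_lt {p : α → ℕ → Prop} (hp : REPred fun x : α × ℕ => p x.1 x.2)
    {b : α → ℕ} (hb : Computable b) : REPred fun a => ∀ i < b a, p a i := by
  obtain ⟨f, hf, h⟩ := hp.exists_primrec
  have hr : PrimrecRel fun (N : List ℕ) (y : α × ℕ) => ∃ n ∈ N, f y n = true :=
    PrimrecRel.exists_mem_list (R := fun (n : ℕ) (y : α × ℕ) => f y n = true)
      (Primrec.eq.comp (hf.comp Primrec.snd Primrec.fst) (Primrec.const true))
  have hr2 : PrimrecRel fun (M : List ℕ) (y : α × ℕ) =>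
      ∀ i ∈ M, ∃ n ∈ List.range y.2, f (y.1, i) n = true :=
    PrimrecRel.forall_mem_list
      (R := fun (i : ℕ) (y : α × ℕ) => ∃ n ∈ List.range y.2, f (y.1, i) n = true)
      (hr.comp (Primrec.list_range.comp (Primrec.snd.comp Primrec.snd))
        ((Primrec.fst.comp Primrec.snd).pair Primrec.fst))
  have hd := hr2.decide.to_comp.comp (Primrec.list_range.to_comp.comp (hb.comp Computable.fst))
    (Computable.id (α := α × ℕ))
  refine (REPred.of_exists_computable hd.to₂).of_eq fun a => ?_
  simp only [decide_eq_true_eq, id, List.mem_range]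
  constructor
  · rintro ⟨N, hN⟩ i hi
    obtain ⟨n, -, hn⟩ := hN i hi
    exact (h (a, i)).2 ⟨n, hn⟩
  · intro H
    have : ∀ i : ℕ, ∃ n, i < b a → f (a, i) n = true := fun i => by
      by_cases hi : i < b a
      · obtain ⟨n, hn⟩ := (h (a, i)).1 (H i hi)
        exact ⟨n, fun _ => hn⟩
      · exact ⟨0, fun h => absurd h hi⟩
    choose n hn using this
    refine ⟨(Finset.range (b a)).sup n + 1, fun i hi => ⟨n i, ?_, hn i hi⟩⟩
    exact Nat.lt_succ_of_le (Finset.le_sup (Finset.mem_range.2 hi))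

theorem REPred.const (p : Prop) : REPred fun _ : α => p := by
  classical
  exact (Computable.computablePred (p := fun _ : α => p) (Computable.const (decide p))).to_re

theorem PrimrecPred.comp_re {p : β → Prop} (hp : PrimrecPred p) {f : α → β} (hf : Computable f) :
    REPred fun a => p (f a) :=
  hp.computablePred.to_re.comp hf

theorem REPred.lt {f g : α → ℕ} (hf : Computable f) (hg : Computable g) :
    REPred fun a => f a < g a :=
  PrimrecPred.comp_re (p := fun x : ℕ × ℕ => x.1 < x.2) Primrec.nat_lt (hf.pair hg)

theorem REPred.le {f g : α → ℕ} (hf : Computable f) (hg : Computable g) :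
    REPred fun a => f a ≤ g a :=
  PrimrecPred.comp_re (p := fun x : ℕ × ℕ => x.1 ≤ x.2) Primrec.nat_le (hf.pair hg)

theorem REPred.eq {f g : α → β} (hf : Computable f) (hg : Computable g) :
    REPred fun a => f a = g a :=
  PrimrecPred.comp_re (p := fun x : β × β => x.1 = x.2) Primrec.eq (hf.pair hg)

theorem REPred.exists_mem_list {p : α → β → Prop} (hp : REPred fun x : α × β => p x.1 x.2)
    {L : α → List β} (hL : Computable L) : REPred fun a => ∃ b ∈ L a, p a b := by
  refine (REPred.exists (p := fun a b => (∃ i : ℕ, (L a)[i]? = some b) ∧ p a b)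
    ((REPred.exists (p := fun (x : α × β) (i : ℕ) => (L x.1)[i]? = some x.2)
      (REPred.eq ?_ ?_)).and hp)).of_eq fun a => ?_
  · exact Computable.list_getElem?.comp (hL.comp (Computable.fst.comp Computable.fst))
      Computable.snd
  · exact Computable.option_some.comp (Computable.snd.comp Computable.fst)
  · simp [List.mem_iff_getElem?]

theorem REPred.forall_mem_list {p : α → β → Prop} (hp : REPred fun x : α × β => p x.1 x.2)
    {L : α → List β} (hL : Computable L) : REPred fun a => ∀ b ∈ L a, p a b := by
  refine (REPred.forall_lt (p := fun a i => ∃ b, (L a)[i]? = some b ∧ p a b)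
    (REPred.exists (REPred.and (REPred.eq ?_ ?_) ?_)) (Computable.list_length.comp hL)).of_eq
      fun a => ?_
  · exact Computable.list_getElem?.comp (hL.comp (Computable.fst.comp Computable.fst))
      (Computable.snd.comp Computable.fst)
  · exact Computable.option_some.comp Computable.snd
  · exact hp.comp ((Computable.fst.comp Computable.fst).pair Computable.snd)
  · constructor
    · intro h b hb
      obtain ⟨i, hi, rfl⟩ := List.mem_iff_getElem.1 hb
      obtain ⟨b', hb', hp'⟩ := h i hi
      rw [List.getElem?_eq_getElem hi] at hb'
      exact Option.some_injective _ hb' ▸ hp'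
    · intro h i hi
      exact ⟨_, List.getElem?_eq_getElem hi, h _ (List.getElem_mem hi)⟩

/-- A semi-decidable total relation has a recursive choice function. -/
theorem REPred.exists_computable {p : α → β → Prop} (hp : REPred fun x : α × β => p x.1 x.2)
    (h : ∀ a, ∃ b, p a b) : ∃ f : α → β, Computable f ∧ ∀ a, p a (f a) := by
  obtain ⟨t, ht, hpt⟩ := hp.exists_primrec
  let g : α → ℕ → Option β := fun a n => (Encodable.decode (α := β) n.unpair.1).bind fun b =>
    bif t (a, b) n.unpair.2 then some b else none
  have hg : Computable₂ g := by
    refine (Primrec.option_bind (Primrec.decode.comp (Primrec.fst.comp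
      (Primrec.unpair.comp Primrec.snd))) (Primrec₂.mk (Primrec.cond ?_ ?_ ?_))).to_comp
    · exact ht.comp ((Primrec.fst.comp Primrec.fst).pair Primrec.snd)
        (Primrec.snd.comp (Primrec.unpair.comp (Primrec.snd.comp Primrec.fst)))
    · exact Primrec.option_some.comp Primrec.snd
    · exact Primrec.const none
  have hgp : ∀ a n b, b ∈ g a n → p a b := by
    intro a n b hb
    simp only [g, Option.mem_def, Option.bind_eq_some_iff] at hb
    obtain ⟨b', -, hb'⟩ := hb
    cases hc : t (a, b') n.unpair.2
    · simp [hc] at hb'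
    · simp only [hc, cond_true, Option.some.injEq] at hb'
      exact hb' ▸ (hpt (a, b')).2 ⟨_, hc⟩
  have hdom : ∀ a, (Nat.rfindOpt (g a)).Dom := fun a => by
    rw [Nat.rfindOpt_dom]
    obtain ⟨b, hb⟩ := h a
    obtain ⟨n, hn⟩ := (hpt (a, b)).1 hb
    exact ⟨Nat.pair (Encodable.encode b) n, b, by simp [g, hn]⟩
  refine ⟨fun a => (Nat.rfindOpt (g a)).get (hdom a),
    (Partrec.rfindOpt hg).of_eq_tot fun a => Part.get_mem _, fun a => ?_⟩
  obtain ⟨n, hn⟩ := Nat.rfindOpt_spec (Part.get_mem (hdom a))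
  exact hgp a n _ hn

end SemiDecidable

/-! ### Semi-decidable relations between indices -/

namespace Presentation

section Relations

variable {X : Type*} [MetricSpace X] (P : Presentation X)

/-- The points with indices `u` and `v` are more than `2^(-n) + 2^(-m)` apart. -/
def Far (u v n m : ℕ) : Prop :=
  ∃ x ∈ P.enum u, ∃ y ∈ P.enum v, (2⁻¹ : ℝ) ^ n + (2⁻¹ : ℝ) ^ m < dist x y

/-- The distance of the points with indices `u` and `v` is less than `2^(-n) - 2^(-m)`. -/
def Near (u v n m : ℕ) : Prop :=
  ∃ x ∈ P.enum u, ∃ y ∈ P.enum v, dist x y + (2⁻¹ : ℝ) ^ m < (2⁻¹ : ℝ) ^ n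

/-- The closed ball of radius `2^(-n)` around the point with index `u` is disjoint from `W`. -/
def Misses (W : Set X) (u n : ℕ) : Prop :=
  ∀ x ∈ P.enum u, ∀ w ∈ W, (2⁻¹ : ℝ) ^ n < dist x w

/-- The open ball of radius `2^(-n)` around the point with index `u` meets `W`. -/
def Hits (W : Set X) (u n : ℕ) : Prop :=
  ∃ x ∈ P.enum u, ∃ w ∈ W, dist x w < (2⁻¹ : ℝ) ^ n

end Relations

end Presentation

/-! ### Semi-decidability of distance comparisons -/

theorem Nat.primrec_pow : Primrec₂ ((· ^ ·) : ℕ → ℕ → ℕ) :=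
  Primrec₂.unpaired'.1 Nat.Primrec.pow

theorem Nat.computable_two_pow {α : Type*} [Primcodable α] {f : α → ℕ} (hf : Computable f) :
    Computable fun a => 2 ^ f a :=
  Nat.primrec_pow.to_comp.comp (Computable.const 2) hf

theorem Int.primrec_natCast : Primrec (fun n : ℕ => (n : ℤ)) := by
  refine Primrec.encode_iff.1 (Primrec.nat_double.of_eq fun n => ?_)
  rfl

namespace Presentation

section Computability

variable {X : Type*} [MetricSpace X] {P : Presentation X} {α : Type*} [Primcodable α]

theorem ComputablyCompact.dom_re (hP : P.ComputablyCompact) {u : α → ℕ} (hu : Computable u) :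
    REPred fun a => u a ∈ P.enum.Dom :=
  hP.1.to_re.comp hu

theorem ComputablyCompact.not_dom_re (hP : P.ComputablyCompact) {u : α → ℕ}
    (hu : Computable u) : REPred fun a => u a ∉ P.enum.Dom :=
  hP.1.not.to_re.comp hu

theorem ComputablyCompact.bound (hP : P.ComputablyCompact) {m : α → ℕ} (hm : Computable m) :
    Computable fun a => 2 ^ P.D (m a) :=
  Nat.computable_two_pow (hP.2.1.comp hm)

theorem ComputablyCompact.far_re (hP : P.ComputablyCompact) {u v n m : α → ℕ}
    (hu : Computable u) (hv : Computable v) (hn : Computable n) (hm : Computable m) :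
    REPred fun a => P.Far (u a) (v a) (n a) (m a) := by
  have hnm := Primrec.nat_add.to_comp.comp hn hm
  -- Over the denominator `2^(n+m)` the threshold is the integer `2^m + 2^n`. The upper bound 2 is
  -- vacuous since distances are at most 1.
  refine (hP.2.2.comp (f := fun a => (((2 ^ m a + 2 ^ n a : ℕ) : ℤ),
    ((2 * 2 ^ (n a + m a) : ℕ) : ℤ), n a + m a, u a, v a)) ?_).of_eq fun a => ?_
  · exact (Int.primrec_natCast.to_comp.comp (Primrec.nat_add.to_comp.comp
      (Nat.computable_two_pow hm) (Nat.computable_two_pow hn))).pair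
      ((Int.primrec_natCast.to_comp.comp (Primrec.nat_double.to_comp.comp
      (Nat.computable_two_pow hnm))).pair (hnm.pair (hu.pair hv)))
  · refine exists_congr fun x => and_congr_right fun _ => exists_congr fun y =>
      and_congr_right fun _ => ?_
    have h1 : (((2 ^ m a + 2 ^ n a : ℕ) : ℤ) : ℝ) / 2 ^ (n a + m a)
        = (2⁻¹ : ℝ) ^ n a + (2⁻¹ : ℝ) ^ m a := by
      push_cast
      rw [inv_pow, inv_pow, pow_add]
      field_simp
    have h2 : (((2 * 2 ^ (n a + m a) : ℕ) : ℤ) : ℝ) / 2 ^ (n a + m a) = 2 := by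
      push_cast
      field_simp
    rw [h1, h2]
    exact and_iff_left ((P.diam_le x y).trans_lt (by norm_num))

theorem ComputablyCompact.near_re (hP : P.ComputablyCompact) {u v n m : α → ℕ}
    (hu : Computable u) (hv : Computable v) (hn : Computable n) (hm : Computable m) :
    REPred fun a => P.Near (u a) (v a) (n a) (m a) := by
  have hnm := Primrec.nat_add.to_comp.comp hn hm
  refine (hP.2.2.comp (f := fun a => ((-1 : ℤ), ((2 ^ m a - 2 ^ n a : ℕ) : ℤ),
    n a + m a, u a, v a)) ?_).of_eq fun a => ?_
  · exact (Computable.const _).pair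
      ((Int.primrec_natCast.to_comp.comp (Primrec.nat_sub.to_comp.comp
      (Nat.computable_two_pow hm) (Nat.computable_two_pow hn))).pair (hnm.pair (hu.pair hv)))
  · refine exists_congr fun x => and_congr_right fun _ => exists_congr fun y =>
      and_congr_right fun _ => ?_
    have h0 : ((-1 : ℤ) : ℝ) / 2 ^ (n a + m a) < dist x y :=
      lt_of_lt_of_le (div_neg_of_neg_of_pos (by norm_num) (by positivity)) dist_nonneg
    rw [and_iff_right h0]
    rcases le_total (n a) (m a) with h | h
    · have h1 : (((2 ^ m a - 2 ^ n a : ℕ) : ℤ) : ℝ) / 2 ^ (n a + m a)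
          = (2⁻¹ : ℝ) ^ n a - (2⁻¹ : ℝ) ^ m a := by
        rw [Int.cast_natCast, Nat.cast_sub (Nat.pow_le_pow_right (by norm_num) h)]
        push_cast
        rw [inv_pow, inv_pow, pow_add]
        field_simp
      rw [h1, lt_sub_iff_add_lt]
    -- For `m ≤ n` the natural subtraction truncates to 0; then both sides are false, because
    -- distances are non-negative.
    · have h1 : 2 ^ m a - 2 ^ n a = 0 :=
        Nat.sub_eq_zero_of_le (Nat.pow_le_pow_right (by norm_num) h)
      have h2 : (2⁻¹ : ℝ) ^ n a ≤ (2⁻¹ : ℝ) ^ m a :=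
        pow_le_pow_of_le_one (by norm_num) (by norm_num) h
      have h3 := dist_nonneg (x := x) (y := y)
      simp only [h1, Nat.cast_zero, Int.cast_zero, zero_div]
      constructor <;> intro h4 <;> linarith

end Computability

/-! ### Powers of one half and approximation by indexed points -/

section Metric

variable {X : Type*} [MetricSpace X] (P : Presentation X)

theorem exists_index (m : ℕ) (x : X) :
    ∃ u < 2 ^ P.D m, ∃ y ∈ P.enum u, dist y x ≤ (2⁻¹ : ℝ) ^ (m + 1) := by
  obtain ⟨y, ⟨u, hu, hy⟩, hd⟩ := (P.covering m).exists_mem x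
  exact ⟨u, hu, y, hy, by rwa [dist_comm]⟩

theorem half_pow_pos (n : ℕ) : (0 : ℝ) < (2⁻¹ : ℝ) ^ n := by positivity

theorem half_pow_succ (n : ℕ) : (2⁻¹ : ℝ) ^ (n + 1) = (2⁻¹ : ℝ) ^ n / 2 := by
  rw [pow_succ]; ring

theorem half_pow_le {m n : ℕ} (h : m ≤ n) : (2⁻¹ : ℝ) ^ n ≤ (2⁻¹ : ℝ) ^ m :=
  pow_le_pow_of_le_one (by norm_num) (by norm_num) h

theorem exists_half_pow_lt {ε : ℝ} (h : 0 < ε) : ∃ n, (2⁻¹ : ℝ) ^ n < ε :=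
  exists_pow_lt_of_lt_one h (by norm_num)

theorem exists_index_lt {x : X} {ε : ℝ} (h : 0 < ε) : ∃ u, ∃ y ∈ P.enum u, dist y x < ε := by
  obtain ⟨n, hn⟩ := exists_half_pow_lt h
  obtain ⟨u, -, y, hy, hd⟩ := P.exists_index n x
  exact ⟨u, y, hy, hd.trans_lt ((half_pow_le n.le_succ).trans_lt hn)⟩

theorem tendsto_half_pow : Filter.Tendsto (fun n : ℕ => (2⁻¹ : ℝ) ^ n) Filter.atTop (nhds 0) :=
  tendsto_pow_atTop_nhds_zero_of_lt_one (by norm_num) (by norm_num)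

theorem tendsto_of_dist_le_half_pow {x v : ℕ → X} {φ : ℕ → ℕ} (hφ : StrictMono φ) {z : X}
    (hx : Filter.Tendsto (x ∘ φ) Filter.atTop (nhds z))
    (hd : ∀ n, dist (x n) (v n) ≤ (2⁻¹ : ℝ) ^ n) :
    Filter.Tendsto (v ∘ φ) Filter.atTop (nhds z) := by
  refine (tendsto_iff_of_dist ?_).1 hx
  exact squeeze_zero (fun _ => dist_nonneg) (fun n => hd (φ n))
    (tendsto_half_pow.comp hφ.tendsto_atTop)

end Metric

end Presentation

/-! ### Characterisation of co-computable and computable sets by balls -/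

namespace Presentation

section Sets

variable {X : Type*} [MetricSpace X] {P : Presentation X}

theorem misses_re_comp {α : Type*} [Primcodable α] {W : Set X}
    (h : REPred fun p : ℕ × ℕ => P.Misses W p.1 p.2) {u n : α → ℕ} (hu : Computable u)
    (hn : Computable n) : REPred fun a => P.Misses W (u a) (n a) :=
  h.comp (hu.pair hn)

theorem hits_re_comp {α : Type*} [Primcodable α] {W : Set X}
    (h : REPred fun p : ℕ × ℕ => P.Hits W p.1 p.2) {u n : α → ℕ} (hu : Computable u)
    (hn : Computable n) : REPred fun a => P.Hits W (u a) (n a) :=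
  h.comp (hu.pair hn)

/-- Emptiness is certified by an undefined centre or by a precision `m` at which every index below
`2^(D m)` is refuted by `V`, by `W` or by one of the balls. A common point would be approximated by
an index that survives. Conversely, if some index survives at every precision, a subsequence of the
surviving points converges, and the limit is a common point because all the sets are closed and the
errors tend to 0. -/
theorem ComputablyCompact.not_exists_mem_inter_re [CompactSpace X] (hP : P.ComputablyCompact)
    {V W : Set X} (hVc : IsClosed V) (hWc : IsClosed W)
    (hV : REPred fun p : ℕ × ℕ => P.Misses V p.1 p.2)
    (hW : REPred fun p : ℕ × ℕ => P.Misses W p.1 p.2) :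
    REPred fun L : List (ℕ × ℕ) =>
      ¬ ∃ w ∈ V ∩ W, ∀ p ∈ L, ∃ x ∈ P.enum p.1, dist x w ≤ (2⁻¹ : ℝ) ^ p.2 := by
  refine (REPred.or (p := fun L : List (ℕ × ℕ) => ∃ p ∈ L, p.1 ∉ P.enum.Dom)
    (q := fun L : List (ℕ × ℕ) => ∃ m, ∀ a < 2 ^ P.D m, (P.Misses V a m ∨ P.Misses W a m) ∨
      ∃ p ∈ L, P.Far a p.1 p.2 m) ?_ ?_).of_eq fun L => ?_
  · exact REPred.exists_mem_list (hP.not_dom_re (Computable.fst.comp Computable.snd)) Computable.id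
  · refine REPred.exists ?_
    refine REPred.forall_lt ?_ (hP.bound Computable.snd)
    refine REPred.or (REPred.or ?_ ?_) ?_
    · exact misses_re_comp hV Computable.snd (Computable.snd.comp Computable.fst)
    · exact misses_re_comp hW Computable.snd (Computable.snd.comp Computable.fst)
    · refine REPred.exists_mem_list ?_ (Computable.fst.comp Computable.fst)
      exact hP.far_re (Computable.snd.comp Computable.fst) (Computable.fst.comp Computable.snd)
        (Computable.snd.comp Computable.snd)
        (Computable.snd.comp (Computable.fst.comp Computable.fst))
  constructor
  · rintro (⟨p, hp, hd⟩ | ⟨m, hm⟩) ⟨w, ⟨hwV, hwW⟩, hw⟩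
    · obtain ⟨x, hx, -⟩ := hw p hp
      exact hd (Part.dom_iff_mem.2 ⟨x, hx⟩)
    · obtain ⟨a, ha, x, hx, hd⟩ := P.exists_index m w
      have hd' := hd.trans (half_pow_le m.le_succ)
      rcases hm a ha with (h | h) | ⟨p, hp, x', hx', y, hy, hf⟩
      · exact absurd hd' (not_le.2 (h x hx w hwV))
      · exact absurd hd' (not_le.2 (h x hx w hwW))
      · obtain ⟨y', hy', hyd⟩ := hw p hp
        obtain rfl := Part.mem_unique hx hx'
        obtain rfl := Part.mem_unique hy hy'
        have := dist_triangle_right x y w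
        linarith
  · intro hno
    by_contra! hc
    obtain ⟨hdom, hc⟩ := hc
    choose a ha hav ha2 using hc
    simp only [Misses, not_forall, not_lt] at hav
    choose h1 h2 using hav
    choose x hx v hv hxv using h1
    choose x' hx' w hw hxw using h2
    have hxx : ∀ m, x' m = x m := fun m => Part.mem_unique (hx' m) (hx m)
    simp only [hxx] at hxw
    obtain ⟨z, φ, hφ, hz⟩ := CompactSpace.tendsto_subseq x
    refine hno ⟨z, ⟨?_, ?_⟩, fun p hp => ?_⟩
    · exact hVc.mem_of_tendsto (tendsto_of_dist_le_half_pow hφ hz hxv)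
        (Filter.Eventually.of_forall fun n => hv _)
    · exact hWc.mem_of_tendsto (tendsto_of_dist_le_half_pow hφ hz hxw)
        (Filter.Eventually.of_forall fun n => hw _)
    · obtain ⟨y, hy⟩ := Part.dom_iff_mem.1 (hdom p hp)
      refine ⟨y, hy, ?_⟩
      have h3 : ∀ n, dist y ((x ∘ φ) n) ≤ (2⁻¹ : ℝ) ^ p.2 + (2⁻¹ : ℝ) ^ φ n := fun n => by
        have := ha2 (φ n) p hp
        by_contra hlt
        exact this ⟨x (φ n), hx _, y, hy, by rw [dist_comm]; exact not_le.1 hlt⟩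
      have h4 := (tendsto_half_pow.comp hφ.tendsto_atTop).const_add ((2⁻¹ : ℝ) ^ p.2)
      rw [add_zero] at h4
      exact le_of_tendsto_of_tendsto' (tendsto_const_nhds.dist hz) h4 h3

theorem misses_univ_iff {u n : ℕ} : P.Misses Set.univ u n ↔ u ∉ P.enum.Dom := by
  constructor
  · intro h hu
    obtain ⟨x, hx⟩ := Part.dom_iff_mem.1 hu
    have := h x hx x trivial
    rw [dist_self] at this
    exact absurd this (not_lt.2 (half_pow_pos n).le)
  · exact fun h x hx => absurd (Part.dom_iff_mem.2 ⟨x, hx⟩) h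

theorem ComputablyCompact.misses_univ_re (hP : P.ComputablyCompact) :
    REPred fun p : ℕ × ℕ => P.Misses Set.univ p.1 p.2 :=
  (hP.not_dom_re Computable.fst).of_eq fun _ => misses_univ_iff.symm

theorem misses_iff {W : Set X} {u n : ℕ} : P.Misses W u n ↔ u ∉ P.enum.Dom ∨
    ¬ ∃ w ∈ W, ∃ x ∈ P.enum u, dist x w ≤ (2⁻¹ : ℝ) ^ n := by
  constructor
  · intro h
    refine or_iff_not_imp_left.2 fun _ => ?_
    rintro ⟨w, hw, x, hx, hd⟩
    exact absurd hd (not_le.2 (h x hx w hw))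
  · rintro (h | h) x hx w hw
    · exact absurd (Part.dom_iff_mem.2 ⟨x, hx⟩) h
    · exact not_le.1 fun hd => h ⟨w, hw, x, hx, hd⟩

theorem ComputablyCompact.misses_re_of_not_exists (hP : P.ComputablyCompact) {W : Set X}
    (h : REPred fun L : List (ℕ × ℕ) =>
      ¬ ∃ w ∈ W, ∀ p ∈ L, ∃ x ∈ P.enum p.1, dist x w ≤ (2⁻¹ : ℝ) ^ p.2) :
    REPred fun p : ℕ × ℕ => P.Misses W p.1 p.2 := by
  refine ((hP.not_dom_re Computable.fst).or (h.comp (f := fun p : ℕ × ℕ => [p])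
    (Computable.list_cons.comp Computable.id (Computable.const [])))).of_eq fun p => ?_
  rw [misses_iff]
  simp only [List.mem_singleton, forall_eq]

theorem image_finset_finite (A : Finset ℕ) : (P.enum.image (A : Set ℕ)).Finite := by
  have : P.enum.image (A : Set ℕ) = ⋃ a ∈ A, {x | x ∈ P.enum a} := by
    ext x
    simp [PFun.image, SetRel.mem_image, PFun.graph']
  rw [this]
  refine A.finite_toSet.biUnion fun a _ => Set.Subsingleton.finite fun x hx y hy =>
    Part.mem_unique hx hy

/-- The Hausdorff distance turns into pointwise conditions with attained minima, since `W` is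
compact and the set of points listed by `A m` is finite. -/
theorem isSetName_iff {A : ℕ → Finset ℕ} {W : Set X} (hW : IsCompact W) (hne : W.Nonempty) :
    P.IsSetName A W ↔ ∀ m, (∀ a ∈ A m, a < 2 ^ P.D m ∧
      ∃ x ∈ P.enum a, ∃ w ∈ W, dist x w ≤ (2⁻¹ : ℝ) ^ m) ∧
      ∀ w ∈ W, ∃ a ∈ A m, ∃ x ∈ P.enum a, dist x w ≤ (2⁻¹ : ℝ) ^ m := by
  refine forall_congr' fun m => ⟨?_, ?_⟩
  · rintro ⟨⟨a₀, ha₀⟩, hA, hd⟩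
    have hfin := P.image_finset_finite (A m)
    have hne' : (P.enum.image (A m : Set ℕ)).Nonempty := by
      obtain ⟨x, hx⟩ := Part.dom_iff_mem.1 (hA a₀ ha₀).2
      exact ⟨x, a₀, ha₀, hx⟩
    have htop := Metric.hausdorffEDist_ne_top_of_nonempty_of_bounded hne' hne
      hfin.isBounded hW.isBounded
    constructor
    · intro a ha
      obtain ⟨x, hx⟩ := Part.dom_iff_mem.1 (hA a ha).2
      obtain ⟨w, hw, he⟩ := hW.exists_infDist_eq_dist hne x
      exact ⟨(hA a ha).1, x, hx, w, hw, he ▸ (Metric.infDist_le_hausdorffDist_of_mem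
        (s := P.enum.image (A m : Set ℕ)) ⟨a, ha, hx⟩ htop).trans hd⟩
    · intro w hw
      obtain ⟨x, ⟨a, ha, hx⟩, he⟩ := hfin.isCompact.exists_infDist_eq_dist hne' w
      refine ⟨a, ha, x, hx, ?_⟩
      rw [dist_comm, ← he]
      rw [Metric.hausdorffEDist_comm] at htop
      rw [Metric.hausdorffDist_comm] at hd
      exact (Metric.infDist_le_hausdorffDist_of_mem hw htop).trans hd
  · rintro ⟨h1, h2⟩
    obtain ⟨w₀, hw₀⟩ := hne
    refine ⟨?_, fun a ha => ⟨(h1 a ha).1, ?_⟩, Metric.hausdorffDist_le_of_mem_dist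
      (half_pow_pos m).le ?_ ?_⟩
    · obtain ⟨a, ha, -⟩ := h2 w₀ hw₀
      exact ⟨a, ha⟩
    · obtain ⟨x, hx, -⟩ := (h1 a ha).2
      exact Part.dom_iff_mem.2 ⟨x, hx⟩
    · rintro x ⟨a, ha, hx⟩
      obtain ⟨x', hx', w, hw, hd⟩ := (h1 a ha).2
      obtain rfl := Part.mem_unique hx hx'
      exact ⟨w, hw, hd⟩
    · intro w hw
      obtain ⟨a, ha, x, hx, hd⟩ := h2 w hw
      exact ⟨x, ⟨a, ha, hx⟩, by rwa [dist_comm]⟩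

/-- Given a name, a ball misses `W` exactly if at some level `m` every index is either removed from
`A m` or far from the centre; the positive distance to the compact set `W` supplies the level.
Conversely, the indices below `2^(D m)` whose closed ball of radius `2^(-m)` meets `W` form a name,
and their complement is enumerated by `Misses`. -/
theorem ComputablyCompact.isCoComputableSet_iff [CompactSpace X] (hP : P.ComputablyCompact)
    {W : Set X} : P.IsCoComputableSet W ↔
      IsCompact W ∧ REPred fun p : ℕ × ℕ => P.Misses W p.1 p.2 := by
  classical
  refine and_congr_right fun hWc => ?_
  rcases W.eq_empty_or_nonempty with rfl | hne
  · refine iff_of_true (fun h => absurd h Set.not_nonempty_empty) ?_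
    exact (REPred.const True).of_eq fun p => by simp [Misses]
  rw [forall_prop_of_true hne]
  constructor
  · rintro ⟨A, hA, hr⟩
    rw [isSetName_iff hWc hne] at hA
    refine (REPred.or (q := fun p : ℕ × ℕ => ∃ m, ∀ a < 2 ^ P.D m, ¬ a ∈ A m ∨ P.Far a p.1 p.2 m)
      (hP.not_dom_re Computable.fst) ?_).of_eq fun p => ?_
    · refine REPred.exists ?_
      refine REPred.forall_lt ?_ (hP.bound Computable.snd)
      refine REPred.or ?_ ?_
      · exact hr.comp (f := fun x : ((ℕ × ℕ) × ℕ) × ℕ => (x.1.2, x.2))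
          ((Computable.snd.comp Computable.fst).pair Computable.snd)
      · exact hP.far_re Computable.snd (Computable.fst.comp (Computable.fst.comp Computable.fst))
          (Computable.snd.comp (Computable.fst.comp Computable.fst))
          (Computable.snd.comp Computable.fst)
    obtain ⟨u, n⟩ := p
    by_cases hu : u ∈ P.enum.Dom
    swap
    · exact iff_of_true (Or.inl hu) (misses_iff.2 (Or.inl hu))
    simp only [hu, not_true, false_or]
    obtain ⟨x, hx⟩ := Part.dom_iff_mem.1 hu
    constructor
    · rintro ⟨m, hm⟩ x' hx' w hw
      obtain rfl := Part.mem_unique hx hx'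
      obtain ⟨a, ha, y, hy, hd⟩ := (hA m).2 w hw
      obtain ⟨y', hy', x', hx', hf⟩ := (hm a ((hA m).1 a ha).1).resolve_left (not_not.2 ha)
      obtain rfl := Part.mem_unique hx hx'
      obtain rfl := Part.mem_unique hy hy'
      have := dist_triangle y w x
      rw [dist_comm w x] at this
      linarith
    · intro h
      -- The distance from `x` to `W` is attained and exceeds `2^(-n)`. Half of the excess pays for
      -- the error of the name, the other half for the margin in `Far`.
      obtain ⟨w₀, hw₀, he⟩ := hWc.exists_infDist_eq_dist hne x
      have hpos := h x hx w₀ hw₀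
      obtain ⟨m, hm⟩ := exists_half_pow_lt (half_pos (sub_pos.2 hpos))
      refine ⟨m, fun a _ => or_iff_not_imp_left.2 fun ha => ?_⟩
      obtain ⟨-, y, hy, w, hw, hd⟩ := (hA m).1 a (not_not.1 ha)
      refine ⟨y, hy, x, hx, ?_⟩
      have h1 : dist x w₀ ≤ dist x w := he ▸ Metric.infDist_le_dist_of_mem hw
      have := dist_triangle x y w
      rw [dist_comm x y] at this
      linarith
  · intro hr
    refine ⟨fun m => (Finset.range (2 ^ P.D m)).filter fun a => ¬ P.Misses W a m,
      (isSetName_iff hWc hne).2 fun m => ⟨fun a ha => ?_, fun w hw => ?_⟩, ?_⟩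
    · rw [Finset.mem_filter, Finset.mem_range] at ha
      refine ⟨ha.1, ?_⟩
      simpa [Misses] using ha.2
    · obtain ⟨a, ha, x, hx, hd⟩ := P.exists_index m w
      have hd' := hd.trans (half_pow_le m.le_succ)
      exact ⟨a, Finset.mem_filter.2 ⟨Finset.mem_range.2 ha, fun h =>
        absurd hd' (not_le.2 (h x hx w hw))⟩, x, hx, hd'⟩
    · refine (REPred.or (REPred.le (hP.bound Computable.fst) Computable.snd)
        (hr.comp (Computable.snd.pair Computable.fst))).of_eq fun p => ?_
      simp only [Finset.mem_filter, Finset.mem_range, not_and, not_not]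
      rw [← not_lt, imp_iff_not_or]

/-- A name is decided by a race between "hits at radius `2^(-m)`" and "misses at radius `2^(-m-1)`".
At least one of the two holds, so a recursive choice exists. Accepted indices are close to `W`; an
index within `2^(-m-1)` of a point of `W` cannot be rejected, and the covering provides such
indices. -/
theorem ComputablyCompact.isComputableSet_iff [CompactSpace X] (hP : P.ComputablyCompact)
    {W : Set X} : P.IsComputableSet W ↔
      IsCompact W ∧ (REPred fun p : ℕ × ℕ => P.Misses W p.1 p.2) ∧
        REPred fun p : ℕ × ℕ => P.Hits W p.1 p.2 := by
  classical
  constructor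
  · rintro ⟨hWc, h⟩
    refine ⟨hWc, (hP.isCoComputableSet_iff.1 ⟨hWc, fun hne => ?_⟩).2, ?_⟩
    · obtain ⟨A, hA, hr⟩ := h hne
      exact ⟨A, hA, hr.not.to_re⟩
    · rcases W.eq_empty_or_nonempty with rfl | hne
      · exact (REPred.const False).of_eq fun p => by simp [Hits]
      obtain ⟨A, hA, hr⟩ := h hne
      rw [isSetName_iff hWc hne] at hA
      have hre : REPred fun p : ℕ × ℕ => ∃ m a, a ∈ A m ∧ P.Near p.1 a p.2 m := by
        refine REPred.exists ?_
        refine REPred.exists ?_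
        refine REPred.and ?_ ?_
        · exact hr.to_re.comp (f := fun x : ((ℕ × ℕ) × ℕ) × ℕ => (x.1.2, x.2))
            ((Computable.snd.comp Computable.fst).pair Computable.snd)
        · exact hP.near_re (Computable.fst.comp (Computable.fst.comp Computable.fst))
            Computable.snd (Computable.snd.comp (Computable.fst.comp Computable.fst))
            (Computable.snd.comp Computable.fst)
      refine hre.of_eq fun p => ?_
      constructor
      · rintro ⟨m, a, ha, x, hx, y, hy, hd⟩
        obtain ⟨-, y', hy', w, hw, hd'⟩ := (hA m).1 a ha
        obtain rfl := Part.mem_unique hy hy'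
        exact ⟨x, hx, w, hw, by linarith [dist_triangle x y w]⟩
      · rintro ⟨x, hx, w, hw, hd⟩
        obtain ⟨m, hm⟩ := exists_half_pow_lt (half_pos (sub_pos.2 hd))
        obtain ⟨a, ha, y, hy, hd'⟩ := (hA m).2 w hw
        exact ⟨m, a, ha, x, hx, y, hy, by linarith [dist_triangle_right x y w]⟩
  · rintro ⟨hWc, hm, hh⟩
    refine ⟨hWc, fun hne => ?_⟩
    have hre : REPred fun x : (ℕ × ℕ) × Bool => (x.2 = true ∧ P.Hits W x.1.1 x.1.2) ∨
        (x.2 = false ∧ P.Misses W x.1.1 (x.1.2 + 1)) :=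
      ((REPred.eq Computable.snd (Computable.const true)).and (hh.comp Computable.fst)).or
        ((REPred.eq Computable.snd (Computable.const false)).and (hm.comp
          ((Computable.fst.comp Computable.fst).pair
            (Computable.succ.comp (Computable.snd.comp Computable.fst)))))
    obtain ⟨f, hf, hfp⟩ := REPred.exists_computable (p := fun (p : ℕ × ℕ) (b : Bool) =>
      (b = true ∧ P.Hits W p.1 p.2) ∨ (b = false ∧ P.Misses W p.1 (p.2 + 1))) hre fun p => by
        by_cases h : P.Misses W p.1 (p.2 + 1)
        · exact ⟨false, Or.inr ⟨rfl, h⟩⟩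
        · refine ⟨true, Or.inl ⟨rfl, ?_⟩⟩
          simp only [Misses, not_forall, not_lt] at h
          obtain ⟨x, hx, w, hw, hd⟩ := h
          exact ⟨x, hx, w, hw, hd.trans_lt (by
            rw [half_pow_succ]; exact half_lt_self (half_pow_pos _))⟩
    refine ⟨fun m => (Finset.range (2 ^ P.D m)).filter fun a => f (a, m) = true,
      (isSetName_iff hWc hne).2 fun m => ⟨fun a ha => ?_, fun w hw => ?_⟩, ?_⟩
    · rw [Finset.mem_filter, Finset.mem_range] at ha
      refine ⟨ha.1, ?_⟩
      rcases hfp (a, m) with ⟨-, x, hx, w, hw, hd⟩ | ⟨h, -⟩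
      · exact ⟨x, hx, w, hw, hd.le⟩
      · simp [h] at ha
    · obtain ⟨a, ha, x, hx, hd⟩ := P.exists_index m w
      refine ⟨a, Finset.mem_filter.2 ⟨Finset.mem_range.2 ha, ?_⟩, x, hx,
        hd.trans (half_pow_le m.le_succ)⟩
      rcases hfp (a, m) with ⟨h, -⟩ | ⟨-, h⟩
      · exact h
      · exact absurd hd (not_le.2 (h x hx w hw))
    · have h1 : ComputablePred fun p : ℕ × ℕ => p.2 < 2 ^ P.D p.1 ∧ f (p.2, p.1) = true := by
        refine ⟨inferInstance, ?_⟩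
        refine ((Primrec.and.to_comp.comp (Primrec.nat_lt.decide.to_comp.comp Computable.snd
          (hP.bound Computable.fst)) (hf.comp (Computable.snd.pair Computable.fst)))).of_eq
            fun p => ?_
        simp
      exact h1.of_eq fun p => by simp

end Sets

end Presentation

/-! ### Unions, intersections, regular sets and computable points -/

namespace Presentation

section SetOperations

variable {X : Type*} [MetricSpace X] {P : Presentation X}

theorem hits_univ_iff {u n : ℕ} : P.Hits Set.univ u n ↔ u ∈ P.enum.Dom := by
  constructor
  · rintro ⟨x, hx, -⟩
    exact Part.dom_iff_mem.2 ⟨x, hx⟩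
  · intro hu
    obtain ⟨x, hx⟩ := Part.dom_iff_mem.1 hu
    exact ⟨x, hx, x, trivial, by rw [dist_self]; exact half_pow_pos n⟩

theorem misses_union_iff {V W : Set X} {u n : ℕ} :
    P.Misses (V ∪ W) u n ↔ P.Misses V u n ∧ P.Misses W u n := by
  simp only [Misses, Set.mem_union, or_imp, forall_and]

theorem hits_union_iff {V W : Set X} {u n : ℕ} :
    P.Hits (V ∪ W) u n ↔ P.Hits V u n ∨ P.Hits W u n := by
  simp only [Hits, Set.mem_union, or_and_right, exists_or, and_or_left]

theorem IsComputableSet.isCoComputableSet {W : Set X} (hW : P.IsComputableSet W) :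
    P.IsCoComputableSet W :=
  ⟨hW.1, fun hne => by
    obtain ⟨A, hA, hr⟩ := hW.2 hne
    exact ⟨A, hA, hr.not.to_re⟩⟩

theorem IsComputablePoint.isComputableSet_singleton {x : X} (hx : P.IsComputablePoint x) :
    P.IsComputableSet {x} := by
  obtain ⟨u, hu, hux⟩ := hx
  refine ⟨isCompact_singleton, fun hne => ⟨fun m => {u m}, ?_, ?_⟩⟩
  · rw [isSetName_iff isCompact_singleton hne]
    intro m
    simpa only [Finset.mem_singleton, forall_eq, Set.mem_singleton_iff, exists_eq_left,
      and_self_right, and_assoc] using And.intro (hux m) (hux m).2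
  · refine (computablePred_iff_computable_decide.2 ?_ :
      ComputablePred fun p : ℕ × ℕ => p.2 = u p.1).of_eq fun p => by simp
    exact Primrec.eq.decide.to_comp.comp Computable.snd (hu.comp Computable.fst)

variable [CompactSpace X]

theorem ComputablyCompact.isComputableSet_univ (hP : P.ComputablyCompact) :
    P.IsComputableSet (Set.univ : Set X) :=
  hP.isComputableSet_iff.2 ⟨isCompact_univ, hP.misses_univ_re,
    (hP.dom_re Computable.fst).of_eq fun _ => hits_univ_iff.symm⟩

theorem ComputablyCompact.isComputableSet_union (hP : P.ComputablyCompact) {V W : Set X}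
    (hV : P.IsComputableSet V) (hW : P.IsComputableSet W) : P.IsComputableSet (V ∪ W) := by
  rw [hP.isComputableSet_iff] at *
  exact ⟨hV.1.union hW.1, (hV.2.1.and hW.2.1).of_eq fun _ => misses_union_iff.symm,
    (hV.2.2.or hW.2.2).of_eq fun _ => hits_union_iff.symm⟩

theorem ComputablyCompact.isCoComputableSet_union (hP : P.ComputablyCompact) {V W : Set X}
    (hV : P.IsCoComputableSet V) (hW : P.IsCoComputableSet W) : P.IsCoComputableSet (V ∪ W) := by
  rw [hP.isCoComputableSet_iff] at *
  exact ⟨hV.1.union hW.1, (hV.2.and hW.2).of_eq fun _ => misses_union_iff.symm⟩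

theorem ComputablyCompact.isCoComputableSet_inter (hP : P.ComputablyCompact) {V W : Set X}
    (hV : P.IsCoComputableSet V) (hW : P.IsCoComputableSet W) : P.IsCoComputableSet (V ∩ W) := by
  rw [hP.isCoComputableSet_iff] at *
  exact ⟨hV.1.inter hW.1, hP.misses_re_of_not_exists
    (hP.not_exists_mem_inter_re hV.1.isClosed hW.1.isClosed hV.2 hW.2)⟩

/-- The complement of `C` is open, so an open ball that meets its closure contains an indexed point
some ball around which misses `C`. Negative information on `C` is thus positive information on the
closure of the complement. -/
theorem ComputablyCompact.hits_closure_compl_re (hP : P.ComputablyCompact) {C : Set X}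
    (hC : P.IsCoComputableSet C) : REPred fun p : ℕ × ℕ => P.Hits (closure Cᶜ) p.1 p.2 := by
  have hm := (hP.isCoComputableSet_iff.1 hC).2
  have hre : REPred fun p : ℕ × ℕ => ∃ a k m, P.Misses C a k ∧ P.Near p.1 a p.2 m := by
    refine REPred.exists ?_
    refine REPred.exists ?_
    refine REPred.exists ?_
    refine REPred.and ?_ ?_
    · exact misses_re_comp hm (Computable.snd.comp (Computable.fst.comp Computable.fst))
        (Computable.snd.comp Computable.fst)
    · exact hP.near_re
          (Computable.fst.comp (Computable.fst.comp (Computable.fst.comp Computable.fst)))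
        (Computable.snd.comp (Computable.fst.comp Computable.fst))
        (Computable.snd.comp (Computable.fst.comp (Computable.fst.comp Computable.fst)))
        Computable.snd
  refine hre.of_eq fun p => ⟨?_, ?_⟩
  · rintro ⟨a, k, m, ha, x, hx, y, hy, hd⟩
    refine ⟨x, hx, y, subset_closure fun hyC => ?_, by linarith [half_pow_pos m]⟩
    have := ha y hy y hyC
    rw [dist_self] at this
    exact absurd this (not_lt.2 (half_pow_pos k).le)
  · rintro ⟨x, hx, w, hw, hd⟩
    obtain ⟨z, hz, hdz⟩ := Metric.mem_closure_iff.1 hw _ (sub_pos.2 hd)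
    have hxz : dist x z < (2⁻¹ : ℝ) ^ p.2 := by linarith [dist_triangle x w z]
    obtain ⟨m, hm⟩ := exists_half_pow_lt (half_pos (sub_pos.2 hxz))
    obtain ⟨r, hr, hball⟩ := Metric.isOpen_iff.1 hC.1.isClosed.isOpen_compl z hz
    obtain ⟨k, hk⟩ := exists_half_pow_lt (half_pos hr)
    obtain ⟨a, y, hy, hdy⟩ := P.exists_index_lt (x := z)
      (lt_min (half_pow_pos k) (half_pow_pos m))
    refine ⟨a, k, m, fun y' hy' w' hw' => ?_, x, hx, y, hy, ?_⟩
    · obtain rfl := Part.mem_unique hy hy'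
      by_contra! hle
      refine hball ?_ hw'
      rw [Metric.mem_ball]
      have := dist_triangle_left w' z y
      linarith [lt_min_iff.1 hdy]
    · have := dist_triangle_right x y z
      linarith [lt_min_iff.1 hdy]

/-- Each of the two sets is the closure of the complement of the other: for `W` this is regularity,
for the other it is the duality of closure and interior. Hence `Misses` for one yields `Hits` for
the other. -/
theorem ComputablyCompact.isComputableSet_of_regular (hP : P.ComputablyCompact) {W : Set X}
    (hreg : W = closure (interior W)) (hW : P.IsCoComputableSet W)
    (hI : P.IsCoComputableSet (interior W)ᶜ) :
    P.IsComputableSet W ∧ P.IsComputableSet (interior W)ᶜ := by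
  have h1 := hP.hits_closure_compl_re hI
  have h2 := hP.hits_closure_compl_re hW
  rw [compl_compl, ← hreg] at h1
  rw [closure_compl] at h2
  exact ⟨hP.isComputableSet_iff.2 ⟨hW.1, (hP.isCoComputableSet_iff.1 hW).2, h1⟩,
    hP.isComputableSet_iff.2 ⟨hI.1, (hP.isCoComputableSet_iff.1 hI).2, h2⟩⟩

/-- An index `u` is accepted as entry `m` as soon as, at some precision `k`, every index not refuted
as an approximation of `x` is near `u`. Some unrefuted index lies within `2^(-k)` of `x`, which
makes `u` correct. -/
theorem ComputablyCompact.isComputablePoint_of_singleton (hP : P.ComputablyCompact) {x : X}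
    (hx : P.IsCoComputableSet {x}) : P.IsComputablePoint x := by
  have hm := (hP.isCoComputableSet_iff.1 hx).2
  have hre : REPred fun p : ℕ × ℕ => p.2 < 2 ^ P.D p.1 ∧
      ∃ k, ∀ a < 2 ^ P.D k, P.Misses {x} a k ∨ P.Near p.2 a p.1 k := by
    refine REPred.and ?_ ?_
    · exact REPred.lt Computable.snd (hP.bound Computable.fst)
    · refine REPred.exists ?_
      refine REPred.forall_lt ?_ (hP.bound Computable.snd)
      refine REPred.or ?_ ?_
      · exact misses_re_comp hm Computable.snd (Computable.snd.comp Computable.fst)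
      · exact hP.near_re (Computable.snd.comp (Computable.fst.comp Computable.fst)) Computable.snd
          (Computable.fst.comp (Computable.fst.comp Computable.fst))
          (Computable.snd.comp Computable.fst)
  obtain ⟨f, hf, hfp⟩ := REPred.exists_computable (p := fun m u => u < 2 ^ P.D m ∧
      ∃ k, ∀ a < 2 ^ P.D k, P.Misses {x} a k ∨ P.Near u a m k) hre fun m => by
    obtain ⟨u, hu, y, hy, hd⟩ := P.exists_index m x
    have h4 := half_pow_succ m
    -- In units of `2^(-m)`: error 1/2 of `u`, error 1/8 of an unrefuted index and margin 1/8 add up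
    -- to less than 1.
    refine ⟨u, hu, m + 3, fun a _ => or_iff_not_imp_left.2 fun ha => ?_⟩
    simp only [Misses, not_forall, not_lt, Set.mem_singleton_iff] at ha
    obtain ⟨z, hz, w, rfl, hzw⟩ := ha
    refine ⟨y, hy, z, hz, ?_⟩
    have h3 : (2⁻¹ : ℝ) ^ (m + 3) = (2⁻¹ : ℝ) ^ m / 8 := by
      rw [pow_add]; norm_num; ring
    linarith [dist_triangle_right y z w, half_pow_pos m]
  refine ⟨f, hf, fun m => ⟨(hfp m).1, ?_⟩⟩
  obtain ⟨k, hk⟩ := (hfp m).2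
  obtain ⟨a, ha, z, hz, hd⟩ := P.exists_index k x
  have hd' := hd.trans (half_pow_le k.le_succ)
  rcases hk a ha with h | ⟨y, hy, z', hz', h⟩
  · exact absurd hd' (not_le.2 (h z hz x rfl))
  · obtain rfl := Part.mem_unique hz hz'
    exact ⟨y, hy, by linarith [dist_triangle y z x]⟩

/-- Starting from any element of `A 1`, an element of the next level at distance less than `2^(-m)`
is chosen recursively. Such an element exists because consecutive levels both approximate `W`. The
sequence is Cauchy, and its limit lies in the closed set `W`. -/
theorem ComputablyCompact.exists_isComputablePoint (hP : P.ComputablyCompact)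
    (hR : P.HasRecursiveRounding) {W : Set X} (hW : P.IsComputableSet W) (hne : W.Nonempty) :
    ∃ x ∈ W, P.IsComputablePoint x := by
  obtain ⟨A, hA, hr⟩ := hW.2 hne
  rw [isSetName_iff hW.1 hne] at hA
  obtain ⟨R, hRc, hR⟩ := hR
  have hre : REPred fun q : (ℕ × ℕ) × ℕ => ¬ q.1.2 ∈ A (q.1.1 + 1) ∨
      (q.2 ∈ A (q.1.1 + 2) ∧ ∃ l, P.Near q.1.2 q.2 q.1.1 l) := by
    refine REPred.or ?_ (REPred.and ?_ ?_)
    · exact hr.not.to_re.comp (f := fun q : (ℕ × ℕ) × ℕ => (q.1.1 + 1, q.1.2))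
        ((Computable.succ.comp (Computable.fst.comp Computable.fst)).pair
          (Computable.snd.comp Computable.fst))
    · exact hr.to_re.comp (f := fun q : (ℕ × ℕ) × ℕ => (q.1.1 + 2, q.2))
        ((Computable.succ.comp (Computable.succ.comp (Computable.fst.comp Computable.fst))).pair
          Computable.snd)
    · refine REPred.exists ?_
      exact hP.near_re (Computable.snd.comp (Computable.fst.comp Computable.fst))
        (Computable.snd.comp Computable.fst)
        (Computable.fst.comp (Computable.fst.comp Computable.fst))
        Computable.snd
  obtain ⟨g, hg, hgp⟩ := REPred.exists_computable (p := fun (p : ℕ × ℕ) (b : ℕ) =>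
      ¬ p.2 ∈ A (p.1 + 1) ∨ (b ∈ A (p.1 + 2) ∧ ∃ l, P.Near p.2 b p.1 l)) hre fun ⟨m, a⟩ => by
    by_cases ha : a ∈ A (m + 1)
    swap
    · exact ⟨0, Or.inl ha⟩
    obtain ⟨-, x, hx, w, hw, hd⟩ := (hA (m + 1)).1 a ha
    obtain ⟨b, hb, y, hy, hd'⟩ := (hA (m + 2)).2 w hw
    -- In units of `2^(-m)`: errors 1/2 and 1/4 of the two levels and margin 1/8.
    refine ⟨b, Or.inr ⟨hb, m + 3, x, hx, y, hy, ?_⟩⟩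
    have h3 : (2⁻¹ : ℝ) ^ (m + 3) = (2⁻¹ : ℝ) ^ m / 8 := by
      rw [pow_add]; norm_num; ring
    have h2 : (2⁻¹ : ℝ) ^ (m + 2) = (2⁻¹ : ℝ) ^ m / 4 := by
      rw [pow_add]; norm_num; ring
    have h1 := half_pow_succ m
    linarith [dist_triangle_right x y w, half_pow_pos m]
  obtain ⟨w₀, hw₀⟩ := hne
  obtain ⟨a₀, ha₀, -⟩ := (hA 1).2 w₀ hw₀
  let a : ℕ → ℕ := fun n => Nat.rec a₀ (fun m b => g (m, b)) n
  have ha : Computable a :=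
    Computable.nat_rec Computable.id (Computable.const a₀) (hg.comp Computable.snd).to₂
  have haA : ∀ m, a m ∈ A (m + 1) := fun m => by
    induction m with
    | zero => exact ha₀
    | succ m ih => exact ((hgp (m, a m)).resolve_left (not_not.2 ih)).1
  have hpt : ∀ m, ∃ x ∈ P.enum (a m), ∃ w ∈ W, dist x w ≤ (2⁻¹ : ℝ) ^ (m + 1) := fun m =>
    ((hA (m + 1)).1 _ (haA m)).2
  choose x hx w hw hxw using hpt
  have hxx : ∀ m, dist (x m) (x (m + 1)) ≤ 2 / 2 / 2 ^ m := fun m => by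
    obtain ⟨-, l, y, hy, z, hz, hd⟩ := (hgp (m, a m)).resolve_left (not_not.2 (haA m))
    obtain rfl := Part.mem_unique hy (hx m)
    obtain rfl := Part.mem_unique hz (hx (m + 1))
    have h1 : (2 : ℝ) / 2 / 2 ^ m = (2⁻¹ : ℝ) ^ m := by
      rw [inv_pow]; field_simp
    linarith [half_pow_pos l]
  obtain ⟨z, hz⟩ := cauchySeq_tendsto_of_complete (cauchySeq_of_le_geometric_two hxx)
  -- The index `a (m + 2)` belongs to level `m + 3` and may be too large for entry `m`, so it is
  -- rounded. The rounding error and the tail of the series are each at most `2^(-m-1)`.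
  refine ⟨z, ?_, fun m => R (a (m + 2)) m,
    hRc.comp (ha.comp (Computable.succ.comp Computable.succ)) Computable.id, fun m => ?_⟩
  · exact hW.1.isClosed.mem_of_tendsto (tendsto_of_dist_le_half_pow (v := w) strictMono_id hz
      fun n => (hxw n).trans (half_pow_le n.le_succ)) (Filter.Eventually.of_forall hw)
  · obtain ⟨hlt, y, hy, hd⟩ := hR _ _ (hx (m + 2)) m
    refine ⟨hlt, y, hy, ?_⟩
    have h1 := dist_le_of_le_geometric_two_of_tendsto hxx hz (m + 2)
    have h2 : (2 : ℝ) / 2 ^ (m + 2) = (2⁻¹ : ℝ) ^ m / 2 := by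
      rw [inv_pow, pow_add]; field_simp
    have h3 := half_pow_succ m
    linarith [dist_triangle y (x (m + 2)) z]

end SetOperations

end Presentation

/-! ### Initial segments of names -/

theorem length_seqPrefix (u : ℕ → ℕ) (n : ℕ) : (seqPrefix u n).length = n := by
  simp [seqPrefix]

theorem getElem?_seqPrefix {u : ℕ → ℕ} {n i : ℕ} (h : i < n) :
    (seqPrefix u n)[i]? = some (u i) := by
  simp [seqPrefix, h]

theorem getElem?_seqPrefix_eq_some {u : ℕ → ℕ} {n i a : ℕ} :
    (seqPrefix u n)[i]? = some a ↔ i < n ∧ u i = a := by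
  by_cases h : i < n
  · simp [getElem?_seqPrefix h, h]
  · simp [seqPrefix, h]

theorem seqPrefix_isPrefix (u : ℕ → ℕ) {m n : ℕ} (h : m ≤ n) : seqPrefix u m <+: seqPrefix u n := by
  obtain ⟨k, rfl⟩ := Nat.exists_eq_add_of_le h
  exact ⟨(List.range k).map fun i => u (m + i), by simp [seqPrefix, List.range_add]⟩

theorem seqPrefix_congr {u v : ℕ → ℕ} {n : ℕ} (h : ∀ i < n, u i = v i) :
    seqPrefix u n = seqPrefix v n := by
  simpa [seqPrefix] using h

theorem eq_of_seqPrefix_eq {u v : ℕ → ℕ} {n i : ℕ} (h : seqPrefix u n = seqPrefix v n)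
    (hi : i < n) : u i = v i := by
  have := getElem?_seqPrefix (u := u) hi
  rw [h, getElem?_seqPrefix hi] at this
  exact (Option.some_injective _ this).symm

theorem seqPrefix_getD (s : List ℕ) : seqPrefix (fun i => s.getD i 0) s.length = s := by
  refine List.ext_getElem? fun i => ?_
  by_cases h : i < s.length
  · rw [getElem?_seqPrefix h]
    simp [h]
  · simp [seqPrefix, h]

theorem eq_seqPrefix_of_isPrefix {s : List ℕ} {v : ℕ → ℕ} {n : ℕ} (h : s <+: seqPrefix v n) :
    s = seqPrefix v s.length := by
  have hl := h.length_le
  rw [length_seqPrefix] at hl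
  exact List.IsPrefix.eq_of_length
    (List.prefix_of_prefix_length_le h (seqPrefix_isPrefix v hl) (by rw [length_seqPrefix]))
    (by rw [length_seqPrefix])

/-- The entries of a list, paired with their positions. -/
def indexed (s : List ℕ) : List (ℕ × ℕ) :=
  (List.range s.length).map fun i => (s.getD i 0, i)

theorem mem_indexed {s : List ℕ} {p : ℕ × ℕ} : p ∈ indexed s ↔ s[p.2]? = some p.1 := by
  obtain ⟨a, i⟩ := p
  simp only [indexed, List.mem_map, List.mem_range, Prod.mk.injEq]
  constructor
  · rintro ⟨i, hi, rfl, rfl⟩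
    simp [hi]
  · intro h
    obtain ⟨hi, rfl⟩ := List.getElem?_eq_some_iff.1 h
    exact ⟨i, hi, by simp [hi], rfl⟩

theorem primrec_indexed : Primrec indexed := by
  refine Primrec.list_map (Primrec.list_range.comp Primrec.list_length) (Primrec₂.mk ?_)
  exact ((Primrec.list_getD 0).comp Primrec.fst Primrec.snd).pair Primrec.snd

namespace Presentation

section Names

variable {X : Type*} [MetricSpace X] {P : Presentation X}

variable (P) in
/-- The intersection of the closed balls of radius `2^(-n)` around the points with index `u`, for
`(u, n) ∈ L`. -/
def ballInter (L : List (ℕ × ℕ)) : Set X :=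
  {x | ∀ p ∈ L, ∃ y ∈ P.enum p.1, dist y x ≤ (2⁻¹ : ℝ) ^ p.2}

theorem isClosed_ballInter (L : List (ℕ × ℕ)) : IsClosed (P.ballInter L) := by
  have : P.ballInter L = ⋂ p ∈ L, {x | ∃ y ∈ P.enum p.1, dist y x ≤ (2⁻¹ : ℝ) ^ p.2} := by
    ext x
    simp [ballInter]
  rw [this]
  refine isClosed_biInter fun p _ => ?_
  by_cases h : p.1 ∈ P.enum.Dom
  · obtain ⟨y, hy⟩ := Part.dom_iff_mem.1 h
    have : {x | ∃ y ∈ P.enum p.1, dist y x ≤ (2⁻¹ : ℝ) ^ p.2} =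
        {x | dist y x ≤ (2⁻¹ : ℝ) ^ p.2} := by
      ext x
      constructor
      · rintro ⟨y', hy', hd⟩
        exact Part.mem_unique hy hy' ▸ hd
      · exact fun hd => ⟨y, hy, hd⟩
    rw [this]
    exact isClosed_le (continuous_const.dist continuous_id) continuous_const
  · convert isClosed_empty
    refine Set.eq_empty_of_forall_notMem fun x => ?_
    rintro ⟨y, hy, -⟩
    exact h (Part.dom_iff_mem.2 ⟨y, hy⟩)

/-- Being an initial segment of a name is a non-emptiness condition on finitely many balls, because
any point in all of them has a name that continues the list. This makes the compactness argument for
balls applicable to names. -/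
theorem mem_initials_iff {W : Set X} {s : List ℕ} : s ∈ P.initials W ↔
    (∀ p ∈ indexed s, p.1 < 2 ^ P.D p.2) ∧ (W ∩ P.ballInter (indexed s)).Nonempty := by
  constructor
  · rintro ⟨x, hx, u, hu, n, rfl⟩
    refine ⟨fun p hp => ?_, x, hx, fun p hp => ?_⟩
    · rw [mem_indexed, getElem?_seqPrefix_eq_some] at hp
      exact hp.2 ▸ (hu p.2).1
    · rw [mem_indexed, getElem?_seqPrefix_eq_some] at hp
      exact hp.2 ▸ (hu p.2).2
  · rintro ⟨hs, x, hx, hL⟩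
    choose v hv y hy hd using fun m => P.exists_index m x
    -- Beyond the end of `s`, the entries are taken from a name of `x`.
    refine ⟨x, hx, fun i => (s[i]?).getD (v i), fun m => ?_, s.length, ?_⟩
    · rcases h : s[m]? with _ | a <;> simp only [h, Option.getD_none, Option.getD_some]
      · exact ⟨hv m, y m, hy m, (hd m).trans (half_pow_le m.le_succ)⟩
      · have := mem_indexed (s := s) (p := (a, m)).2 h
        exact ⟨hs _ this, hL _ this⟩
    · rw [← seqPrefix_getD s, length_seqPrefix]
      refine seqPrefix_congr fun i hi => ?_
      rw [seqPrefix_getD]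
      simp [hi]

theorem seqPrefix_mem_initials_of_le {W : Set X} {u : ℕ → ℕ} {m n : ℕ} (hmn : m ≤ n)
    (h : seqPrefix u n ∈ P.initials W) : seqPrefix u m ∈ P.initials W := by
  obtain ⟨x, hx, v, hv, k, hk⟩ := h
  have hnk : n = k := by
    have := congrArg List.length hk
    rwa [length_seqPrefix, length_seqPrefix] at this
  subst hnk
  exact ⟨x, hx, v, hv, m, seqPrefix_congr fun i hi => eq_of_seqPrefix_eq hk (hi.trans_le hmn)⟩

/-- An infinite branch of the tree of initial segments is a name: points witnessing longer and
longer segments accumulate at a point of `W`, and each of the closed balls contains all but finitely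
many of them. -/
theorem exists_isPointName_of_forall_mem_initials [CompactSpace X] {W : Set X} (hW : IsClosed W)
    {u : ℕ → ℕ} (h : ∀ n, seqPrefix u n ∈ P.initials W) : ∃ x ∈ W, P.IsPointName u x := by
  simp only [mem_initials_iff] at h
  choose hlt x hx hL using h
  obtain ⟨z, φ, hφ, hz⟩ := CompactSpace.tendsto_subseq x
  have hmem : ∀ {m n}, m < n → (u m, m) ∈ indexed (seqPrefix u n) := fun {m n} hmn => by
    rw [mem_indexed, getElem?_seqPrefix hmn]
  refine ⟨z, hW.mem_of_tendsto hz (Filter.Eventually.of_forall fun n => hx _), fun m =>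
    ⟨hlt _ _ (hmem m.lt_succ_self), ?_⟩⟩
  obtain ⟨y, hy, -⟩ := hL _ _ (hmem m.lt_succ_self)
  refine ⟨y, hy, le_of_tendsto (tendsto_const_nhds.dist hz) ?_⟩
  filter_upwards [Filter.eventually_gt_atTop m] with n hn
  obtain ⟨y', hy', hd⟩ := hL _ _ (hmem (hn.trans_le hφ.le_apply))
  exact Part.mem_unique hy hy' ▸ hd

/-- The covering radius is half of the error allowed in a name. The slack lets a finite part of such
a name serve nearby points as well. -/
theorem exists_isPointName_half (P : Presentation X) (x : X) :
    ∃ u, P.IsPointName u x ∧ ∀ m, ∃ y ∈ P.enum (u m), dist y x ≤ (2⁻¹ : ℝ) ^ (m + 1) := by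
  choose v hv y hy hd using fun m => P.exists_index m x
  exact ⟨v, fun m => ⟨hv m, y m, hy m, (hd m).trans (half_pow_le m.le_succ)⟩,
    fun m => ⟨y m, hy m, hd m⟩⟩

/-- By `mem_initials_iff` the balls of the list `q.1` and those of the segment can simply be
concatenated, which leaves a single emptiness test. -/
theorem ComputablyCompact.not_mem_initials_re [CompactSpace X] (hP : P.ComputablyCompact)
    {W : Set X} (hWc : IsClosed W) (hW : REPred fun p : ℕ × ℕ => P.Misses W p.1 p.2) :
    REPred fun q : List (ℕ × ℕ) × List ℕ => q.2 ∉ P.initials (W ∩ P.ballInter q.1) := by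
  have h := hP.not_exists_mem_inter_re hWc hWc hW hW
  have hre : REPred fun q : List (ℕ × ℕ) × List ℕ => (∃ p ∈ indexed q.2, 2 ^ P.D p.2 ≤ p.1) ∨
      ¬ ∃ w ∈ W ∩ W, ∀ p ∈ q.1 ++ indexed q.2, ∃ x ∈ P.enum p.1, dist x w ≤ (2⁻¹ : ℝ) ^ p.2 := by
    refine REPred.or ?_ ?_
    · refine REPred.exists_mem_list ?_ (primrec_indexed.to_comp.comp Computable.snd)
      exact REPred.le (hP.bound (Computable.snd.comp Computable.snd))
        (Computable.fst.comp Computable.snd)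
    · exact h.comp (f := fun q : List (ℕ × ℕ) × List ℕ => q.1 ++ indexed q.2)
        (Computable.list_append.comp Computable.fst (primrec_indexed.to_comp.comp Computable.snd))
  refine hre.of_eq fun q => ?_
  rw [mem_initials_iff, not_and_or]
  refine or_congr (by simp) (not_congr (exists_congr fun w => ?_))
  simp only [Set.mem_inter_iff, and_self, List.mem_append, or_imp, forall_and, ballInter,
    Set.mem_ofPred_eq, and_assoc]

end Names

end Presentation

/-! ### Uniform bounds on spaces of bounded sequences -/

theorem isOpen_setOf_seqPrefix (p : List ℕ → Prop) (n : ℕ) : IsOpen {u | p (seqPrefix u n)} := by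
  rw [isOpen_iff_mem_nhds]
  intro u hu
  have h : (⋂ i ∈ Finset.range n, {v : ℕ → ℕ | v i = u i}) ∈ nhds u := by
    refine (Filter.biInter_finset_mem _).2 fun i _ => ?_
    exact (continuous_apply i).continuousAt.preimage_mem_nhds (by simp : {u i} ∈ nhds (u i))
  filter_upwards [h] with v hv
  have : seqPrefix v n = seqPrefix u n := seqPrefix_congr fun i hi => by
    simp only [Set.mem_iInter] at hv
    exact hv i (Finset.mem_range.2 hi)
  simpa only [Set.mem_ofPred_eq, this] using hu

/-- König's lemma in topological form: the bounded sequences form a compact product of finite sets,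
and the sets of sequences satisfying `p` at length `n` form an increasing open cover. -/
theorem exists_forall_seqPrefix {b : ℕ → ℕ} {p : List ℕ → Prop}
    (hmono : ∀ u m n, m ≤ n → p (seqPrefix u m) → p (seqPrefix u n))
    (h : ∀ u : ℕ → ℕ, (∀ i, u i < b i) → ∃ n, p (seqPrefix u n)) :
    ∃ n, ∀ u : ℕ → ℕ, (∀ i, u i < b i) → p (seqPrefix u n) := by
  have hK : IsCompact (Set.univ.pi fun i => {a | a < b i}) :=
    isCompact_univ_pi fun i => (Set.finite_lt_nat (b i)).isCompact
  obtain ⟨n, hn⟩ := hK.elim_directed_cover (fun n => {u | p (seqPrefix u n)})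
    (isOpen_setOf_seqPrefix p)
    (fun u hu => by
      obtain ⟨n, hn⟩ := h u fun i => hu i trivial
      exact Set.mem_iUnion.2 ⟨n, hn⟩)
    (fun m n => ⟨max m n, fun u hu => hmono u _ _ (le_max_left m n) hu,
      fun u hu => hmono u _ _ (le_max_right m n) hu⟩)
  exact ⟨n, fun u hu => hn fun i _ => hu i⟩

/-! ### Runs of a machine on finite initial segments of the input -/

theorem encodeSeq_append (s t : List ℕ) : encodeSeq (s ++ t) = encodeSeq s ++ encodeSeq t := by
  simp [encodeSeq]

theorem encodeSeq_isPrefix {s t : List ℕ} (h : s <+: t) : encodeSeq s <+: encodeSeq t := by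
  obtain ⟨r, rfl⟩ := h
  exact ⟨encodeSeq r, (encodeSeq_append s r).symm⟩

theorem inputSymbol_congr {u v : ℕ → ℕ} {n p : ℕ} (h : seqPrefix u n = seqPrefix v n)
    (hp : p < n) : inputSymbol u p = inputSymbol v p := by
  unfold inputSymbol
  rw [seqPrefix_congr fun i hi => eq_of_seqPrefix_eq h (Nat.lt_of_lt_of_le hi hp)]

namespace StreamMachine

variable (M : StreamMachine)

theorem pos_run_le (u : ℕ → ℕ) (t : ℕ) : (M.run u t).pos ≤ t := by
  induction t with
  | zero => exact le_rfl
  | succ t ih =>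
    simp only [run, step]
    split <;> omega

/-- In `t` steps the input head visits only cells below `t`. Every entry occupies at least one cell,
so these cells are determined by the first `t` entries. -/
theorem run_congr {u v : ℕ → ℕ} {n : ℕ} (h : seqPrefix u n = seqPrefix v n) {t : ℕ} (ht : t ≤ n) :
    M.run u t = M.run v t := by
  induction t with
  | zero => rfl
  | succ t ih =>
    have hs : inputSymbol u (M.run v t).pos = inputSymbol v (M.run v t).pos :=
      inputSymbol_congr h (by have := M.pos_run_le v t; omega)
    simp only [run, ih (by omega), step, hs]

theorem out_run_isPrefix (u : ℕ → ℕ) {s t : ℕ} (h : s ≤ t) :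
    (M.run u s).out <+: (M.run u t).out := by
  induction t, h using Nat.le_induction with
  | base => exact List.prefix_rfl
  | succ t _ ih => exact ih.trans ⟨_, rfl⟩

variable {M} in
theorem Printed.mono {u : ℕ → ℕ} {t t' : ℕ} {s : List ℕ} (h : M.Printed u t s) (ht : t ≤ t') :
    M.Printed u t' s :=
  List.IsPrefix.trans h (M.out_run_isPrefix u ht)

/-- The output that is printed in the first `s.length` steps on inputs that extend `s`. -/
def outputOn (s : List ℕ) : List (Option Bool) :=
  (M.run (fun i => s.getD i 0) s.length).out

theorem outputOn_seqPrefix (u : ℕ → ℕ) (n : ℕ) : M.outputOn (seqPrefix u n) = (M.run u n).out := by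
  have h := seqPrefix_getD (seqPrefix u n)
  rw [length_seqPrefix] at h
  rw [outputOn, length_seqPrefix, M.run_congr h le_rfl]

theorem ComputesMap.exists_output {X Y : Type*} [MetricSpace X] [MetricSpace Y]
    {P : Presentation X} {Q : Presentation Y} {W : Set X} {Λ : W → Y} {M : StreamMachine}
    (hM : M.ComputesMap P Q Λ) (x : W) {u : ℕ → ℕ} (hu : P.IsPointName u x) :
    ∃ v, Q.IsPointName v (Λ x) ∧ (∀ n, ∃ t, M.Printed u t (seqPrefix v n)) ∧
      ∀ t s, M.Printed u t s → s = seqPrefix v s.length := by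
  obtain ⟨F, ⟨-, -, hF⟩, hMF⟩ := hM
  obtain ⟨hlen, v, hv, hFv⟩ := hF x u hu
  refine ⟨v, hv, fun n => ?_, fun t s hs => ?_⟩
  · obtain ⟨m, hm⟩ := hlen n
    rw [hMF x u hu]
    refine ⟨m, ?_⟩
    rw [hFv m]
    exact seqPrefix_isPrefix v hm
  · obtain ⟨m, hm⟩ := (hMF x u hu s).1 ⟨t, hs⟩
    rw [hFv m] at hm
    exact eq_seqPrefix_of_isPrefix hm

end StreamMachine

/-! ### Recursiveness of the simulation -/

theorem primrec_natBits : Primrec Nat.bits := by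
  have h : Primrec₂ fun (_ : Unit) (n : ℕ) => Nat.bits n := by
    -- Course-of-values recursion: `l` lists the values at all smaller arguments, so `l.length` is
    -- the current argument, and the digits of its half are prefixed by its parity.
    refine Primrec.nat_strong_rec (g := fun _ l => bif l.length == 0 then some [] else
      (l[l.length / 2]?).map fun r => (l.length).bodd :: r) _ ?_ ?_
    · refine Primrec₂.mk (Primrec.cond ?_ (Primrec.const _) (Primrec.option_map ?_ ?_))
      · exact Primrec.beq.comp (Primrec.list_length.comp Primrec.snd) (Primrec.const 0)
      · exact Primrec.list_getElem?.comp Primrec.snd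
          (Primrec.nat_div.comp (Primrec.list_length.comp Primrec.snd) (Primrec.const 2))
      · exact Primrec₂.mk (Primrec.list_cons.comp (Primrec.nat_bodd.comp
          (Primrec.list_length.comp (Primrec.snd.comp Primrec.fst))) Primrec.snd)
    · intro _ n
      rcases Nat.eq_zero_or_pos n with rfl | hn
      · simp
      · have h2 : n / 2 < n := Nat.div_lt_self hn one_lt_two
        have h3 : n.bits = n.bodd :: (n / 2).bits := by
          conv_lhs => rw [← Nat.bit_bodd_div2 n]
          rw [Nat.bits_append_bit, Nat.div2_val]
          intro h0
          by_contra hc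
          have := Nat.bit_bodd_div2 n
          rw [h0] at this
          simp only [Bool.not_eq_true] at hc
          rw [hc] at this
          simp at this
          omega
        have h4 : (n == 0) = false := beq_false_of_ne hn.ne'
        simp [h2, h3, h4]
  exact h.comp (Primrec.const ()) Primrec.id

theorem primrec_encodeSeq : Primrec encodeSeq := by
  refine Primrec.list_flatMap Primrec.id (Primrec₂.mk (Primrec.list_append.comp
    (Primrec.list_map (primrec_natBits.comp Primrec.snd) ?_) (Primrec.const _)))
  exact (Primrec.option_some.comp Primrec.snd).to₂

theorem primrec_inputSymbol_getD :
    Primrec₂ fun (s : List ℕ) (p : ℕ) => inputSymbol (fun i => s.getD i 0) p := by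
  refine Primrec₂.mk ((Primrec.list_getD none).comp (primrec_encodeSeq.comp ?_) Primrec.snd)
  refine Primrec.list_map (Primrec.list_range.comp (Primrec.succ.comp Primrec.snd)) ?_
  exact Primrec₂.mk ((Primrec.list_getD 0).comp (Primrec.fst.comp Primrec.fst) Primrec.snd)

/-- Moves of a head, coded by truth values. -/
def moveCode : Option Turing.Dir → Option Bool
  | none => none
  | some Turing.Dir.left => some false
  | some Turing.Dir.right => some true

/-- The effect on a work tape of writing a symbol and a coded move. -/
def WorkTape.actCode {g : ℕ} (T : WorkTape g) (a : Fin (g + 1)) (o : Option Bool) : WorkTape g :=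
  o.casesOn (T.1, a, T.2.2) fun b => bif b then (a :: T.1, T.2.2.headI, T.2.2.tail) else
    (T.1.tail, T.1.headI, a :: T.2.2)

theorem WorkTape.act_eq {g : ℕ} (T : WorkTape g) (a : Fin (g + 1)) (o : Option Turing.Dir) :
    T.act a o = T.actCode a (moveCode o) := by
  have h : ∀ l : List (Fin (g + 1)), l.head?.getD 0 = l.headI := by
    intro l
    cases l <;> rfl
  rcases o with _ | _ | _ <;> simp [WorkTape.act, WorkTape.actCode, moveCode, h]

theorem WorkTape.primrec_actCode {g : ℕ} :
    Primrec fun x : WorkTape g × Fin (g + 1) × Option Bool => x.1.actCode x.2.1 x.2.2 := by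
  have hT : Primrec fun y : (WorkTape g × Fin (g + 1) × Option Bool) × Bool => y.1.1 :=
    Primrec.fst.comp Primrec.fst
  have ha : Primrec fun y : (WorkTape g × Fin (g + 1) × Option Bool) × Bool => y.1.2.1 :=
    Primrec.fst.comp (Primrec.snd.comp Primrec.fst)
  have hr := Primrec.snd.comp (Primrec.snd.comp hT)
  have hl := Primrec.fst.comp hT
  refine Primrec.option_casesOn (Primrec.snd.comp Primrec.snd) ?_ (Primrec₂.mk
    (Primrec.cond Primrec.snd ?_ ?_))
  · exact (Primrec.fst.comp Primrec.fst).pair ((Primrec.fst.comp Primrec.snd).pair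
      (Primrec.snd.comp (Primrec.snd.comp Primrec.fst)))
  · exact (Primrec.list_cons.comp ha hl).pair
      ((Primrec.list_headI.comp hr).pair (Primrec.list_tail.comp hr))
  · exact (Primrec.list_tail.comp hl).pair
      ((Primrec.list_headI.comp hl).pair (Primrec.list_cons.comp ha hr))

namespace StreamMachine

variable (M : StreamMachine)

/-- Configurations as tuples. -/
abbrev Tuple : Type :=
  Fin (M.q + 1) × (Fin M.k → WorkTape M.g) × ℕ × List (Option Bool)

/-- The tuple of the components of a configuration. -/
def Config.toTuple {M : StreamMachine} (c : M.Config) : M.Tuple :=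
  (c.state, c.tape, c.pos, c.out)

/-- The part of a tuple that determines the next action, apart from the input symbol. -/
def scanned (c : M.Tuple) : Fin (M.q + 1) × (Fin M.k → Fin (M.g + 1)) :=
  (c.1, fun i => (c.2.1 i).2.1)

/-- The action determined by the scanned symbols. -/
def action (x : (Fin (M.q + 1) × (Fin M.k → Fin (M.g + 1))) × Option Bool) :
    MachineAction M.k M.q M.g :=
  M.δ x.1.1 x.2 x.1.2

/-- One step in terms of tuples. -/
def stepTuple (b : Option Bool) (c : M.Tuple) : M.Tuple :=
  ((M.action (M.scanned c, b)).next,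
    fun i => (c.2.1 i).actCode ((M.action (M.scanned c, b)).write i)
      (moveCode ((M.action (M.scanned c, b)).move i)),
    bif (M.action (M.scanned c, b)).advance then c.2.2.1 + 1 else c.2.2.1,
    c.2.2.2 ++ (M.action (M.scanned c, b)).print.toList)

theorem toTuple_step (u : ℕ → ℕ) (c : M.Config) :
    (M.step u c).toTuple = M.stepTuple (inputSymbol u c.pos) c.toTuple := by
  simp only [step, Config.toTuple, stepTuple, scanned, action, WorkTape.act_eq]
  congr 3
  cases (M.δ c.state (inputSymbol u c.pos) fun i => (c.tape i).2.1).advance <;> rfl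

theorem primrec_scanned : Primrec M.scanned := by
  refine Primrec.fst.pair (Primrec.fin_curry.2 (Primrec₂.mk ?_))
  have : Primrec fun x : M.Tuple × Fin M.k => x.1.2.1 x.2 :=
    Primrec.fin_app.comp (Primrec.fst.comp (Primrec.snd.comp Primrec.fst)) Primrec.snd
  exact Primrec.fst.comp (Primrec.snd.comp this)

theorem primrec_stepTuple : Primrec₂ M.stepTuple := by
  have hs : Primrec fun x : Option Bool × M.Tuple => (M.scanned x.2, x.1) :=
    (M.primrec_scanned.comp Primrec.snd).pair Primrec.fst
  -- The transition table has a finite domain, so each of its components is primitive recursive.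
  have hf : ∀ {σ : Type} [Primcodable σ] (f : MachineAction M.k M.q M.g → σ),
      Primrec fun x : Option Bool × M.Tuple => f (M.action (M.scanned x.2, x.1)) :=
    fun f => (Primrec.dom_finite fun y => f (M.action y)).comp hs
  refine Primrec₂.mk ((hf fun a => a.next).pair (Primrec.pair (Primrec.fin_curry.2
    (Primrec₂.mk ?_)) (Primrec.pair (Primrec.cond (hf fun a => a.advance) ?_ ?_)
      (Primrec.list_append.comp ?_ (hf fun a => a.print.toList)))))
  · have h1 : Primrec fun x : (Option Bool × M.Tuple) × Fin M.k => x.1.2.2.1 x.2 :=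
      Primrec.fin_app.comp (Primrec.fst.comp (Primrec.snd.comp (Primrec.snd.comp Primrec.fst)))
        Primrec.snd
    have h2 : Primrec fun x : (Option Bool × M.Tuple) × Fin M.k =>
        (M.action (M.scanned x.1.2, x.1.1)).write x.2 :=
      Primrec.fin_app.comp ((hf fun a => a.write).comp Primrec.fst) Primrec.snd
    have h3 : Primrec fun x : (Option Bool × M.Tuple) × Fin M.k =>
        moveCode ((M.action (M.scanned x.1.2, x.1.1)).move x.2) :=
      Primrec.fin_app.comp ((hf fun a i => moveCode (a.move i)).comp Primrec.fst) Primrec.snd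
    exact WorkTape.primrec_actCode.comp (h1.pair (h2.pair h3))
  · exact Primrec.succ.comp (Primrec.fst.comp (Primrec.snd.comp (Primrec.snd.comp Primrec.snd)))
  · exact Primrec.fst.comp (Primrec.snd.comp (Primrec.snd.comp Primrec.snd))
  · exact Primrec.snd.comp (Primrec.snd.comp (Primrec.snd.comp Primrec.snd))

/-- One step on the input whose first entries are those of `s`, in terms of tuples. -/
def stepOn (s : List ℕ) (c : M.Tuple) : M.Tuple :=
  M.stepTuple (inputSymbol (fun i => s.getD i 0) c.2.2.1) c

theorem primrec_stepOn : Primrec₂ M.stepOn :=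
  Primrec₂.mk (M.primrec_stepTuple.comp (primrec_inputSymbol_getD.comp Primrec.fst
    (Primrec.fst.comp (Primrec.snd.comp (Primrec.snd.comp Primrec.snd)))) Primrec.snd)

theorem iterate_stepOn (s : List ℕ) (n : ℕ) :
    (M.stepOn s)^[n] M.init.toTuple = (M.run (fun i => s.getD i 0) n).toTuple := by
  induction n with
  | zero => rfl
  | succ n ih =>
    rw [Function.iterate_succ_apply', ih]
    exact (M.toTuple_step _ _).symm

theorem primrec_outputOn : Primrec M.outputOn := by
  have h : Primrec fun s : List ℕ => (M.stepOn s)^[s.length] M.init.toTuple :=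
    Primrec.nat_iterate Primrec.list_length (Primrec.const _) M.primrec_stepOn
  refine (Primrec.snd.comp (Primrec.snd.comp (Primrec.snd.comp h))).of_eq fun s => ?_
  rw [iterate_stepOn]
  rfl

theorem encodeSeq_isPrefix_outputOn_re {α : Type*} [Primcodable α] {w s : α → List ℕ}
    (hw : Computable w) (hs : Computable s) :
    REPred fun a => encodeSeq (w a) <+: M.outputOn (s a) := by
  refine REPred.exists (p := fun a t => encodeSeq (w a) ++ t = M.outputOn (s a)) ?_
  exact REPred.eq (Computable.list_append.comp
    (primrec_encodeSeq.to_comp.comp (hw.comp Computable.fst)) Computable.snd)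
    (M.primrec_outputOn.to_comp.comp (hs.comp Computable.fst))

end StreamMachine

namespace Presentation

section Names

variable {X : Type*} [MetricSpace X] {P : Presentation X}

theorem IsPointName.unique {u : ℕ → ℕ} {x y : X} (hx : P.IsPointName u x)
    (hy : P.IsPointName u y) : x = y := by
  refine dist_le_zero.1 (le_of_forall_pos_le_add fun ε hε => ?_)
  obtain ⟨n, hn⟩ := exists_half_pow_lt (half_pos hε)
  obtain ⟨-, z, hz, hd⟩ := hx n
  obtain ⟨-, z', hz', hd'⟩ := hy n
  obtain rfl := Part.mem_unique hz hz'
  linarith [dist_triangle_left x y z]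

theorem IsPointName.seqPrefix_mem_initials {u : ℕ → ℕ} {x : X} (hu : P.IsPointName u x)
    {W : Set X} (hx : x ∈ W) (n : ℕ) : seqPrefix u n ∈ P.initials W :=
  ⟨x, hx, u, hu, n, rfl⟩

@[simp]
theorem ballInter_nil : P.ballInter [] = Set.univ := by
  ext
  simp [ballInter]

theorem ComputablyCompact.not_mem_initials_re' [CompactSpace X] (hP : P.ComputablyCompact)
    {W : Set X} (hW : P.IsCoComputableSet W) : REPred fun s : List ℕ => s ∉ P.initials W := by
  have h := hP.isCoComputableSet_iff.1 hW
  refine ((hP.not_mem_initials_re h.1.isClosed h.2).comp (f := fun s : List ℕ => ([], s))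
    ((Computable.const _).pair Computable.id)).of_eq fun s => ?_
  rw [ballInter_nil, Set.inter_univ]

end Names

end Presentation

/-! ### Searching through all lists of a given length -/

/-- The first `n` digits of `c` in base `b`. -/
def digitList (b n c : ℕ) : List ℕ :=
  (List.range n).map fun i => c / b ^ i % b

/-- Lists of fixed length with bounded entries are enumerated by the numbers below a power, so that
a universal quantifier over such lists becomes a bounded one. -/
theorem exists_digitList_eq {b : ℕ} (s : List ℕ) (hs : ∀ a ∈ s, a < b) :
    ∃ c < b ^ s.length, digitList b s.length c = s := by
  induction s with
  | nil => exact ⟨0, by simp, rfl⟩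
  | cons a s ih =>
    obtain ⟨c, hc, he⟩ := ih fun a ha => hs a (List.mem_cons_of_mem _ ha)
    have ha : a < b := hs a List.mem_cons_self
    refine ⟨a + b * c, ?_, ?_⟩
    · rw [List.length_cons, pow_succ]
      nlinarith
    · simp only [digitList, List.length_cons, List.range_succ_eq_map, List.map_cons, pow_zero,
        Nat.div_one, Nat.add_mul_mod_self_left, Nat.mod_eq_of_lt ha, List.map_map, List.cons.injEq,
        true_and]
      conv_rhs => rw [← he]
      refine List.map_congr_left fun i _ => ?_
      simp only [Function.comp_apply]
      rw [Nat.succ_eq_add_one, pow_succ', ← Nat.div_div_eq_div_mul,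
        Nat.add_mul_div_left _ _ (by omega), Nat.div_eq_of_lt ha, Nat.zero_add]

theorem primrec_digitList : Primrec fun x : ℕ × ℕ × ℕ => digitList x.1 x.2.1 x.2.2 := by
  refine Primrec.list_map (Primrec.list_range.comp (Primrec.fst.comp Primrec.snd)) (Primrec₂.mk ?_)
  exact Primrec.nat_mod.comp (Primrec.nat_div.comp
    (Primrec.snd.comp (Primrec.snd.comp Primrec.fst)) (Nat.primrec_pow.comp
      (Primrec.fst.comp Primrec.fst) Primrec.snd)) (Primrec.fst.comp Primrec.fst)

theorem REPred.forall_list {α : Type*} [Primcodable α] {q : α → List ℕ → Prop}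
    (hq : REPred fun x : α × List ℕ => q x.1 x.2) {n b : α → ℕ} (hn : Computable n)
    (hb : Computable b) :
    REPred fun a => ∀ s : List ℕ, s.length = n a → (∀ i ∈ s, i < b a) → q a s := by
  refine (REPred.forall_lt (p := fun a c => q a (digitList (b a) (n a) c)) ?_
    (Nat.primrec_pow.to_comp.comp hb hn)).of_eq fun a => ⟨?_, ?_⟩
  · exact hq.comp (f := fun x : α × ℕ => (x.1, digitList (b x.1) (n x.1) x.2))
      (Computable.fst.pair (primrec_digitList.to_comp.comp ((hb.comp Computable.fst).pair
        ((hn.comp Computable.fst).pair Computable.snd))))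
  · rintro h s hs hsb
    obtain ⟨c, hc, he⟩ := exists_digitList_eq s hsb
    rw [hs] at hc he
    exact he ▸ h c hc
  · intro h c hc
    refine h _ (by simp [digitList]) fun i hi => ?_
    simp only [digitList, List.mem_map, List.mem_range] at hi
    obtain ⟨j, hj, rfl⟩ := hi
    refine Nat.mod_lt _ (Nat.pos_of_ne_zero fun h0 => ?_)
    rw [h0, zero_pow (by omega)] at hc
    omega

/-! ### Uniform time bounds, recursive moduli and preimages -/

section MapsBetweenSpaces

open Presentation

variable {X Y : Type*} [MetricSpace X] [MetricSpace Y]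
  {P : Presentation X} {Q : Presentation Y} {W : Set X} {Λ : W → Y} {M : StreamMachine}

/-- A sequence of bounded entries either leaves the tree of initial segments of names of points of
`C`, or names a point of `C`, in which case the machine eventually prints a word satisfying `R`.
Either event occurs at a finite length and persists, so `exists_forall_seqPrefix` makes that length
uniform. -/
theorem StreamMachine.ComputesMap.exists_level [CompactSpace X] (hM : M.ComputesMap P Q Λ)
    {C : Set X} (hC : IsClosed C) (hCW : C ⊆ W) {R : List ℕ → Prop}
    (hR : ∀ x : W, (x : X) ∈ C → ∀ v, Q.IsPointName v (Λ x) → ∃ n, R (seqPrefix v n)) :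
    ∃ T, ∀ s : List ℕ, s.length = T → s ∈ P.initials C →
      ∃ w, R w ∧ encodeSeq w <+: M.outputOn s := by
  have hmono : ∀ u m n, m ≤ n → (seqPrefix u m ∈ P.initials C →
      ∃ w, R w ∧ encodeSeq w <+: M.outputOn (seqPrefix u m)) → seqPrefix u n ∈ P.initials C →
      ∃ w, R w ∧ encodeSeq w <+: M.outputOn (seqPrefix u n) := by
    intro u m n hmn h hn
    obtain ⟨w, hw, hp⟩ := h (seqPrefix_mem_initials_of_le hmn hn)
    refine ⟨w, hw, ?_⟩
    rw [M.outputOn_seqPrefix] at hp ⊢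
    exact hp.trans (M.out_run_isPrefix u hmn)
  obtain ⟨T, hT⟩ := exists_forall_seqPrefix (b := fun i => 2 ^ P.D i)
    (p := fun s => s ∈ P.initials C → ∃ w, R w ∧ encodeSeq w <+: M.outputOn s) hmono fun u _ => by
      by_cases h : ∀ n, seqPrefix u n ∈ P.initials C
      · obtain ⟨x, hx, hu⟩ := exists_isPointName_of_forall_mem_initials hC h
        obtain ⟨v, hv, hpr, -⟩ := hM.exists_output ⟨x, hCW hx⟩ hu
        obtain ⟨n, hn⟩ := hR ⟨x, hCW hx⟩ hx v hv
        obtain ⟨t, ht⟩ := hpr n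
        exact ⟨t, fun _ => ⟨_, hn, by rw [M.outputOn_seqPrefix]; exact ht⟩⟩
      · obtain ⟨n, hn⟩ := not_forall.1 h
        exact ⟨n, fun h => absurd h hn⟩
  refine ⟨T, fun s hs hsC => ?_⟩
  obtain ⟨x, hx, u, hu, n, rfl⟩ := hsC
  rw [length_seqPrefix] at hs
  subst hs
  exact hT u (fun i => (hu i).1) ⟨x, hx, u, hu, n, rfl⟩

theorem StreamMachine.RunsInTime.of_forall_list {T : ℕ → ℕ}
    (h : ∀ n, ∀ s : List ℕ, s.length = T n → s ∈ P.initials W →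
      ∃ w : List ℕ, w.length = n + 1 ∧ encodeSeq w <+: M.outputOn s) : M.RunsInTime P W T := by
  intro x hx u hu n
  obtain ⟨w, hw, hp⟩ := h n (seqPrefix u (T n)) (length_seqPrefix _ _)
    (hu.seqPrefix_mem_initials hx _)
  rw [M.outputOn_seqPrefix] at hp
  exact ⟨w, hw, hp⟩

theorem StreamMachine.RunsInTime.mono {T T' : ℕ → ℕ} (h : M.RunsInTime P W T)
    (hT : ∀ n, T n ≤ T' n) : M.RunsInTime P W T' := by
  intro x hx u hu n
  obtain ⟨s, hs, hp⟩ := h x hx u hu n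
  exact ⟨s, hs, hp.mono (hT n)⟩

theorem monotone_sum_range_succ (f : ℕ → ℕ) : Monotone fun n => ∑ i ∈ Finset.range (n + 1), f i :=
  fun _ _ h => Finset.sum_le_sum_of_subset (Finset.range_mono (Nat.succ_le_succ h))

theorem le_sum_range_succ (f : ℕ → ℕ) (n : ℕ) : f n ≤ ∑ i ∈ Finset.range (n + 1), f i :=
  Finset.single_le_sum (f := f) (fun _ _ => Nat.zero_le _) (Finset.self_mem_range_succ n)

theorem Computable.sum_range_succ {f : ℕ → ℕ} (hf : Computable f) :
    Computable fun n => ∑ i ∈ Finset.range (n + 1), f i := by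
  have h : Computable fun n : ℕ => (Nat.rec (f 0) (fun i r => r + f (i + 1)) n : ℕ) :=
    Computable.nat_rec Computable.id (Computable.const _)
      ((Primrec.nat_add.to_comp.comp (Computable.snd.comp Computable.snd)
        (hf.comp (Computable.succ.comp (Computable.fst.comp Computable.snd)))).to₂)
  refine h.of_eq fun n => ?_
  induction n with
  | zero => simp
  | succ n ih => rw [Finset.sum_range_succ, ← ih]

theorem exists_length_seqPrefix (v : ℕ → ℕ) (n : ℕ) : ∃ m, (seqPrefix v m).length = n :=
  ⟨n, length_seqPrefix v n⟩

theorem StreamMachine.ComputesMap.exists_runsInTime [CompactSpace X] (hM : M.ComputesMap P Q Λ)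
    (hW : IsCompact W) : ∃ T : ℕ → ℕ, Monotone T ∧ M.RunsInTime P W T := by
  choose T hT using fun n => hM.exists_level hW.isClosed subset_rfl
    (R := fun w => w.length = n + 1) fun _ _ v _ => exists_length_seqPrefix v (n + 1)
  exact ⟨_, monotone_sum_range_succ T,
    (StreamMachine.RunsInTime.of_forall_list hT).mono (le_sum_range_succ T)⟩

/-- The first `T (n + 1)` entries of a name of `x` with halved errors also start a name of `x'`. On
both names the machine prints the same entry number `n + 1` by time `T (n + 1)`, and this entry is
within `2^(-n-1)` of both images. -/
theorem StreamMachine.ComputesMap.binaryModulusEstimate (hM : M.ComputesMap P Q Λ) {T : ℕ → ℕ}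
    (hT : M.RunsInTime P W T) : BinaryModulusEstimate Λ fun n => T (n + 1) + 1 := by
  intro n x x' hxx
  obtain ⟨u, hu, hhalf⟩ := P.exists_isPointName_half (x : X)
  obtain ⟨u', hu', -⟩ := P.exists_isPointName_half (x' : X)
  have hname : P.IsPointName (fun i => if i < T (n + 1) then u i else u' i) x' := by
    intro m
    by_cases hm : m < T (n + 1)
    · simp only [hm, if_true]
      obtain ⟨y, hy, hd⟩ := hhalf m
      refine ⟨(hu m).1, y, hy, ?_⟩
      have h1 : (2⁻¹ : ℝ) ^ (T (n + 1) + 1) ≤ (2⁻¹ : ℝ) ^ (m + 1) := half_pow_le (by omega)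
      have h2 := half_pow_succ m
      have h3 : dist (x : X) x' ≤ (2⁻¹ : ℝ) ^ (T (n + 1) + 1) := hxx
      linarith [dist_triangle y (x : X) x']
    · simp only [hm, if_false]
      exact hu' m
  obtain ⟨s, hs, hp⟩ := hT x x.2 u hu (n + 1)
  have hp' : M.Printed (fun i => if i < T (n + 1) then u i else u' i) (T (n + 1)) s := by
    rw [StreamMachine.Printed, ← M.run_congr (u := u) (n := T (n + 1)) ?_ le_rfl]
    · exact hp
    · exact seqPrefix_congr fun i hi => by simp only [hi, if_true]
  obtain ⟨v, hv, -, hsv⟩ := hM.exists_output x hu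
  obtain ⟨v', hv', -, hsv'⟩ := hM.exists_output x' hname
  have he : v (n + 1) = v' (n + 1) :=
    eq_of_seqPrefix_eq ((hsv _ _ hp).symm.trans (hsv' _ _ hp')) (by omega)
  obtain ⟨-, y, hy, hd⟩ := hv (n + 1)
  obtain ⟨-, y', hy', hd'⟩ := hv' (n + 1)
  rw [← he] at hy'
  obtain rfl := Part.mem_unique hy hy'
  have h2 := half_pow_succ n
  linarith [dist_triangle_left (Λ x) (Λ x') y]

theorem StreamMachine.ComputesMap.isBinaryModulus (hM : M.ComputesMap P Q Λ) {T : ℕ → ℕ}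
    (hT : M.RunsInTime P W T) (hmono : Monotone T) : IsBinaryModulus Λ fun n => T (n + 1) + 1 :=
  ⟨fun _ _ h => Nat.succ_le_succ (hmono (Nat.succ_le_succ h)), hM.binaryModulusEstimate hT⟩

theorem BinaryModulusEstimate.continuous {μ : ℕ → ℕ} (h : BinaryModulusEstimate Λ μ) :
    Continuous Λ := by
  refine Metric.continuous_iff.2 fun x ε hε => ?_
  obtain ⟨n, hn⟩ := exists_half_pow_lt hε
  exact ⟨_, half_pow_pos (μ n), fun y hy => (h n y x hy.le).trans_lt hn⟩

theorem IsComputableMap.continuous [CompactSpace X] (h : IsComputableMap P Q Λ)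
    (hW : IsCompact W) : Continuous Λ := by
  obtain ⟨M, hM⟩ := h
  obtain ⟨T, -, hT⟩ := hM.exists_runsInTime hW
  exact (hM.binaryModulusEstimate hT).continuous

/-- A uniform time for `n + 1` output entries is found by search: every candidate segment is either
refuted as an initial segment of a name or seen to make the machine print enough. The common entry
bound `2^(D T)` admits superfluous candidates, but these are refuted. -/
theorem StreamMachine.ComputesMap.exists_computable_modulus [CompactSpace X]
    (hP : P.ComputablyCompact) (hM : M.ComputesMap P Q Λ) (hW : P.IsCoComputableSet W) :
    ∃ μ : ℕ → ℕ, Computable μ ∧ IsBinaryModulus Λ μ ∧ M.RunsInTime P W μ := by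
  have hre : REPred fun p : ℕ × ℕ => ∀ s : List ℕ, s.length = p.2 → (∀ i ∈ s, i < 2 ^ P.D p.2) →
      (s ∉ P.initials W ∨ ∃ w : List ℕ, w.length = p.1 + 1 ∧ encodeSeq w <+: M.outputOn s) := by
    refine REPred.forall_list ?_ Computable.snd (hP.bound Computable.snd)
    refine REPred.or ((hP.not_mem_initials_re' hW).comp Computable.snd) ?_
    refine REPred.exists ?_
    refine REPred.and ?_ ?_
    · exact REPred.eq (Computable.list_length.comp Computable.snd)
        (Computable.succ.comp (Computable.fst.comp (Computable.fst.comp Computable.fst)))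
    · exact M.encodeSeq_isPrefix_outputOn_re Computable.snd (Computable.snd.comp Computable.fst)
  obtain ⟨f, hf, hfp⟩ := REPred.exists_computable (p := fun n T => ∀ s : List ℕ, s.length = T →
      (∀ i ∈ s, i < 2 ^ P.D T) → (s ∉ P.initials W ∨
        ∃ w : List ℕ, w.length = n + 1 ∧ encodeSeq w <+: M.outputOn s)) hre fun n => by
    obtain ⟨T, hT⟩ := hM.exists_level hW.1.isClosed subset_rfl
      (R := fun w => w.length = n + 1) fun _ _ v _ => exists_length_seqPrefix v (n + 1)
    exact ⟨T, fun s hs _ => or_iff_not_imp_left.2 fun h => hT s hs (not_not.1 h)⟩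
  have hrun : M.RunsInTime P W f := StreamMachine.RunsInTime.of_forall_list fun n s hs hsW => by
    refine (hfp n s hs fun i hi => ?_).resolve_left (not_not.2 hsW)
    obtain ⟨j, hj⟩ := List.mem_iff_getElem?.1 hi
    have h1 := (mem_initials_iff.1 hsW).1 (i, j) (mem_indexed.2 hj)
    have h2 : j < s.length := (List.getElem?_eq_some_iff.1 hj).1
    exact h1.trans_le (Nat.pow_le_pow_right (by norm_num) (P.strictMono.monotone (by
      simp only; omega)))
  have hrun' := hrun.mono (le_sum_range_succ f)
  -- Let `S n` be the sum of `f i` over `i ≤ n`, a monotone time bound. Then `S (n + 1) + 1` is a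
  -- modulus, and it dominates `S n`, so it is a time bound as well.
  refine ⟨_, Computable.succ.comp (hf.sum_range_succ.comp Computable.succ),
    hM.isBinaryModulus hrun' (monotone_sum_range_succ f), hrun'.mono fun n => ?_⟩
  exact (monotone_sum_range_succ f n.le_succ).trans (Nat.le_succ _)

/-- The certificate is a length `T` at which every input segment is refuted for `W` and the balls,
or makes the machine print a word that no name of a point of `V` extends. It exists by
`exists_level`: if all initial segments of the output were compatible with the closed set `V`, the
output would name a point of `V`. The parameter `α` allows the target set to vary, which is needed
for rectangles. -/
theorem StreamMachine.ComputesMap.preimage_re [CompactSpace X] [CompactSpace Y]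
    (hP : P.ComputablyCompact) (hM : M.ComputesMap P Q Λ) (hW : P.IsCoComputableSet W)
    {α : Type*} [Primcodable α] {V : α → Set Y} (hVc : ∀ a, IsClosed (V a))
    (hV : REPred fun x : List ℕ × α => x.1 ∉ Q.initials (V x.2)) :
    REPred fun q : List (ℕ × ℕ) × α => ¬ ∃ x : W, (x : X) ∈ P.ballInter q.1 ∧ Λ x ∈ V q.2 := by
  have hWm := hP.isCoComputableSet_iff.1 hW
  have hre : REPred fun q : List (ℕ × ℕ) × α => ∃ T, ∀ s : List ℕ, s.length = T →
      (∀ i ∈ s, i < 2 ^ P.D T) → (s ∉ P.initials (W ∩ P.ballInter q.1) ∨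
        ∃ w : List ℕ, w ∉ Q.initials (V q.2) ∧ encodeSeq w <+: M.outputOn s) := by
    refine REPred.exists ?_
    refine REPred.forall_list ?_ Computable.snd (hP.bound Computable.snd)
    refine REPred.or ?_ ?_
    · exact (hP.not_mem_initials_re hWm.1.isClosed hWm.2).comp
        (f := fun y : ((List (ℕ × ℕ) × α) × ℕ) × List ℕ => (y.1.1.1, y.2))
        ((Computable.fst.comp (Computable.fst.comp Computable.fst)).pair Computable.snd)
    · refine REPred.exists ?_
      refine REPred.and ?_ ?_
      · exact hV.comp
          (f := fun y : (((List (ℕ × ℕ) × α) × ℕ) × List ℕ) × List ℕ => (y.2, y.1.1.1.2))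
          (Computable.snd.pair
            (Computable.snd.comp (Computable.fst.comp (Computable.fst.comp Computable.fst))))
      · exact M.encodeSeq_isPrefix_outputOn_re Computable.snd (Computable.snd.comp Computable.fst)
  refine hre.of_eq fun q => ⟨?_, ?_⟩
  · rintro ⟨T, hT⟩ ⟨x, hxL, hxV⟩
    obtain ⟨u, hu, -⟩ := P.exists_isPointName_half (x : X)
    have hlt : ∀ i ∈ seqPrefix u T, i < 2 ^ P.D T := by
      intro i hi
      obtain ⟨j, hj⟩ := List.mem_iff_getElem?.1 hi
      rw [getElem?_seqPrefix_eq_some] at hj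
      exact hj.2 ▸ (hu j).1.trans_le (Nat.pow_le_pow_right (by norm_num)
        (P.strictMono.monotone hj.1.le))
    rcases hT (seqPrefix u T) (length_seqPrefix _ _) hlt with h | ⟨w, hw, hp⟩
    · exact h (hu.seqPrefix_mem_initials (W := W ∩ P.ballInter q.1) ⟨x.2, hxL⟩ T)
    · rw [M.outputOn_seqPrefix] at hp
      obtain ⟨v, hv, -, hvs⟩ := hM.exists_output x hu
      refine hw ?_
      rw [hvs _ _ hp]
      exact hv.seqPrefix_mem_initials hxV _
  · intro h
    obtain ⟨T, hT⟩ := hM.exists_level (C := W ∩ P.ballInter q.1)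
      (hWm.1.isClosed.inter (isClosed_ballInter _)) Set.inter_subset_left
      (R := fun w => w ∉ Q.initials (V q.2)) fun x hx v hv => by
        by_contra! hc
        obtain ⟨y, hy, hvy⟩ := exists_isPointName_of_forall_mem_initials (hVc q.2) hc
        exact h ⟨x, hx.2, hv.unique hvy ▸ hy⟩
    exact ⟨T, fun s hs _ => or_iff_not_imp_left.2 fun hc => hT s hs (not_not.1 hc)⟩

end MapsBetweenSpaces

/-! ### Preimages, images and rectangles meeting the graph -/

section Images

open Presentation

variable {X Y : Type*} [MetricSpace X] [MetricSpace Y]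
  {P : Presentation X} {Q : Presentation Y} {W : Set X} {Λ : W → Y} {M : StreamMachine}

theorem IsComputableMap.isCoComputableSet_preimage [CompactSpace X] [CompactSpace Y]
    (hP : P.ComputablyCompact) (hQ : Q.ComputablyCompact) (hΛ : IsComputableMap P Q Λ)
    (hW : P.IsCoComputableSet W) {V : Set Y} (hV : Q.IsCoComputableSet V) :
    P.IsCoComputableSet (Subtype.val '' (Λ ⁻¹' V)) := by
  have hcont := hΛ.continuous hW.1
  obtain ⟨M, hM⟩ := hΛ
  refine hP.isCoComputableSet_iff.2 ⟨?_, ?_⟩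
  · have := isCompact_iff_compactSpace.1 hW.1
    exact (hV.1.isClosed.preimage hcont).isCompact.image continuous_subtype_val
  · have hre := hM.preimage_re hP hW (α := Unit) (V := fun _ => V) (fun _ => hV.1.isClosed)
      ((hQ.not_mem_initials_re' hV).comp Computable.fst)
    refine hP.misses_re_of_not_exists ((hre.comp (f := fun L => (L, ()))
      (Computable.id.pair (Computable.const ()))).of_eq fun L => not_congr ⟨?_, ?_⟩)
    · rintro ⟨x, hx, hxV⟩
      exact ⟨x, ⟨x, hxV, rfl⟩, hx⟩
    · rintro ⟨-, ⟨x, hxV, rfl⟩, hx⟩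
      exact ⟨x, hx, hxV⟩

theorem StreamMachine.ComputesMap.rectangle_re [CompactSpace X] [CompactSpace Y]
    (hP : P.ComputablyCompact) (hQ : Q.ComputablyCompact) (hM : M.ComputesMap P Q Λ)
    (hW : P.IsCoComputableSet W) : REPred fun q : List (ℕ × ℕ) × List (ℕ × ℕ) =>
      ¬ ∃ x : W, (x : X) ∈ P.ballInter q.1 ∧ Λ x ∈ Q.ballInter q.2 := by
  refine hM.preimage_re hP hW isClosed_ballInter ?_
  refine ((hQ.not_mem_initials_re isClosed_univ hQ.misses_univ_re).comp
    (Computable.snd.pair Computable.fst)).of_eq fun x => ?_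
  simp only [Set.univ_inter]

/-- The certificate is a finite run and a small ball. `Near` says that the small ball lies in the
given one and in the ball of every entry of the input segment `s`, so `s` starts a name of each of
its points. The ball meets `W`, and an entry printed on `s` places the image of a point of `W` in
the target ball. -/
theorem StreamMachine.ComputesMap.hits_rectangle_re (hP : P.ComputablyCompact)
    (hQ : Q.ComputablyCompact) (hM : M.ComputesMap P Q Λ)
    (hW : REPred fun p : ℕ × ℕ => P.Hits W p.1 p.2) :
    REPred fun q : (ℕ × ℕ) × (ℕ × ℕ) => ∃ x : W,
      (∃ y ∈ P.enum q.1.1, dist y x < (2⁻¹ : ℝ) ^ q.1.2) ∧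
      ∃ z ∈ Q.enum q.2.1, dist z (Λ x) < (2⁻¹ : ℝ) ^ q.2.2 := by
  have hre : REPred fun q : (ℕ × ℕ) × (ℕ × ℕ) => ∃ (s w : List ℕ) (c : ℕ × ℕ),
      (∀ p ∈ indexed s, p.1 < 2 ^ P.D p.2 ∧ P.Near p.1 c.1 p.2 c.2) ∧
      (P.Near q.1.1 c.1 q.1.2 c.2 ∧ P.Hits W c.1 c.2) ∧
      encodeSeq w <+: M.outputOn s ∧ ∃ p ∈ indexed w, Q.Near q.2.1 p.1 q.2.2 p.2 := by
    refine REPred.exists ?_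
    refine REPred.exists ?_
    refine REPred.exists ?_
    have hs : Computable fun x : ((((ℕ × ℕ) × (ℕ × ℕ)) × List ℕ) × List ℕ) × (ℕ × ℕ) => x.1.1.2 :=
      Computable.snd.comp (Computable.fst.comp Computable.fst)
    have hw : Computable fun x : ((((ℕ × ℕ) × (ℕ × ℕ)) × List ℕ) × List ℕ) × (ℕ × ℕ) => x.1.2 :=
      Computable.snd.comp Computable.fst
    have hq : Computable fun x : ((((ℕ × ℕ) × (ℕ × ℕ)) × List ℕ) × List ℕ) × (ℕ × ℕ) => x.1.1.1 :=
      Computable.fst.comp (Computable.fst.comp Computable.fst)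
    have hc : Computable fun x : ((((ℕ × ℕ) × (ℕ × ℕ)) × List ℕ) × List ℕ) × (ℕ × ℕ) => x.2 :=
      Computable.snd
    refine REPred.and ?_ (REPred.and (REPred.and ?_ ?_) (REPred.and ?_ ?_))
    · refine REPred.forall_mem_list ?_ (primrec_indexed.to_comp.comp hs)
      refine REPred.and ?_ ?_
      · exact REPred.lt (Computable.fst.comp Computable.snd)
          (hP.bound (Computable.snd.comp Computable.snd))
      · exact hP.near_re (Computable.fst.comp Computable.snd)
          (Computable.fst.comp (hc.comp Computable.fst)) (Computable.snd.comp Computable.snd)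
          (Computable.snd.comp (hc.comp Computable.fst))
    · exact hP.near_re (Computable.fst.comp (Computable.fst.comp hq)) (Computable.fst.comp hc)
        (Computable.snd.comp (Computable.fst.comp hq)) (Computable.snd.comp hc)
    · exact hits_re_comp hW (Computable.fst.comp hc) (Computable.snd.comp hc)
    · exact M.encodeSeq_isPrefix_outputOn_re hw hs
    · refine REPred.exists_mem_list ?_ (primrec_indexed.to_comp.comp hw)
      exact hQ.near_re (Computable.fst.comp (Computable.snd.comp (hq.comp Computable.fst)))
        (Computable.fst.comp Computable.snd)
        (Computable.snd.comp (Computable.snd.comp (hq.comp Computable.fst)))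
        (Computable.snd.comp Computable.snd)
  refine hre.of_eq fun ⟨⟨u, n⟩, ⟨v, k⟩⟩ => ⟨?_, ?_⟩
  · rintro ⟨s, w, ⟨a, l⟩, hs, ⟨⟨y, hy, y', hy', hd⟩, b, hb, x, hx, hbx⟩, hp, ⟨c, j⟩, hcj,
      z, hz, z', hz', hdz⟩
    simp only at hy hy' hd hb hbx hz hz' hdz
    obtain rfl := Part.mem_unique hy' hb
    have hsx : s ∈ P.initials {x} := mem_initials_iff.2 ⟨fun p hp => (hs p hp).1, x, rfl,
      fun p hp => by
        obtain ⟨-, e, he, e', he', hd⟩ := hs p hp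
        obtain rfl := Part.mem_unique he' hy'
        exact ⟨e, he, by linarith [dist_triangle e e' x]⟩⟩
    obtain ⟨x', rfl, U, hU, m, rfl⟩ := hsx
    rw [M.outputOn_seqPrefix] at hp
    obtain ⟨V, hV, -, hVs⟩ := hM.exists_output ⟨x', hx⟩ hU
    rw [hVs _ _ hp, mem_indexed, getElem?_seqPrefix_eq_some] at hcj
    obtain ⟨-, e, he, hde⟩ := hV j
    rw [hcj.2] at he
    obtain rfl := Part.mem_unique he hz'
    exact ⟨⟨x', hx⟩, ⟨y, hy, by linarith [dist_triangle y y' x']⟩, z, hz,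
      by linarith [dist_triangle z e (Λ ⟨x', hx⟩)]⟩
  · rintro ⟨x, ⟨y, hy, hyx⟩, z, hz, hzx⟩
    simp only at hy hyx hz hzx
    obtain ⟨U, hU, hhalf⟩ := P.exists_isPointName_half (x : X)
    obtain ⟨V, hV, hpr, -⟩ := hM.exists_output x hU
    obtain ⟨j, hj⟩ := exists_half_pow_lt (half_pos (sub_pos.2 hzx))
    obtain ⟨T, hT⟩ := hpr (j + 1)
    -- Twice `2^(-l)` must fit into the room left in the given ball and into the slack of the first
    -- `T` entries, which have halved errors and hence slack at least `2^(-T-1)`.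
    obtain ⟨l, hl⟩ := exists_half_pow_lt (half_pos (lt_min (sub_pos.2 hyx) (half_pow_pos (T + 1))))
    obtain ⟨a, b, hb, hbx⟩ := P.exists_index_lt (x := (x : X)) (half_pow_pos l)
    have hl1 := min_le_left ((2⁻¹ : ℝ) ^ n - dist y x) ((2⁻¹ : ℝ) ^ (T + 1))
    have hl2 := min_le_right ((2⁻¹ : ℝ) ^ n - dist y x) ((2⁻¹ : ℝ) ^ (T + 1))
    refine ⟨seqPrefix U T, seqPrefix V (j + 1), (a, l), fun p hp => ?_, ⟨⟨y, hy, b, hb, ?_⟩,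
      b, hb, x, x.2, hbx⟩, ?_, (V j, j), ?_, ?_⟩
    · obtain ⟨c, i⟩ := p
      rw [mem_indexed, getElem?_seqPrefix_eq_some] at hp
      obtain ⟨hiT, hc⟩ := hp
      change U i = c at hc
      change i < T at hiT
      subst hc
      refine ⟨(hU i).1, ?_⟩
      obtain ⟨e, he, hde⟩ := hhalf i
      refine ⟨e, he, b, hb, ?_⟩
      have h1 := half_pow_succ i
      have h2 : (2⁻¹ : ℝ) ^ (T + 1) ≤ (2⁻¹ : ℝ) ^ (i + 1) := half_pow_le (by omega)
      simp only
      linarith [dist_triangle_right e b (x : X)]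
    · simp only
      linarith [dist_triangle_right y b (x : X)]
    · rw [M.outputOn_seqPrefix]
      exact hT
    · rw [mem_indexed, getElem?_seqPrefix_eq_some]
      exact ⟨Nat.lt_succ_self j, rfl⟩
    · obtain ⟨-, e, he, hde⟩ := hV j
      refine ⟨z, hz, e, he, ?_⟩
      simp only
      linarith [dist_triangle_right z e (Λ x)]

/-- The image is the projection of the graph: missing a ball is missing the rectangle over all of
`X`, and hitting it is hitting some rectangle over it. -/
theorem IsComputableMap.isComputableSet_range [CompactSpace X] [CompactSpace Y]
    (hP : P.ComputablyCompact) (hQ : Q.ComputablyCompact) (hΛ : IsComputableMap P Q Λ)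
    (hW : P.IsComputableSet W) : Q.IsComputableSet (Set.range Λ) := by
  have hcont := hΛ.continuous hW.1
  obtain ⟨M, hM⟩ := hΛ
  have hWc := isCompact_iff_compactSpace.1 hW.1
  refine hQ.isComputableSet_iff.2 ⟨isCompact_range hcont, ?_, ?_⟩
  · refine hQ.misses_re_of_not_exists (((hM.rectangle_re hP hQ hW.isCoComputableSet).comp
      (f := fun L => ([], L)) ((Computable.const []).pair Computable.id)).of_eq fun L => ?_)
    simp only [ballInter_nil, Set.mem_univ, true_and, Set.exists_range_iff]
    rfl
  · have h := hM.hits_rectangle_re hP hQ (hP.isComputableSet_iff.1 hW).2.2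
    have hre : REPred fun p : ℕ × ℕ => ∃ (r : ℕ × ℕ) (x : W),
        (∃ y ∈ P.enum r.1, dist y x < (2⁻¹ : ℝ) ^ r.2) ∧
        ∃ z ∈ Q.enum p.1, dist z (Λ x) < (2⁻¹ : ℝ) ^ p.2 := by
      refine REPred.exists ?_
      exact h.comp (f := fun x : (ℕ × ℕ) × (ℕ × ℕ) => (x.2, x.1))
        (Computable.snd.pair Computable.fst)
    refine hre.of_eq fun p => ⟨?_, ?_⟩
    · rintro ⟨-, x, -, z, hz, hd⟩
      exact ⟨z, hz, _, ⟨x, rfl⟩, hd⟩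
    · rintro ⟨z, hz, -, ⟨x, rfl⟩, hd⟩
      obtain ⟨u, y, hy, hyx⟩ := P.exists_index_lt (x := (x : X)) (half_pow_pos 0)
      exact ⟨(u, 0), x, ⟨y, hy, hyx⟩, z, hz, hd⟩

end Images

/-! ### The product presentation -/

namespace Presentation

variable {X Y : Type*} [MetricSpace X] [MetricSpace Y] {P : Presentation X} {Q : Presentation Y}

/-- The least stage is the unique solution of a semi-decidable relation, so recursive choice returns
it. -/
theorem computable_stage (hP : P.ComputablyCompact) (hQ : Q.ComputablyCompact) :
    Computable (stage P Q) := by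
  have hb : Computable fun m => 2 ^ P.D m * 2 ^ Q.D m :=
    Primrec.nat_mul.to_comp.comp (hP.bound Computable.id) (hQ.bound Computable.id)
  have hre : REPred fun x : ℕ × ℕ => x.1 < 2 ^ P.D x.2 * 2 ^ Q.D x.2 ∧
      ∀ j < x.2, 2 ^ P.D j * 2 ^ Q.D j ≤ x.1 := by
    refine REPred.and (REPred.lt Computable.fst (hb.comp Computable.snd)) ?_
    refine REPred.forall_lt ?_ Computable.snd
    exact REPred.le (hb.comp Computable.snd) (Computable.fst.comp Computable.fst)
  have hiff : ∀ k m, stage P Q k = m ↔ k < 2 ^ P.D m * 2 ^ Q.D m ∧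
      ∀ j < m, 2 ^ P.D j * 2 ^ Q.D j ≤ k := fun k m => by
    rw [stage, Nat.find_eq_iff]
    simp only [not_lt]
  obtain ⟨f, hf, hfp⟩ := REPred.exists_computable (p := fun k m => k < 2 ^ P.D m * 2 ^ Q.D m ∧
      ∀ j < m, 2 ^ P.D j * 2 ^ Q.D j ≤ k) hre fun k => ⟨_, (hiff k _).1 rfl⟩
  exact hf.of_eq fun k => ((hiff k _).2 (hfp k)).symm

theorem computable_unpairIndex (hP : P.ComputablyCompact) (hQ : Q.ComputablyCompact) :
    Computable (unpairIndex P Q) := by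
  have add := Primrec.nat_add.to_comp
  have sub := Primrec.nat_sub.to_comp
  have mul := Primrec.nat_mul.to_comp
  have div := Primrec.nat_div.to_comp
  have mod := Primrec.nat_mod.to_comp
  have k : Computable fun x : ℕ × ℕ => x.1 := Computable.fst
  have M : Computable fun x : ℕ × ℕ => 2 ^ P.D x.2 := hP.bound Computable.snd
  have N : Computable fun x : ℕ × ℕ => 2 ^ Q.D x.2 := hQ.bound Computable.snd
  have M' : Computable fun x : ℕ × ℕ => 2 ^ P.D (x.2 + 1) :=
    hP.bound (Computable.succ.comp Computable.snd)
  have h0 : Computable fun k : ℕ => (k % 2 ^ P.D 0, k / 2 ^ P.D 0) :=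
    (mod.comp Computable.id (Computable.const _)).pair (div.comp Computable.id (Computable.const _))
  have hr := sub.comp k (mul.comp M N)
  have hr' := sub.comp k (mul.comp M' N)
  have hd := sub.comp M' M
  have h1 := Computable.cond (Primrec.nat_lt.decide.to_comp.comp k (mul.comp M' N))
    ((add.comp M (mod.comp hr hd)).pair (div.comp hr hd))
    ((mod.comp hr' M').pair (add.comp N (div.comp hr' M')))
  refine (Computable.nat_casesOn (computable_stage hP hQ) h0 h1.to₂).of_eq fun k => ?_
  unfold unpairIndex
  cases stage P Q k with
  | zero => rfl
  | succ m => simp only [Bool.cond_decide]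

theorem ComputablyCompact.dist_re (hP : P.ComputablyCompact) {α : Type*} [Primcodable α]
    {a b : α → ℤ} {n u v : α → ℕ} (ha : Computable a) (hb : Computable b) (hn : Computable n)
    (hu : Computable u) (hv : Computable v) :
    REPred fun x => ∃ y ∈ P.enum (u x), ∃ z ∈ P.enum (v x),
      (a x : ℝ) / 2 ^ n x < dist y z ∧ dist y z < (b x : ℝ) / 2 ^ n x :=
  hP.2.2.comp (ha.pair (hb.pair (hn.pair (hu.pair hv))))

theorem mem_prod_enum {k : ℕ} {z : X × Y} : z ∈ (P.prod Q).enum k ↔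
    z.1 ∈ P.enum (unpairIndex P Q k).1 ∧ z.2 ∈ Q.enum (unpairIndex P Q k).2 :=
  PFun.mem_prodMap

theorem mem_dom_prod {k : ℕ} : k ∈ (P.prod Q).enum.Dom ↔
    (unpairIndex P Q k).1 ∈ P.enum.Dom ∧ (unpairIndex P Q k).2 ∈ Q.enum.Dom := by
  simp only [PFun.mem_dom, mem_prod_enum, Prod.exists, exists_and_left, exists_and_right]

/-- For the maximum metric, both distances must satisfy the upper bound and at least one the lower
bound. The irrelevant bound in each comparison is made vacuous by the constants -1 and 2. -/
theorem ComputablyCompact.prod (hP : P.ComputablyCompact) (hQ : Q.ComputablyCompact) :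
    (P.prod Q).ComputablyCompact := by
  have hun := computable_unpairIndex hP hQ
  refine ⟨?_, Primrec.nat_add.to_comp.comp hP.2.1 hQ.2.1, ?_⟩
  · refine ComputablePred.computable_iff_re_compl_re'.2 ⟨?_, ?_⟩
    · exact ((hP.dom_re (Computable.fst.comp hun)).and
        (hQ.dom_re (Computable.snd.comp hun))).of_eq fun k => mem_dom_prod.symm
    · exact ((hP.not_dom_re (Computable.fst.comp hun)).or
        (hQ.not_dom_re (Computable.snd.comp hun))).of_eq fun k => by
          rw [mem_dom_prod, not_and_or]
  · have ha : Computable fun q : ℤ × ℤ × ℕ × ℕ × ℕ => q.1 := Computable.fst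
    have hb : Computable fun q : ℤ × ℤ × ℕ × ℕ × ℕ => q.2.1 := Computable.fst.comp Computable.snd
    have hn : Computable fun q : ℤ × ℤ × ℕ × ℕ × ℕ => q.2.2.1 :=
      Computable.fst.comp (Computable.snd.comp Computable.snd)
    have hu : Computable fun q : ℤ × ℤ × ℕ × ℕ × ℕ => unpairIndex P Q q.2.2.2.1 :=
      hun.comp (Computable.fst.comp (Computable.snd.comp (Computable.snd.comp Computable.snd)))
    have hv : Computable fun q : ℤ × ℤ × ℕ × ℕ × ℕ => unpairIndex P Q q.2.2.2.2 :=
      hun.comp (Computable.snd.comp (Computable.snd.comp (Computable.snd.comp Computable.snd)))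
    have h1 : Computable fun _ : ℤ × ℤ × ℕ × ℕ × ℕ => (-1 : ℤ) := Computable.const _
    have h2 : Computable fun q : ℤ × ℤ × ℕ × ℕ × ℕ => ((2 * 2 ^ q.2.2.1 : ℕ) : ℤ) :=
      Int.primrec_natCast.to_comp.comp (Primrec.nat_double.to_comp.comp
        (Nat.computable_two_pow hn))
    have hu1 := Computable.fst.comp hu
    have hu2 := Computable.snd.comp hu
    have hv1 := Computable.fst.comp hv
    have hv2 := Computable.snd.comp hv
    refine (((hP.dist_re h1 hb hn hu1 hv1).and (hQ.dist_re h1 hb hn hu2 hv2)).and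
      ((hP.dist_re ha h2 hn hu1 hv1).or (hQ.dist_re ha h2 hn hu2 hv2))).of_eq
        fun ⟨a, b, n, k, l⟩ => ?_
    have hneg : ((-1 : ℤ) : ℝ) / 2 ^ n < 0 := div_neg_of_neg_of_pos (by norm_num) (by positivity)
    have htwo : (((2 * 2 ^ n : ℕ) : ℤ) : ℝ) / 2 ^ n = 2 := by
      push_cast
      field_simp
    simp only [mem_prod_enum, htwo]
    constructor
    · rintro ⟨⟨⟨x, hx, x', hx', -, hdx⟩, y, hy, y', hy', -, hdy⟩, h⟩
      refine ⟨(x, y), ⟨hx, hy⟩, (x', y'), ⟨hx', hy'⟩, ?_, ?_⟩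
      · rw [Prod.dist_eq, lt_max_iff]
        rcases h with ⟨z, hz, z', hz', h, -⟩ | ⟨z, hz, z', hz', h, -⟩
        · obtain rfl := Part.mem_unique hx hz
          obtain rfl := Part.mem_unique hx' hz'
          exact Or.inl h
        · obtain rfl := Part.mem_unique hy hz
          obtain rfl := Part.mem_unique hy' hz'
          exact Or.inr h
      · rw [Prod.dist_eq]
        exact max_lt hdx hdy
    · rintro ⟨⟨x, y⟩, ⟨hx, hy⟩, ⟨x', y'⟩, ⟨hx', hy'⟩, hlt, hgt⟩
      rw [Prod.dist_eq, lt_max_iff] at hlt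
      rw [Prod.dist_eq, max_lt_iff] at hgt
      refine ⟨⟨⟨x, hx, x', hx', hneg.trans_le dist_nonneg, hgt.1⟩,
        y, hy, y', hy', hneg.trans_le dist_nonneg, hgt.2⟩, hlt.imp (fun h => ?_) fun h => ?_⟩
      · exact ⟨x, hx, x', hx', h, (P.diam_le _ _).trans_lt one_lt_two⟩
      · exact ⟨y, hy, y', hy', h, (Q.diam_le _ _).trans_lt one_lt_two⟩

end Presentation

theorem IsComputableMap.isComputableSet_mapGraph {X Y : Type*} [MetricSpace X] [MetricSpace Y]
    [CompactSpace X] [CompactSpace Y] {P : Presentation X} {Q : Presentation Y} {W : Set X}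
    {Λ : W → Y} (hP : P.ComputablyCompact) (hQ : Q.ComputablyCompact)
    (hΛ : IsComputableMap P Q Λ) (hW : P.IsComputableSet W) :
    (P.prod Q).IsComputableSet (mapGraph Λ) := by
  have hcont := hΛ.continuous hW.1
  obtain ⟨M, hM⟩ := hΛ
  have hWc := isCompact_iff_compactSpace.1 hW.1
  have hun := Presentation.computable_unpairIndex hP hQ
  have hu := Computable.fst.comp (hun.comp (Computable.fst (α := ℕ) (β := ℕ)))
  have hv := Computable.snd.comp (hun.comp (Computable.fst (α := ℕ) (β := ℕ)))
  have hn := Computable.snd (α := ℕ) (β := ℕ)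
  refine (hP.prod hQ).isComputableSet_iff.2
    ⟨isCompact_range (continuous_subtype_val.prodMk hcont), ?_, ?_⟩
  · refine ((hM.rectangle_re hP hQ hW.isCoComputableSet).comp
      ((Computable.list_cons.comp (hu.pair hn) (Computable.const [])).pair
        (Computable.list_cons.comp (hv.pair hn) (Computable.const [])))).of_eq fun p => ?_
    simp only [Presentation.ballInter, List.mem_singleton, forall_eq]
    constructor
    · rintro h z hz - ⟨x, rfl⟩
      rw [Presentation.mem_prod_enum] at hz
      by_contra! hd
      rw [Prod.dist_eq, max_le_iff] at hd
      exact h ⟨x, ⟨z.1, hz.1, hd.1⟩, z.2, hz.2, hd.2⟩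
    · rintro h ⟨x, ⟨y, hy, hyd⟩, z, hz, hzd⟩
      refine absurd (h (y, z) (Presentation.mem_prod_enum.2 ⟨hy, hz⟩) _ ⟨x, rfl⟩) (not_lt.2 ?_)
      rw [Prod.dist_eq]
      exact max_le hyd hzd
  · refine ((hM.hits_rectangle_re hP hQ (hP.isComputableSet_iff.1 hW).2.2).comp
      ((hu.pair hn).pair (hv.pair hn))).of_eq fun p => ?_
    constructor
    · rintro ⟨x, ⟨y, hy, hyd⟩, z, hz, hzd⟩
      refine ⟨(y, z), Presentation.mem_prod_enum.2 ⟨hy, hz⟩, _, ⟨x, rfl⟩, ?_⟩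
      rw [Prod.dist_eq]
      exact max_lt hyd hzd
    · rintro ⟨z, hz, -, ⟨x, rfl⟩, hd⟩
      rw [Presentation.mem_prod_enum] at hz
      rw [Prod.dist_eq, max_lt_iff] at hd
      exact ⟨x, ⟨z.1, hz.1, hd.1⟩, z.2, hz.2, hd.2⟩

/-! ### Machines with finitely many stacks -/

/-- Code 0 is reserved for `s₀`: state 0 is initial and symbol 0 is blank, so they must decode to
the start state and to "no symbol". -/
theorem exists_finite_code {S : Type*} {F : Set S} (hF : F.Finite) (s₀ : S) :
    ∃ (q : ℕ) (enc : S → Fin (q + 1)) (dec : Fin (q + 1) → S),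
      dec 0 = s₀ ∧ ∀ s ∈ F, dec (enc s) = s := by
  classical
  have := hF.to_subtype
  obtain ⟨q, ⟨e⟩⟩ := Finite.exists_equiv_fin F
  refine ⟨q, fun s => if h : s ∈ F then (e ⟨s, h⟩).succ else 0,
    Fin.cases s₀ fun i => (e.symm i : S), rfl, fun s hs => ?_⟩
  simp [hs]

/-- The effect of one step of a stack machine. -/
structure StackAction (K Γ S : Type) where
  /-- the next state -/
  next : S
  /-- the stack operation: `(k, some a)` pushes `a` to the stack `k`, and `(k, none)` pops it -/
  op : Option (K × Option Γ)
  /-- whether the input head advances -/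
  advance : Bool
  /-- the symbol (if any) to be printed -/
  print : Option (Option Bool)

/-- A machine with stacks instead of work tapes. -/
structure StackMachine (K Γ S : Type) where
  start : S
  δ : S → Option Bool → (K → Option Γ) → StackAction K Γ S

namespace StackMachine

variable {K Γ S : Type} [DecidableEq K]

/-- A configuration of a stack machine. -/
structure Config (K Γ S : Type) where
  state : S
  stk : K → List Γ
  pos : ℕ
  out : List (Option Bool)

/-- The effect of a stack operation. -/
def applyOp (stk : K → List Γ) : Option (K × Option Γ) → K → List Γ
  | none => stk
  | some (k, none) => Function.update stk k (stk k).tail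
  | some (k, some a) => Function.update stk k (a :: stk k)

/-- One step on the input `u`. -/
def step (N : StackMachine K Γ S) (u : ℕ → ℕ) (c : Config K Γ S) : Config K Γ S :=
  let a := N.δ c.state (inputSymbol u c.pos) fun k => (c.stk k).head?
  { state := a.next
    stk := applyOp c.stk a.op
    pos := if a.advance then c.pos + 1 else c.pos
    out := c.out ++ a.print.toList }

/-- The initial configuration. -/
def init (N : StackMachine K Γ S) : Config K Γ S :=
  ⟨N.start, fun _ => [], 0, []⟩

end StackMachine

/-- The work tape `T` holds the stack `L`, with the head on its top. -/
def WorkTape.Holds {g : ℕ} {Γ : Type} (enc : Option Γ → Fin (g + 1)) (T : WorkTape g)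
    (L : List Γ) : Prop :=
  ∃ j, T.2.1 :: T.1 = L.map (fun a => enc (some a)) ++ List.replicate j 0

namespace WorkTape.Holds

variable {g : ℕ} {Γ : Type} {enc : Option Γ → Fin (g + 1)} {T : WorkTape g} {L : List Γ}

theorem nil : WorkTape.Holds enc ([], 0, []) [] :=
  ⟨1, rfl⟩

theorem head (h : T.Holds enc L) {dec : Fin (g + 1) → Option Γ} (h0 : dec 0 = none)
    (hdec : ∀ x, dec (enc x) = x) : dec T.2.1 = L.head? := by
  obtain ⟨j, hj⟩ := h
  cases L with
  | nil =>
    cases j with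
    | zero => simp at hj
    | succ j =>
      simp only [List.map_nil, List.nil_append, List.replicate_succ, List.cons.injEq] at hj
      rw [hj.1, h0]
      rfl
  | cons a L =>
    simp only [List.map_cons, List.cons_append, List.cons.injEq] at hj
    rw [hj.1, hdec]
    rfl

/-- Moving left exposes the next symbol of the stack, or a blank at its bottom. The symbol left
behind on the right is harmless, since a push overwrites it. -/
theorem pop (h : T.Holds enc L) (a : Fin (g + 1)) :
    (T.act a (some Turing.Dir.left)).Holds enc L.tail := by
  obtain ⟨j, hj⟩ := h
  have key : ∀ l : List (Fin (g + 1)), l.headD 0 :: l.tail = l ∨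
      l = [] ∧ l.headD 0 :: l.tail = [0] := fun l => by cases l <;> simp
  simp only [WorkTape.Holds, WorkTape.act]
  cases L with
  | nil =>
    cases j with
    | zero => simp at hj
    | succ j =>
      simp only [List.map_nil, List.nil_append, List.replicate_succ, List.cons.injEq] at hj
      rcases key T.1 with h | ⟨-, h⟩
      · exact ⟨j, by rw [h, hj.2]; rfl⟩
      · exact ⟨1, by rw [h]; rfl⟩
  | cons b L =>
    simp only [List.map_cons, List.cons_append, List.cons.injEq] at hj
    rcases key T.1 with h | ⟨h0, h⟩
    · exact ⟨j, by rw [h, hj.2]; rfl⟩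
    · rw [hj.2] at h0
      simp only [List.append_eq_nil_iff, List.map_eq_nil_iff] at h0
      exact ⟨1, by rw [h, h0.1]; rfl⟩

/-- A step writes before it moves, so a push takes two steps: move to a fresh cell, then write there
without moving. -/
theorem push (h : T.Holds enc L) (a : Γ) :
    ((T.act T.2.1 (some Turing.Dir.right)).act (enc (some a)) none).Holds enc (a :: L) := by
  obtain ⟨j, hj⟩ := h
  exact ⟨j, by simp only [WorkTape.act, hj, List.map_cons, List.cons_append]⟩

end WorkTape.Holds

namespace StackMachine

variable {K Γ S : Type} [DecidableEq K]

/-- The action of the stream machine that simulates a stack machine. Its states are the states of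
the stack machine together with a symbol that remains to be pushed. -/
def simulate (N : StackMachine K Γ S) {k q g : ℕ} (e : K ≃ Fin k)
    (enc : S × Option (K × Γ) → Fin (q + 1)) (dec : Fin (q + 1) → S × Option (K × Γ))
    (encΓ : Option Γ → Fin (g + 1)) (decΓ : Fin (g + 1) → Option Γ) (s : Fin (q + 1))
    (b : Option Bool) (r : Fin k → Fin (g + 1)) : MachineAction k q g :=
  match (dec s).2 with
  | some (i, a) =>
    { next := enc ((dec s).1, none)
      write := fun j => if j = e i then encΓ (some a) else r j
      move := fun _ => none
      advance := false
      print := none }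
  | none =>
    let A := N.δ (dec s).1 b fun i => decΓ (r (e i))
    { next := enc (A.next, A.op.bind fun x => x.2.map fun a => (x.1, a))
      write := r
      move := fun j => A.op.bind fun x => if j = e x.1 then
        some (if x.2.isSome then Turing.Dir.right else Turing.Dir.left) else none
      advance := A.advance
      print := A.print }

/-- Every stack machine with finitely many states is simulated by a stream machine. -/
theorem exists_streamMachine [Finite K] [Finite Γ] (N : StackMachine K Γ S) {F : Set S}
    (hF : F.Finite) (hstart : N.start ∈ F) (hcl : ∀ s ∈ F, ∀ b r, (N.δ s b r).next ∈ F) :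
    ∃ M : StreamMachine, ∀ u n, ∃ t, (M.run u t).pos = ((N.step u)^[n] N.init).pos ∧
      (M.run u t).out = ((N.step u)^[n] N.init).out := by
  obtain ⟨k, ⟨e⟩⟩ := Finite.exists_equiv_fin K
  obtain ⟨q, enc, dec, hdec0, hdec⟩ := exists_finite_code
    (hF.prod (Set.finite_univ (α := Option (K × Γ)))) (N.start, none)
  obtain ⟨g, encΓ, decΓ, hdecΓ0, hdecΓ⟩ := exists_finite_code (Set.finite_univ (α := Option Γ)) none
  replace hdec : ∀ s ∈ F, ∀ o, dec (enc (s, o)) = (s, o) := fun s hs o => hdec _ ⟨hs, trivial⟩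
  replace hdecΓ : ∀ x, decΓ (encΓ x) = x := fun x => hdecΓ x trivial
  let M : StreamMachine := ⟨k, q, g, N.simulate e enc dec encΓ decΓ⟩
  -- Invariant after each stack step: no push is pending, all stacks are held by the tapes, and
  -- input position and output agree.
  have key : ∀ u n, ((N.step u)^[n] N.init).state ∈ F ∧
      ∃ t, dec (M.run u t).state = (((N.step u)^[n] N.init).state, none) ∧
        (∀ i, ((M.run u t).tape (e i)).Holds encΓ (((N.step u)^[n] N.init).stk i)) ∧
        (M.run u t).pos = ((N.step u)^[n] N.init).pos ∧
        (M.run u t).out = ((N.step u)^[n] N.init).out := by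
    intro u n
    induction n with
    | zero => exact ⟨hstart, 0, hdec0, fun i => WorkTape.Holds.nil, rfl, rfl⟩
    | succ n ih =>
      rw [Function.iterate_succ_apply']
      generalize (N.step u)^[n] N.init = d at ih
      obtain ⟨hdF, t, hst, htape, hpos, hout⟩ := ih
      have hnF : (N.step u d).state ∈ F := hcl _ hdF _ _
      refine ⟨hnF, ?_⟩
      have hread : (fun i => decΓ (((M.run u t).tape (e i)).2.1)) = fun i => (d.stk i).head? :=
        funext fun i => (htape i).head hdecΓ0 hdecΓ
      generalize hA : N.δ d.state (inputSymbol u d.pos) (fun i => (d.stk i).head?) = A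
      have hδ : M.δ (M.run u t).state (inputSymbol u (M.run u t).pos)
          (fun j => ((M.run u t).tape j).2.1) =
          { next := enc (A.next, A.op.bind fun x => x.2.map fun a => (x.1, a))
            write := fun j => ((M.run u t).tape j).2.1
            move := fun j => A.op.bind fun x => if j = e x.1 then
              some (if x.2.isSome then Turing.Dir.right else Turing.Dir.left) else none
            advance := A.advance
            print := A.print } := by
        simp only [M, simulate]
        rw [hst]
        simp only
        rw [hread, hpos, hA]
      have hN : N.step u d = ⟨A.next, applyOp d.stk A.op,
          if A.advance then d.pos + 1 else d.pos, d.out ++ A.print.toList⟩ := by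
        simp only [step, hA]
      have hAF : A.next ∈ F := by rw [hN] at hnF; exact hnF
      have h1 : M.run u (t + 1) = ⟨enc (A.next, A.op.bind fun x => x.2.map fun a => (x.1, a)),
          fun j => ((M.run u t).tape j).act ((M.run u t).tape j).2.1
            (A.op.bind fun x => if j = e x.1 then
              some (if x.2.isSome then Turing.Dir.right else Turing.Dir.left) else none),
          if A.advance then d.pos + 1 else d.pos, d.out ++ A.print.toList⟩ := by
        simp only [StreamMachine.run, StreamMachine.step]
        rw [hδ, hpos, hout]
      rw [hN]
      rcases hop : A.op with _ | ⟨i, _ | a⟩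
      · refine ⟨t + 1, ?_⟩
        rw [h1]
        simp only [hop, Option.bind_none, applyOp]
        exact ⟨hdec _ hAF _, htape, by simp, by simp⟩
      · refine ⟨t + 1, ?_⟩
        rw [h1]
        simp only [hop, Option.bind_some, applyOp, Option.map_none]
        refine ⟨hdec _ hAF _, fun j => ?_, by simp, by simp⟩
        by_cases hj : j = i
        · subst hj
          simpa using (htape j).pop _
        · simp only [e.injective.eq_iff, hj, if_false, Function.update_of_ne hj]
          exact htape j
      -- The intermediate state remembers the symbol to be pushed. Its step neither advances the
      -- input head nor prints.
      · refine ⟨t + 2, ?_⟩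
        have h2 : M.δ (M.run u (t + 1)).state (inputSymbol u (M.run u (t + 1)).pos)
            (fun j => ((M.run u (t + 1)).tape j).2.1) =
            { next := enc (A.next, none)
              write := fun j => if j = e i then encΓ (some a) else ((M.run u (t + 1)).tape j).2.1
              move := fun _ => none
              advance := false
              print := none } := by
          have h3 : dec (M.run u (t + 1)).state = (A.next, some (i, a)) := by
            rw [h1]
            simp only [hop, Option.bind_some, Option.map_some]
            exact hdec _ hAF _
          simp only [M, simulate]
          rw [h3]
        have h4 : M.run u (t + 2) = M.step u (M.run u (t + 1)) := rfl
        rw [h4, StreamMachine.step]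
        simp only [h2]
        rw [h1]
        simp only [hop, Option.bind_some, applyOp, Option.isSome_some, if_true, Option.toList_none,
          List.append_nil]
        refine ⟨hdec _ hAF _, fun j => ?_, by simp, by simp⟩
        by_cases hj : j = i
        · subst hj
          simpa using (htape j).push a
        · simp only [e.injective.eq_iff, hj, if_false, Function.update_of_ne hj]
          exact htape j
  refine ⟨M, fun u n => ?_⟩
  obtain ⟨-, t, -, -, hpos, hout⟩ := key u n
  exact ⟨t, hpos, hout⟩

end StackMachine

/-! ### A stack machine that iterates a recursive function on its input -/

section Iteration

open Turing Turing.PartrecToTM2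

instance : Finite K' :=
  Finite.of_injective (fun k : K' => (K'.casesOn k 0 1 2 3 : Fin 4)) fun a b h => by
    cases a <;> cases b <;> simp_all

/-- The states of the machine: `exec` executes a statement of the program for a code, and the
others supply its input and print its output. -/
inductive Control
  | start
  | read
  | feed (b : Option Bool)
  | feedZero
  | exec (q : Stmt') (v : Option Γ')
  | print
  | printOdd
  | printEven
  | drop

namespace Control

/-- The continuation after a step of the program. -/
def resume (c : Cfg') : Control :=
  match c.l with
  | some l => exec (tr l) c.var
  | none => print

/-- The action in a state that executes a statement. -/
def execAction (v : Option Γ') (r : K' → Option Γ') : Stmt' → StackAction K' Γ' Control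
  | TM2.Stmt.push k f q => ⟨exec q v, some (k, some (f v)), false, none⟩
  | TM2.Stmt.peek k f q => ⟨exec q (f v (r k)), none, false, none⟩
  | TM2.Stmt.pop k f q => ⟨exec q (f v (r k)), some (k, none), false, none⟩
  | TM2.Stmt.load f q => ⟨exec q (f v), none, false, none⟩
  | TM2.Stmt.branch f q₁ q₂ => ⟨exec (cond (f v) q₁ q₂) v, none, false, none⟩
  | TM2.Stmt.goto f => ⟨exec (tr (f v)) v, none, false, none⟩
  | TM2.Stmt.halt => ⟨print, none, false, none⟩

/-- The state in which the program for the code `c` starts. -/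
def entry (c : ToPartrec.Code) : Control :=
  exec (tr (trNormal c Cont'.halt)) none

/-- The action of the machine. -/
def action (c : ToPartrec.Code) (s : Control) (b : Option Bool) (r : K' → Option Γ') :
    StackAction K' Γ' Control :=
  match s with
  | start => ⟨read, some (K'.main, some Γ'.cons), false, none⟩
  | read => ⟨feed b, some (K'.main, some Γ'.cons), true, none⟩
  | feed none => ⟨entry c, none, false, none⟩
  | feed (some false) => ⟨entry c, some (K'.main, some Γ'.bit1), false, none⟩
  | feed (some true) => ⟨feedZero, some (K'.main, some Γ'.bit1), false, none⟩
  | feedZero => ⟨entry c, some (K'.main, some Γ'.bit0), false, none⟩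
  | exec q v => execAction v r q
  | print => ⟨if r K'.main = some Γ'.cons then read else
      if r K'.main = some Γ'.bit1 then printOdd else printEven, some (K'.main, none), false, none⟩
  | printOdd => ⟨if r K'.main = some Γ'.cons then read else drop, some (K'.main, none), false,
      some (if r K'.main = some Γ'.cons then none else some true)⟩
  | printEven => ⟨drop, some (K'.main, none), false, some (some false)⟩
  | drop => ⟨read, some (K'.main, none), false, none⟩

/-- The states that the machine can reach. -/
def reachable (c : ToPartrec.Code) : Set Control :=
  {s | ∀ q v, s = exec q v → some q ∈ TM2.stmts tr (codeSupp c Cont'.halt)}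

end Control

/-- The machine that iterates the function with code `c`. -/
def iterationMachine (c : ToPartrec.Code) : StackMachine K' Γ' Control :=
  ⟨Control.start, Control.action c⟩

/-- Symbols of the tapes as numbers. -/
def symbolCode : Option Bool → ℕ
  | none => 0
  | some false => 1
  | some true => 2

/-- Printed symbols (if any) as numbers. -/
def printCode : Option (Option Bool) → ℕ
  | none => 0
  | some none => 1
  | some (some false) => 2
  | some (some true) => 3

namespace Control

/-- Arbitrary statements could be executed, but only the finitely many substatements of the program
supported by `codeSupp` occur. -/
theorem finite_reachable (c : ToPartrec.Code) : (reachable c).Finite := by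
  classical
  have h1 : {q : Stmt' | some q ∈ TM2.stmts tr (codeSupp c Cont'.halt)}.Finite :=
    (TM2.stmts tr (codeSupp c Cont'.halt)).finite_toSet.preimage (Option.some_injective _).injOn
  have h2 := Set.Finite.image2 exec h1 (Set.finite_univ (α := Option Γ'))
  have h3 : (Set.range feed).Finite := Set.finite_range feed
  refine (((h2.union h3).union (Set.toFinite {start, read, feedZero, print, printOdd, printEven,
    drop}))).subset fun s hs => ?_
  cases s with
  | exec q v => exact Or.inl (Or.inl ⟨q, hs q v rfl, v, trivial, rfl⟩)
  | feed b => exact Or.inl (Or.inr ⟨b, rfl⟩)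
  | _ => exact Or.inr (by simp)

theorem tr_mem_stmts {c : ToPartrec.Code} {l : Λ'} (h : l ∈ codeSupp c Cont'.halt) :
    some (tr l) ∈ TM2.stmts tr (codeSupp c Cont'.halt) := by
  classical
  exact Finset.some_mem_insertNone.2 (Finset.mem_biUnion.2 ⟨l, h, TM2.stmts₁_self⟩)

theorem entry_mem_reachable (c : ToPartrec.Code) : entry c ∈ reachable c := by
  rintro q v h
  simp only [entry, exec.injEq] at h
  rw [← h.1]
  exact tr_mem_stmts (codeSupp_self _ _ (trStmts₁_self _))

theorem execAction_mem_reachable {c : ToPartrec.Code} {q : Stmt'}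
    (h : some q ∈ TM2.stmts tr (codeSupp c Cont'.halt)) (v : Option Γ') (r : K' → Option Γ') :
    (execAction v r q).next ∈ reachable c := by
  classical
  have hsub : ∀ q' : Stmt', q' ∈ TM2.stmts₁ q → ∀ w, exec q' w ∈ reachable c := by
    rintro q' hq' w q'' w' h'
    simp only [exec.injEq] at h'
    rw [← h'.1]
    exact TM2.stmts_trans hq' h
  cases q with
  | push k f q => exact hsub q (Finset.mem_insert_of_mem TM2.stmts₁_self) _
  | peek k f q => exact hsub q (Finset.mem_insert_of_mem TM2.stmts₁_self) _
  | pop k f q => exact hsub q (Finset.mem_insert_of_mem TM2.stmts₁_self) _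
  | load f q => exact hsub q (Finset.mem_insert_of_mem TM2.stmts₁_self) _
  | branch f q₁ q₂ =>
    refine hsub _ (Finset.mem_insert_of_mem (Finset.mem_union.2 ?_)) _
    cases f v
    · exact Or.inr TM2.stmts₁_self
    · exact Or.inl TM2.stmts₁_self
  | goto f =>
    -- `tr_supports` refers to this choice of the initial label.
    let _ : Inhabited Λ' := ⟨trNormal c Cont'.halt⟩
    have hs := TM2.stmts_supportsStmt (tr_supports c Cont'.halt) h
    rintro q' w h'
    simp only [execAction, exec.injEq] at h'
    rw [← h'.1]
    exact tr_mem_stmts (hs v)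
  | halt =>
    rintro q' w h'
    simp [execAction] at h'

theorem action_mem_reachable (c : ToPartrec.Code) : ∀ s ∈ reachable c, ∀ b r,
    (action c s b r).next ∈ reachable c := by
  have hne : ∀ s : Control, (∀ q v, s ≠ exec q v) → s ∈ reachable c :=
    fun s hs q v h => absurd h (hs q v)
  intro s hs b r
  cases s with
  | exec q v => exact execAction_mem_reachable (hs q v rfl) v r
  | feed b =>
    rcases b with _ | _ | _
    · exact entry_mem_reachable c
    · exact entry_mem_reachable c
    · exact hne _ (by simp [action])
  | feedZero => exact entry_mem_reachable c
  | print =>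
    refine hne _ fun q v => ?_
    simp only [action]
    split_ifs <;> simp
  | printOdd =>
    refine hne _ fun q v => ?_
    simp only [action]
    split_ifs <;> simp
  | _ => exact hne _ (by simp [action])

end Control

namespace iterationMachine

variable {c : ToPartrec.Code} {u : ℕ → ℕ}

/-- Reachability of configurations. -/
def Reaches (c : ToPartrec.Code) (u : ℕ → ℕ) (d d' : StackMachine.Config K' Γ' Control) : Prop :=
  ∃ n, ((iterationMachine c).step u)^[n] d = d'

theorem Reaches.refl (d : StackMachine.Config K' Γ' Control) : Reaches c u d d :=
  ⟨0, rfl⟩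

theorem Reaches.trans {d₁ d₂ d₃ : StackMachine.Config K' Γ' Control} (h : Reaches c u d₁ d₂)
    (h' : Reaches c u d₂ d₃) : Reaches c u d₁ d₃ := by
  obtain ⟨m, rfl⟩ := h
  obtain ⟨n, rfl⟩ := h'
  exact ⟨n + m, Function.iterate_add_apply _ _ _ _⟩

theorem Reaches.of_step {d d' d'' : StackMachine.Config K' Γ' Control}
    (h : (iterationMachine c).step u d = d') (h' : Reaches c u d' d'') : Reaches c u d d'' :=
  Reaches.trans ⟨1, h⟩ h'

/-- A step of the stack program runs a whole statement up to its jump or halt; here each of its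
instructions is a step of its own. -/
theorem reaches_stepAux (q : Stmt') (v : Option Γ') (S : K' → List Γ') (p : ℕ)
    (o : List (Option Bool)) :
    Reaches c u ⟨Control.exec q v, S, p, o⟩
      ⟨Control.resume (TM2.stepAux q v S), (TM2.stepAux q v S).stk, p, o⟩ := by
  induction q generalizing v S with
  | push k f q ih =>
    refine .of_step ?_ (ih _ _)
    simp [StackMachine.step, iterationMachine, Control.action, Control.execAction,
      StackMachine.applyOp]
  | peek k f q ih =>
    refine .of_step ?_ (ih _ _)
    simp [StackMachine.step, iterationMachine, Control.action, Control.execAction,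
      StackMachine.applyOp]
  | pop k f q ih =>
    refine .of_step ?_ (ih _ _)
    simp [StackMachine.step, iterationMachine, Control.action, Control.execAction,
      StackMachine.applyOp]
  | load f q ih =>
    refine .of_step ?_ (ih _ _)
    simp [StackMachine.step, iterationMachine, Control.action, Control.execAction,
      StackMachine.applyOp]
  | branch f q₁ q₂ ih₁ ih₂ =>
    refine .of_step (d' := ⟨Control.exec (cond (f v) q₁ q₂) v, S, p, o⟩) ?_ ?_
    · simp [StackMachine.step, iterationMachine, Control.action, Control.execAction,
        StackMachine.applyOp]
    · simp only [TM2.stepAux]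
      cases f v
      · exact ih₂ _ _
      · exact ih₁ _ _
  | goto f =>
    refine .of_step ?_ (.refl _)
    simp [StackMachine.step, iterationMachine, Control.action, Control.execAction,
      StackMachine.applyOp, Control.resume]
  | halt =>
    refine .of_step ?_ (.refl _)
    simp [StackMachine.step, iterationMachine, Control.action, Control.execAction,
      StackMachine.applyOp, Control.resume]

theorem reaches_of_reaches {a b : Cfg'} (h : StateTransition.Reaches (TM2.step tr) a b) (p : ℕ)
    (o : List (Option Bool)) :
    Reaches c u ⟨Control.resume a, a.stk, p, o⟩ ⟨Control.resume b, b.stk, p, o⟩ := by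
  induction h with
  | refl => exact .refl _
  | tail _ hbc ih =>
    rename_i b d _
    refine ih.trans ?_
    obtain ⟨_ | l, v, S⟩ := b
    · cases hbc
    · cases hbc
      exact reaches_stepAux _ _ _ _ _

/-- This is the correctness theorem `tr_eval` of the compilation, transported step by step. All
stacks except the main one are empty again at the end, so the program can be restarted. -/
theorem reaches_print {v w : List ℕ} (h : w ∈ c.eval v) (p : ℕ) (o : List (Option Bool)) :
    Reaches c u ⟨Control.entry c, K'.elim (trList v) [] [] [], p, o⟩
      ⟨Control.print, K'.elim (trList w) [] [] [], p, o⟩ := by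
  have h1 : PartrecToTM2.halt w ∈ StateTransition.eval (TM2.step tr) (PartrecToTM2.init c v) := by
    rw [tr_eval]
    exact Part.mem_map _ h
  exact reaches_of_reaches (StateTransition.mem_eval.1 h1).1 p o

theorem trNat_one : trNat 1 = [Γ'.bit1] := rfl

theorem trNat_two : trNat 2 = [Γ'.bit0, Γ'.bit1] := rfl

theorem trNat_three : trNat 3 = [Γ'.bit1, Γ'.bit1] := rfl

/-- A number lies on the main stack with its least significant digit on top and a delimiter below.
Hence a new argument is pushed delimiter first and digits from the top one downwards. -/
theorem reaches_entry (N p : ℕ) (o : List (Option Bool)) :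
    Reaches c u ⟨Control.read, K'.elim (trList [N]) [] [] [], p, o⟩
      ⟨Control.entry c, K'.elim (trList [symbolCode (inputSymbol u p), N]) [] [] [], p + 1, o⟩ := by
  refine .of_step (d' := ⟨Control.feed (inputSymbol u p),
    K'.elim (Γ'.cons :: trList [N]) [] [] [], p + 1, o⟩) ?_ ?_
  · simp [StackMachine.step, iterationMachine, Control.action, StackMachine.applyOp,
      K'.elim_update_main]
  · rcases inputSymbol u p with _ | _ | _
    · refine .of_step ?_ (.refl _)
      simp [StackMachine.step, iterationMachine, Control.action, StackMachine.applyOp, symbolCode]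
    · refine .of_step ?_ (.refl _)
      simp [StackMachine.step, iterationMachine, Control.action, StackMachine.applyOp, symbolCode,
        K'.elim_update_main, trNat_one]
    · refine .of_step rfl (.of_step ?_ (.refl _))
      simp [StackMachine.step, iterationMachine, Control.action, StackMachine.applyOp, symbolCode,
        K'.elim_update_main, trNat_two]

/-- The codes 0 to 3 are distinguished by popping at most two digits. The printed symbol is known
before the delimiter is removed. -/
theorem reaches_read (N p : ℕ) (o : List (Option Bool)) (x : Option (Option Bool)) :
    Reaches c u ⟨Control.print, K'.elim (trList [printCode x, N]) [] [] [], p, o⟩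
      ⟨Control.read, K'.elim (trList [N]) [] [] [], p, o ++ x.toList⟩ := by
  rcases x with _ | _ | _ | _
  · refine .of_step ?_ (.refl _)
    simp [StackMachine.step, iterationMachine, Control.action, StackMachine.applyOp, printCode,
      K'.elim_update_main]
  · refine .of_step rfl (.of_step ?_ (.refl _))
    simp [StackMachine.step, iterationMachine, Control.action, StackMachine.applyOp, printCode,
      K'.elim_update_main, trNat_one]
  · refine .of_step rfl (.of_step rfl (.of_step ?_ (.refl _)))
    simp [StackMachine.step, iterationMachine, Control.action, StackMachine.applyOp, printCode,
      K'.elim_update_main, trNat_two]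
  · refine .of_step rfl (.of_step rfl (.of_step ?_ (.refl _)))
    simp [StackMachine.step, iterationMachine, Control.action, StackMachine.applyOp, printCode,
      K'.elim_update_main, trNat_three]

theorem reaches_round {N N' p : ℕ} {x : Option (Option Bool)} (o : List (Option Bool))
    (h : [printCode x, N'] ∈ c.eval [symbolCode (inputSymbol u p), N]) :
    Reaches c u ⟨Control.read, K'.elim (trList [N]) [] [] [], p, o⟩
      ⟨Control.read, K'.elim (trList [N']) [] [] [], p + 1, o ++ x.toList⟩ :=
  (reaches_entry N p o).trans ((reaches_print h _ _).trans (reaches_read N' _ _ x))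

theorem reaches_start : Reaches c u (iterationMachine c).init
    ⟨Control.read, K'.elim (trList [0]) [] [] [], 0, []⟩ := by
  refine .of_step ?_ (.refl _)
  have : (fun _ : K' => ([] : List Γ')) = K'.elim [] [] [] [] := by
    funext k
    cases k <;> rfl
  simp [StackMachine.step, StackMachine.init, iterationMachine, Control.action,
    StackMachine.applyOp, this, K'.elim_update_main]

end iterationMachine

end Iteration

/-! ### Transducers -/

/-- The state and the output of a transducer with initial state `s₀` and transition function `f`
after it has read the first `n` symbols of `b`. -/
def transduce {σ : Type*} (f : σ × Option Bool → σ × Option (Option Bool)) (s₀ : σ)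
    (b : ℕ → Option Bool) : ℕ → σ × List (Option Bool)
  | 0 => (s₀, [])
  | n + 1 => ((f ((transduce f s₀ b n).1, b n)).1,
      (transduce f s₀ b n).2 ++ (f ((transduce f s₀ b n).1, b n)).2.toList)

theorem Turing.ToPartrec.Code.exists_eval_pair {g h : ℕ → ℕ → ℕ} (hg : Computable₂ g)
    (hh : Computable₂ h) :
    ∃ c : Turing.ToPartrec.Code, ∀ x y, [g x y, h x y] ∈ c.eval [x, y] := by
  have key : ∀ {g : ℕ → ℕ → ℕ}, Computable₂ g →
      ∃ c : Turing.ToPartrec.Code, ∀ x y, c.eval [x, y] = pure [g x y] := by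
    intro g hg
    obtain ⟨c, hc⟩ := exists_code
      (Nat.Partrec'.part_iff₂ (f := fun x y => Part.some (g x y)) |>.2 hg.partrec₂)
    refine ⟨c, fun x y => ?_⟩
    have := hc (x ::ᵥ y ::ᵥ List.Vector.nil)
    simpa using! this
  obtain ⟨c₁, h₁⟩ := key hg
  obtain ⟨c₂, h₂⟩ := key hh
  refine ⟨Code.cons c₁ c₂, fun x y => ?_⟩
  simp [cons_eval, h₁, h₂]

/-- Every recursive transducer is realised by a Turing machine. -/
theorem StreamMachine.exists_transduce {σ : Type*} [Primcodable σ]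
    {f : σ × Option Bool → σ × Option (Option Bool)} (hf : Computable f) (s₀ : σ) :
    ∃ M : StreamMachine, ∀ (u : ℕ → ℕ) (n : ℕ), ∃ t, (M.run u t).pos = n ∧
      (M.run u t).out = (transduce f s₀ (inputSymbol u) n).2 := by
  classical
  -- The stack initially holds the number 0, which therefore stands for `s₀`; all later states are
  -- encoded with a shift by one.
  set dec : ℕ → σ := fun N => (Encodable.decode (α := σ) (N - 1)).getD s₀ with hdec
  set sym : ℕ → Option Bool := fun b => if b = 0 then none else some (decide (b = 2)) with hsym
  set next : ℕ → ℕ → σ × Option (Option Bool) := fun b N =>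
    f (if N = 0 then s₀ else dec N, sym b) with hnext
  have hdec' : Computable dec :=
    Computable.option_getD (Computable.decode.comp
      (Primrec.nat_sub.comp Primrec.id (Primrec.const 1)).to_comp) (Computable.const s₀)
  have hsym' : Primrec sym :=
    Primrec.ite (Primrec.eq.comp Primrec.id (Primrec.const 0)) (Primrec.const none)
      (Primrec.option_some.comp (Primrec.eq.comp Primrec.id (Primrec.const 2)).decide)
  have hnext' : Computable₂ next := by
    refine hf.comp (Computable.pair ?_ (hsym'.to_comp.comp Computable.fst))
    refine (Computable.cond (c := fun p : ℕ × ℕ => decide (p.2 = 0))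
      (Primrec.eq.comp Primrec.snd (Primrec.const 0)).decide.to_comp (Computable.const s₀)
      (hdec'.comp Computable.snd)).of_eq fun p => ?_
    by_cases h : p.2 = 0 <;> simp [h]
  obtain ⟨c, hc⟩ := Turing.ToPartrec.Code.exists_eval_pair
    (g := fun b N => printCode (next b N).2) (h := fun b N => Encodable.encode (next b N).1 + 1)
    ((Primrec.dom_finite printCode).to_comp.comp (Computable.snd.comp hnext'))
    (Computable.succ.comp (Computable.encode.comp (Computable.fst.comp hnext')))
  obtain ⟨M, hM⟩ := StackMachine.exists_streamMachine (iterationMachine c)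
    (Control.finite_reachable c) (fun q v h => by cases h) (Control.action_mem_reachable c)
  refine ⟨M, fun u n => ?_⟩
  -- One round of the iteration machine is one transition, and the number kept on the stack codes
  -- the current state of the transducer.
  have key : ∃ N, (if N = 0 then s₀ else dec N) = (transduce f s₀ (inputSymbol u) n).1 ∧
      iterationMachine.Reaches c u (iterationMachine c).init
        ⟨Control.read, Turing.PartrecToTM2.K'.elim (Turing.PartrecToTM2.trList [N]) [] [] [], n,
          (transduce f s₀ (inputSymbol u) n).2⟩ := by
    induction n with
    | zero => exact ⟨0, by simp [transduce], iterationMachine.reaches_start⟩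
    | succ n ih =>
      obtain ⟨N, hN, hr⟩ := ih
      have hs : sym (symbolCode (inputSymbol u n)) = inputSymbol u n := by
        rcases inputSymbol u n with _ | _ | _ <;> simp [hsym, symbolCode]
      have he : next (symbolCode (inputSymbol u n)) N =
          f ((transduce f s₀ (inputSymbol u) n).1, inputSymbol u n) := by
        simp only [hnext, hs, hN]
      have := hc (symbolCode (inputSymbol u n)) N
      simp only [he] at this
      refine ⟨_, ?_, hr.trans (iterationMachine.reaches_round _ this)⟩
      simp [hdec, transduce]
  obtain ⟨N, -, m, hm⟩ := key
  obtain ⟨t, ht⟩ := hM u m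
  refine ⟨t, ?_⟩
  rw [ht.1, ht.2, hm]
  exact ⟨rfl, rfl⟩

/-! ### Machines for monotone functions on finite sequences -/

namespace SeqReader

/-- The number with the given binary digits, the least significant one first. -/
def ofBits (l : List Bool) : ℕ :=
  l.foldr (fun b n => 2 * n + b.toNat) 0

theorem ofBits_bits (n : ℕ) : ofBits n.bits = n := by
  induction n using Nat.binaryRec' with
  | zero => simp [ofBits]
  | bit b n hn ih =>
    rw [Nat.bits_append_bit _ _ hn, Nat.bit_val]
    conv_rhs => rw [← ih]
    rfl

/-- The effect of reading a symbol: the digits of the current entry and the list of complete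
entries are updated. -/
def next (r : List Bool × List ℕ) : Option Bool → List Bool × List ℕ
  | none => ([], r.2 ++ [ofBits r.1])
  | some b => (r.1 ++ [b], r.2)

/-- The state after reading `l`. -/
def read (l : List (Option Bool)) : List Bool × List ℕ :=
  l.foldl next ([], [])

theorem read_append_singleton (l : List (Option Bool)) (b : Option Bool) :
    read (l ++ [b]) = next (read l) b := by
  simp [read]

theorem isPrefix_next (r : List Bool × List ℕ) (b : Option Bool) : r.2 <+: (next r b).2 := by
  cases b
  · exact List.prefix_append _ _
  · exact List.prefix_rfl

theorem isPrefix_read {l l' : List (Option Bool)} (h : l <+: l') : (read l).2 <+: (read l').2 := by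
  obtain ⟨r, rfl⟩ := h
  induction r using List.reverseRecOn with
  | nil => simp
  | append_singleton r b ih =>
    rw [← List.append_assoc, read_append_singleton]
    exact ih.trans (isPrefix_next _ _)

theorem foldl_next_map_some (l : List Bool) (r : List Bool × List ℕ) :
    (l.map some).foldl next r = (r.1 ++ l, r.2) := by
  induction l generalizing r with
  | nil => simp
  | cons b l ih => simp [ih, next]

theorem read_encodeSeq (s : List ℕ) : read (encodeSeq s) = ([], s) := by
  induction s using List.reverseRecOn with
  | nil => rfl
  | append_singleton s a ih =>
    rw [read] at ih
    rw [encodeSeq_append, read, List.foldl_append, ih]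
    simp [encodeSeq, foldl_next_map_some, next, ofBits_bits]

theorem isPrefix_of_encodeSeq {s t : List ℕ} (h : encodeSeq s <+: encodeSeq t) : s <+: t := by
  simpa [read_encodeSeq] using isPrefix_read h

theorem length_le_encodeSeq (s : List ℕ) : s.length ≤ (encodeSeq s).length := by
  induction s with
  | nil => simp
  | cons a s ih =>
    simp only [encodeSeq, List.flatMap_cons, List.length_append, List.length_cons,
      List.length_map] at ih ⊢
    omega

/-- The first `n` symbols on the input tape. -/
def inputPrefix (u : ℕ → ℕ) (n : ℕ) : List (Option Bool) :=
  (List.range n).map (inputSymbol u)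

theorem inputPrefix_succ (u : ℕ → ℕ) (n : ℕ) :
    inputPrefix u (n + 1) = inputPrefix u n ++ [inputSymbol u n] := by
  simp [inputPrefix, List.range_succ]

theorem inputPrefix_isPrefix (u : ℕ → ℕ) {m n : ℕ} (h : m ≤ n) :
    inputPrefix u m <+: inputPrefix u n := by
  obtain ⟨k, rfl⟩ := Nat.exists_eq_add_of_le h
  exact ⟨(List.range k).map fun i => inputSymbol u (m + i), by simp [inputPrefix, List.range_add]⟩

theorem inputPrefix_length_encodeSeq (u : ℕ → ℕ) (j : ℕ) :
    inputPrefix u (encodeSeq (seqPrefix u j)).length = encodeSeq (seqPrefix u j) := by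
  refine List.ext_getElem (by simp [inputPrefix]) fun p hp hp' => ?_
  simp only [inputPrefix, List.getElem_map, List.getElem_range, inputSymbol]
  have hl : p < (encodeSeq (seqPrefix u (p + 1))).length :=
    Nat.lt_of_succ_le ((length_seqPrefix u (p + 1)).ge.trans (length_le_encodeSeq _))
  rw [List.getD_eq_getElem _ _ hl]
  rcases le_total (p + 1) j with h | h
  · exact (encodeSeq_isPrefix (seqPrefix_isPrefix u h)).getElem hl
  · exact ((encodeSeq_isPrefix (seqPrefix_isPrefix u h)).getElem hp').symm

theorem seqPrefix_isPrefix_read {u : ℕ → ℕ} {j n : ℕ} (h : (encodeSeq (seqPrefix u j)).length ≤ n) :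
    seqPrefix u j <+: (read (inputPrefix u n)).2 := by
  have := isPrefix_read (inputPrefix_isPrefix u h)
  rwa [inputPrefix_length_encodeSeq, read_encodeSeq] at this

theorem read_isPrefix_seqPrefix (u : ℕ → ℕ) (n : ℕ) :
    (read (inputPrefix u n)).2 <+: seqPrefix u n := by
  have := isPrefix_read (inputPrefix_isPrefix u
    ((length_seqPrefix u n).ge.trans (length_le_encodeSeq (seqPrefix u n))))
  rwa [inputPrefix_length_encodeSeq, read_encodeSeq] at this

theorem primrec_ofBits : Primrec ofBits :=
  Primrec.list_foldr (h := fun _ (p : Bool × ℕ) => 2 * p.2 + p.1.toNat) Primrec.id (Primrec.const 0)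
    (Primrec₂.mk (Primrec.nat_add.comp
    (Primrec.nat_double.comp (Primrec.snd.comp Primrec.snd))
    ((Primrec.dom_finite Bool.toNat).comp (Primrec.fst.comp Primrec.snd))))

theorem primrec_next : Primrec₂ next := by
  have : Primrec₂ fun (r : List Bool × List ℕ) (b : Option Bool) =>
      (Option.casesOn b ([], r.2 ++ [ofBits r.1]) fun b => (r.1 ++ [b], r.2) :
        List Bool × List ℕ) := by
    refine Primrec.option_casesOn Primrec.snd ?_ (Primrec₂.mk ?_)
    · exact (Primrec.const []).pair (Primrec.list_append.comp (Primrec.snd.comp Primrec.fst)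
        (Primrec.list_cons.comp (primrec_ofBits.comp (Primrec.fst.comp Primrec.fst))
          (Primrec.const [])))
    · exact (Primrec.list_append.comp (Primrec.fst.comp (Primrec.fst.comp Primrec.fst))
        (Primrec.list_cons.comp Primrec.snd (Primrec.const []))).pair
        (Primrec.snd.comp (Primrec.fst.comp Primrec.fst))
  exact this.of_eq fun r b => by cases b <;> rfl

/-- The transducer that prints the values of `F`: its state consists of the state of the reader
and the number of symbols printed so far. -/
def transition (F : List ℕ → List ℕ) (x : ((List Bool × List ℕ) × ℕ) × Option Bool) :
    ((List Bool × List ℕ) × ℕ) × Option (Option Bool) :=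
  ((next x.1.1 x.2,
      x.1.2 + ((encodeSeq (F (next x.1.1 x.2).2))[x.1.2]?).isSome.toNat),
    (encodeSeq (F (next x.1.1 x.2).2))[x.1.2]?)

theorem computable_transition {F : List ℕ → List ℕ} (hF : Computable F) :
    Computable (transition F) := by
  have h1 : Computable fun x : ((List Bool × List ℕ) × ℕ) × Option Bool => next x.1.1 x.2 :=
    primrec_next.to_comp.comp (Computable.fst.comp Computable.fst) Computable.snd
  have h2 : Computable fun x : ((List Bool × List ℕ) × ℕ) × Option Bool =>
      (encodeSeq (F (next x.1.1 x.2).2))[x.1.2]? :=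
    Computable.list_getElem?.comp (primrec_encodeSeq.to_comp.comp
      (hF.comp (Computable.snd.comp h1))) (Computable.snd.comp Computable.fst)
  exact (h1.pair (Primrec.nat_add.to_comp.comp (Computable.snd.comp Computable.fst)
    ((Primrec.dom_finite Bool.toNat).to_comp.comp (Primrec.option_isSome.to_comp.comp h2)))).pair h2

section

variable {F : List ℕ → List ℕ} {u : ℕ → ℕ}

variable (F u) in
/-- The state and the output of the transducer after `n` symbols of the input. -/
abbrev printer (n : ℕ) : ((List Bool × List ℕ) × ℕ) × List (Option Bool) :=
  transduce (transition F) (([], []), 0) (inputSymbol u) n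

theorem transduce_reader (n : ℕ) : (printer F u n).1.1 = read (inputPrefix u n) := by
  induction n with
  | zero => rfl
  | succ n ih =>
    rw [inputPrefix_succ, read_append_singleton, ← ih]
    rfl

/-- The output is always a truncation of the encoded value of `F` on the entries read so far. By
monotonicity of `F`, what has been printed stays valid when more input arrives. -/
theorem transduce_snd (hF : ∀ {s t}, s <+: t → F s <+: F t) (n : ℕ) :
    (printer F u n).1.2 ≤ (encodeSeq (F (read (inputPrefix u n)).2)).length ∧
      (printer F u n).2 = (encodeSeq (F (read (inputPrefix u n)).2)).take (printer F u n).1.2 := by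
  induction n with
  | zero => simp [transduce]
  | succ n ih =>
    have hpre := encodeSeq_isPrefix (hF (isPrefix_next (read (inputPrefix u n)) (inputSymbol u n)))
    simp only [transduce, transition, transduce_reader, inputPrefix_succ, read_append_singleton]
    generalize encodeSeq (F (next (read (inputPrefix u n)) (inputSymbol u n)).2) = E' at *
    obtain ⟨r, rfl⟩ := hpre
    generalize encodeSeq (F (read (inputPrefix u n)).2) = E at *
    rw [ih.2]
    generalize (printer F u n).1.2 = p at *
    rcases h : (E ++ r)[p]? with _ | b
    · simp only [Option.isSome_none, Bool.toNat_false, Nat.add_zero, Option.toList_none,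
        List.append_nil]
      exact ⟨ih.1.trans (by simp), (List.take_append_of_le_length ih.1).symm⟩
    · have hp := (List.getElem?_eq_some_iff.1 h).1
      simp only [Option.isSome_some, Bool.toNat_true]
      exact ⟨hp, by rw [List.take_add_one, h, List.take_append_of_le_length ih.1]⟩

/-- Once the first `j` entries have been read, each further input symbol releases one output symbol
until the encoded value of `F` on these entries is exhausted. -/
theorem min_le_transduce (hF : ∀ {s t}, s <+: t → F s <+: F t) (j n : ℕ) :
    min (n - (encodeSeq (seqPrefix u j)).length) (encodeSeq (F (seqPrefix u j))).length ≤
      (printer F u n).1.2 := by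
  induction n with
  | zero => simp
  | succ n ih =>
    have hle : (printer F u (n + 1)).1.2 = (printer F u n).1.2 +
        ((encodeSeq (F (read (inputPrefix u (n + 1))).2))[(printer F u n).1.2]?).isSome.toNat := by
      simp only [transduce, transition, transduce_reader, inputPrefix_succ, read_append_singleton]
    rw [hle]
    by_cases h1 : (encodeSeq (seqPrefix u j)).length ≤ n + 1
    · have h2 := (encodeSeq_isPrefix (hF (seqPrefix_isPrefix_read h1))).length_le
      by_cases h3 : (printer F u n).1.2 < (encodeSeq (F (seqPrefix u j))).length
      · rw [List.getElem?_eq_getElem (h3.trans_le h2)]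
        simp only [Option.isSome_some, Bool.toNat_true]
        omega
      · omega
    · omega

end

end SeqReader

open SeqReader in
/-- Every recursive monotone function on finite sequences is computed by a Turing machine. -/
theorem StreamMachine.exists_printed_iff {F : List ℕ → List ℕ} (hF : Computable F)
    (hmono : ∀ {s t}, s <+: t → F s <+: F t) :
    ∃ M : StreamMachine, ∀ (u : ℕ → ℕ) (s : List ℕ),
      (∃ t, M.Printed u t s) ↔ ∃ m, s <+: F (seqPrefix u m) := by
  obtain ⟨M, hM⟩ := StreamMachine.exists_transduce (computable_transition hF) (([], []), 0)
  refine ⟨M, fun u s => ⟨?_, ?_⟩⟩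
  · rintro ⟨t, ht⟩
    obtain ⟨t', hpos, hout⟩ := hM u t
    -- The head cannot be ahead of time, so the output at time `t` is contained in the output after
    -- `t` input symbols have been read.
    have htt : t ≤ t' := hpos ▸ M.pos_run_le u t'
    have h1 := ht.mono htt
    rw [StreamMachine.Printed, hout, (transduce_snd hmono t).2] at h1
    exact ⟨t, isPrefix_of_encodeSeq ((h1.trans (List.take_prefix _ _)).trans
      (encodeSeq_isPrefix (hmono (read_isPrefix_seqPrefix u t))))⟩
  · rintro ⟨m, hm⟩
    set n := (encodeSeq (seqPrefix u m)).length + (encodeSeq (F (seqPrefix u m))).length with hn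
    obtain ⟨t, -, hout⟩ := hM u n
    refine ⟨t, (encodeSeq_isPrefix hm).trans ?_⟩
    rw [hout, (transduce_snd hmono n).2]
    have h1 := min_le_transduce (u := u) hmono m n
    have h2 := encodeSeq_isPrefix (hmono (seqPrefix_isPrefix_read (u := u) (j := m) (n := n)
      (by omega)))
    exact List.prefix_take_iff.2 ⟨h2, by omega⟩

/-! ### Maps with computable graphs -/

section Search

/-- The list obtained from the empty list by `n` attempts to append a new entry. An attempt
appends the candidate `v` to `g` if `test` confirms `(g, v, k, sₖ)` with the witness `w`, where
`v`, `k` and `w` are encoded in the number of the attempt. -/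
def searchSeq (test : List ℕ × ℕ × ℕ × ℕ → ℕ → Bool) (s : List ℕ) : ℕ → List ℕ
  | 0 => []
  | i + 1 => searchSeq test s i ++
      bif test (searchSeq test s i, i.unpair.1, i.unpair.2.unpair.1,
          s.getD i.unpair.2.unpair.1 0) i.unpair.2.unpair.2.unpair.1
        then [i.unpair.1] else []

variable {test : List ℕ × ℕ × ℕ × ℕ → ℕ → Bool}

theorem primrec_searchSeq (h : Primrec₂ test) : Primrec₂ (searchSeq test) := by
  have hv : Primrec fun x : List ℕ × ℕ × List ℕ => x.2.1.unpair.1 :=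
    Primrec.fst.comp (Primrec.unpair.comp (Primrec.fst.comp Primrec.snd))
  have hr : Primrec fun x : List ℕ × ℕ × List ℕ => x.2.1.unpair.2.unpair :=
    Primrec.unpair.comp (Primrec.snd.comp (Primrec.unpair.comp (Primrec.fst.comp Primrec.snd)))
  have hk : Primrec fun x : List ℕ × ℕ × List ℕ => x.2.1.unpair.2.unpair.1 := Primrec.fst.comp hr
  have hw : Primrec fun x : List ℕ × ℕ × List ℕ => x.2.1.unpair.2.unpair.2.unpair.1 :=
    Primrec.fst.comp (Primrec.unpair.comp (Primrec.snd.comp hr))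
  have hg : Primrec fun x : List ℕ × ℕ × List ℕ => x.2.2 := Primrec.snd.comp Primrec.snd
  have hstep : Primrec fun x : List ℕ × ℕ × List ℕ => x.2.2 ++
      bif test (x.2.2, x.2.1.unpair.1, x.2.1.unpair.2.unpair.1,
          x.1.getD x.2.1.unpair.2.unpair.1 0) x.2.1.unpair.2.unpair.2.unpair.1
        then [x.2.1.unpair.1] else [] :=
    Primrec.list_append.comp hg (Primrec.cond
      (h.comp (hg.pair (hv.pair (hk.pair ((Primrec.list_getD 0).comp Primrec.fst hk)))) hw)
      (Primrec.list_cons.comp hv (Primrec.const [])) (Primrec.const []))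
  refine ((Primrec.nat_rec (f := fun _ : List ℕ => ([] : List ℕ))
    (g := fun s (p : ℕ × List ℕ) => p.2 ++
      bif test (p.2, p.1.unpair.1, p.1.unpair.2.unpair.1,
          s.getD p.1.unpair.2.unpair.1 0) p.1.unpair.2.unpair.2.unpair.1
        then [p.1.unpair.1] else []) (Primrec.const []) hstep.to₂)).of_eq fun s n => ?_
  induction n with
  | zero => rfl
  | succ n ih => simp only [searchSeq, ← ih]

theorem searchSeq_isPrefix (s : List ℕ) {m n : ℕ} (h : m ≤ n) :
    searchSeq test s m <+: searchSeq test s n := by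
  induction n, h using Nat.le_induction with
  | base => exact List.prefix_rfl
  | succ n _ ih => exact ih.trans (List.prefix_append _ _)

/-- Attempt `i` inspects only an entry with number at most `i`, since the components of a pair do
not exceed its code. This makes the search monotone in the input segment. -/
theorem searchSeq_congr {s t : List ℕ} (h : s <+: t) {n : ℕ} (hn : n ≤ s.length) :
    searchSeq test s n = searchSeq test t n := by
  induction n with
  | zero => rfl
  | succ n ih =>
    have hk : n.unpair.2.unpair.1 < s.length :=
      ((Nat.unpair_left_le _).trans (Nat.unpair_right_le _)).trans_lt hn
    have hd : s.getD n.unpair.2.unpair.1 0 = t.getD n.unpair.2.unpair.1 0 := by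
      rw [List.getD_eq_getElem _ _ hk, List.getD_eq_getElem _ _ (hk.trans_le h.length_le)]
      exact h.getElem hk
    simp only [searchSeq, ih (Nat.le_of_succ_le hn), hd]

theorem searchSeq_length_isPrefix {s t : List ℕ} (h : s <+: t) :
    searchSeq test s s.length <+: searchSeq test t t.length := by
  rw [searchSeq_congr h le_rfl]
  exact searchSeq_isPrefix t h.length_le

/-- A property that is preserved by the confirmed extensions holds throughout the search. -/
theorem searchSeq_induction {s : List ℕ} {p : List ℕ → Prop} (hnil : p [])
    (happend : ∀ g v k w, p g → k < s.length → test (g, v, k, s.getD k 0) w = true → p (g ++ [v]))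
    {n : ℕ} (hn : n ≤ s.length) : p (searchSeq test s n) := by
  induction n with
  | zero => exact hnil
  | succ n ih =>
    simp only [searchSeq]
    cases h : test (searchSeq test s n, n.unpair.1, n.unpair.2.unpair.1,
        s.getD n.unpair.2.unpair.1 0) n.unpair.2.unpair.2.unpair.1
    · simpa using ih (Nat.le_of_succ_le hn)
    · exact happend _ _ _ _ (ih (Nat.le_of_succ_le hn))
        (((Nat.unpair_left_le _).trans (Nat.unpair_right_le _)).trans_lt hn) h

/-- The search does not come to an end if there are always candidates. -/
theorem exists_le_length_searchSeq {u : ℕ → ℕ}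
    (h : ∀ m, ∃ v k w, test (searchSeq test (seqPrefix u m) m, v, k, u k) w = true) (n : ℕ) :
    ∃ m, n ≤ (searchSeq test (seqPrefix u m) m).length := by
  induction n with
  | zero => exact ⟨0, Nat.zero_le _⟩
  | succ n ih =>
    obtain ⟨m, hm⟩ := ih
    by_contra! hc
    obtain ⟨v, k, w, ht⟩ := h m
    -- Including `m` in the number postpones the attempt beyond stage `m`. If the list had stopped
    -- growing, it would still be the same at attempt `i`, which would then succeed.
    set i := Nat.pair v (Nat.pair k (Nat.pair w m)) with hi
    have hmi : m ≤ i := (Nat.right_le_pair _ _).trans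
      ((Nat.right_le_pair _ _).trans (Nat.right_le_pair _ _))
    have hki : k ≤ i := (Nat.left_le_pair _ _).trans (Nat.right_le_pair _ _)
    have hgi : searchSeq test (seqPrefix u (i + 1)) i = searchSeq test (seqPrefix u m) m := by
      have h1 := searchSeq_length_isPrefix (test := test)
        (seqPrefix_isPrefix u (hmi.trans i.le_succ))
      have h2 := searchSeq_isPrefix (test := test) (seqPrefix u (i + 1)) i.le_succ
      have h3 := searchSeq_isPrefix (test := test) (seqPrefix u (i + 1)) hmi
      have h4 := hc (i + 1)
      rw [← searchSeq_congr (seqPrefix_isPrefix u (hmi.trans i.le_succ))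
        (length_seqPrefix u m).ge] at h3
      refine (h3.eq_of_length ?_).symm
      have := h2.length_le
      have := h3.length_le
      simp only [Nat.succ_eq_add_one] at *
      omega
    have h5 := hc (i + 1)
    have hk : (seqPrefix u (i + 1)).getD k 0 = u k := by
      simp [List.getD, getElem?_seqPrefix (Nat.lt_succ_of_le hki)]
    simp only [searchSeq, hgi] at h5
    rw [show i.unpair = (v, Nat.pair k (Nat.pair w m)) from Nat.unpair_pair _ _] at h5
    simp only [Nat.unpair_pair, hk, ht, cond_true, List.length_append, List.length_singleton] at h5
    omega

end Search

/-! ### Recovering a map from its graph -/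

section Graph

open Presentation

variable {X Y : Type*} [MetricSpace X] [MetricSpace Y] {P : Presentation X} {Q : Presentation Y}

variable (P Q) in
/-- The list `g` can be extended by `v` to an initial segment of a name, and all points `y` such
that `(x, y) ∈ G` for some `x` in the closed ball of radius `2^(-k)` around the point with index
`a` have distance less than `2^(-m)` to the point with index `v`, where `m` is the length
of `g`. -/
def Extends (G : Set (X × Y)) (g : List ℕ) (v k a : ℕ) : Prop :=
  (∀ p ∈ indexed (g ++ [v]), p.1 < 2 ^ Q.D p.2) ∧
  (∃ q : ℕ × ℕ, ∀ p ∈ indexed (g ++ [v]), Q.Near q.1 p.1 p.2 q.2) ∧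
  ∀ b < 2 ^ Q.D k, b ∉ Q.enum.Dom ∨
    (∃ i, unpairIndex P Q i = (a, b) ∧ (P.prod Q).Misses G i k) ∨ Q.Near b v g.length k

theorem extends_re (hP : P.ComputablyCompact) (hQ : Q.ComputablyCompact) {G : Set (X × Y)}
    (hG : REPred fun p : ℕ × ℕ => (P.prod Q).Misses G p.1 p.2) :
    REPred fun x : List ℕ × ℕ × ℕ × ℕ => Extends P Q G x.1 x.2.1 x.2.2.1 x.2.2.2 := by
  have hv : Computable fun x : List ℕ × ℕ × ℕ × ℕ => x.2.1 := Computable.fst.comp Computable.snd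
  have hk : Computable fun x : List ℕ × ℕ × ℕ × ℕ => x.2.2.1 :=
    Computable.fst.comp (Computable.snd.comp Computable.snd)
  have ha : Computable fun x : List ℕ × ℕ × ℕ × ℕ => x.2.2.2 :=
    Computable.snd.comp (Computable.snd.comp Computable.snd)
  have hL : Computable fun x : List ℕ × ℕ × ℕ × ℕ => indexed (x.1 ++ [x.2.1]) :=
    primrec_indexed.to_comp.comp (Computable.list_append.comp Computable.fst
      (Computable.list_cons.comp hv (Computable.const [])))
  refine REPred.and ?_ ?_
  · refine REPred.forall_mem_list ?_ hL
    exact REPred.lt (Computable.fst.comp Computable.snd)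
      (hQ.bound (Computable.snd.comp Computable.snd))
  refine REPred.and ?_ ?_
  · refine REPred.exists ?_
    refine REPred.forall_mem_list ?_ (hL.comp Computable.fst)
    exact hQ.near_re (Computable.fst.comp (Computable.snd.comp Computable.fst))
      (Computable.fst.comp Computable.snd) (Computable.snd.comp Computable.snd)
      (Computable.snd.comp (Computable.snd.comp Computable.fst))
  · refine REPred.forall_lt ?_ (hQ.bound hk)
    refine REPred.or ?_ ?_
    · exact hQ.not_dom_re Computable.snd
    refine REPred.or ?_ ?_
    · refine REPred.exists ?_
      refine REPred.and ?_ ?_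
      · exact REPred.eq ((computable_unpairIndex hP hQ).comp Computable.snd)
          ((ha.comp (Computable.fst.comp Computable.fst)).pair
            (Computable.snd.comp Computable.fst))
      · exact hG.comp (f := fun y : ((List ℕ × ℕ × ℕ × ℕ) × ℕ) × ℕ => (y.2, y.1.1.2.2.1))
          (Computable.snd.pair (hk.comp (Computable.fst.comp Computable.fst)))
    · exact hQ.near_re Computable.snd (hv.comp Computable.fst)
        (Computable.list_length.comp (Computable.fst.comp Computable.fst))
        (hk.comp Computable.fst)

/-- The first two clauses ensure this regardless of `G`. It is needed because a name of a map must
take admissible values on all initial segments of names in `X`, including those of points outside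
`W`. -/
theorem Extends.mem_initials {G : Set (X × Y)} {g : List ℕ} {v k a : ℕ}
    (h : Extends P Q G g v k a) : g ++ [v] ∈ Q.initials Set.univ := by
  obtain ⟨h1, ⟨q, hq⟩, -⟩ := h
  obtain ⟨y, hy, -⟩ := hq (v, g.length) (mem_indexed.2 (by simp))
  refine mem_initials_iff.2 ⟨h1, y, trivial, fun p hp => ?_⟩
  obtain ⟨y', hy', z, hz, hd⟩ := hq p hp
  rw [Part.mem_unique hy' hy, dist_comm] at hd
  exact ⟨z, hz, by linarith [half_pow_pos q.2]⟩

/-- The point `y` has an approximating index `b` at level `k`. The rectangle around `(a, b)`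
contains `(x, y)` and so cannot miss `G`; hence `b` is near `v`, with a margin that covers the error
of `b`. -/
theorem Extends.dist_lt {G : Set (X × Y)} {g : List ℕ} {v k a : ℕ} (h : Extends P Q G g v k a)
    {x : X} {y : Y} (hxy : (x, y) ∈ G) (ha : ∃ z ∈ P.enum a, dist z x ≤ (2⁻¹ : ℝ) ^ k) :
    ∃ z ∈ Q.enum v, dist z y < (2⁻¹ : ℝ) ^ g.length := by
  obtain ⟨z, hz, hzx⟩ := ha
  obtain ⟨b, hb, z', hz', hd⟩ := Q.exists_index k y
  have hd' := hd.trans (half_pow_le k.le_succ)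
  rcases h.2.2 b hb with hn | ⟨i, hi, hm⟩ | ⟨z'', hz'', w, hw, hdw⟩
  · exact absurd ⟨z', hz'⟩ (fun h => hn ((PFun.mem_dom _ _).2 h))
  · have := hm (z, z') (mem_prod_enum.2 (by rw [hi]; exact ⟨hz, hz'⟩)) _ hxy
    rw [Prod.dist_eq] at this
    exact absurd (max_le hzx hd') (not_le.2 this)
  · rw [Part.mem_unique hz'' hz'] at hdw
    exact ⟨w, hw, by linarith [dist_triangle_left w y z']⟩

/-- The entries of `g` are strict approximations of `y`. -/
def Approximates (Q : Presentation Y) (g : List ℕ) (y : Y) : Prop :=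
  ∀ p ∈ indexed g, p.1 < 2 ^ Q.D p.2 ∧ ∃ z ∈ Q.enum p.1, dist z y < (2⁻¹ : ℝ) ^ p.2

theorem approximates_append {g : List ℕ} {v : ℕ} {y : Y} : Approximates Q (g ++ [v]) y ↔
    Approximates Q g y ∧ v < 2 ^ Q.D g.length ∧
      ∃ z ∈ Q.enum v, dist z y < (2⁻¹ : ℝ) ^ g.length := by
  constructor
  · intro h
    refine ⟨fun p hp => h p ?_, h (v, g.length) (mem_indexed.2 (by simp))⟩
    rw [mem_indexed] at hp ⊢
    rw [List.getElem?_append_left (List.getElem?_eq_some_iff.1 hp).1]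
    exact hp
  · rintro ⟨h, hv⟩ p hp
    rw [mem_indexed] at hp
    by_cases hl : p.2 < g.length
    · rw [List.getElem?_append_left hl] at hp
      exact h p (mem_indexed.2 hp)
    · have h1 := (List.getElem?_eq_some_iff.1 hp).1
      rw [List.length_append, List.length_singleton] at h1
      have h2 : p.2 = g.length := by omega
      rw [h2, List.getElem?_concat_length, Option.some.injEq] at hp
      rw [h2, ← hp]
      exact hv

/-- Finitely many strict inequalities leave a common slack, so `y` can be replaced by a close
indexed point. -/
theorem Approximates.exists_near {g : List ℕ} {y : Y} (h : Approximates Q g y) :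
    ∃ q : ℕ × ℕ, ∀ p ∈ indexed g, Q.Near q.1 p.1 p.2 q.2 := by
  have hev : ∀ᶠ l : ℕ in Filter.atTop, ∀ p ∈ indexed g, ∃ z ∈ Q.enum p.1,
      dist z y + 2 * (2⁻¹ : ℝ) ^ l < (2⁻¹ : ℝ) ^ p.2 := by
    refine (Filter.eventually_all_finite (List.finite_toSet (indexed g))).2 fun p hp => ?_
    obtain ⟨-, z, hz, hd⟩ := h p hp
    have : Filter.Tendsto (fun l : ℕ => dist z y + 2 * (2⁻¹ : ℝ) ^ l) Filter.atTop
        (nhds (dist z y + 2 * 0)) := tendsto_const_nhds.add (tendsto_half_pow.const_mul 2)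
    rw [mul_zero, add_zero] at this
    filter_upwards [this.eventually_lt_const hd] with l hl
    exact ⟨z, hz, hl⟩
  obtain ⟨l, hl⟩ := hev.exists
  obtain ⟨b, -, w, hw, hd⟩ := Q.exists_index l y
  refine ⟨(b, l), fun p hp => ?_⟩
  obtain ⟨z, hz, hdz⟩ := hl p hp
  exact ⟨w, hw, z, hz, by linarith [dist_triangle_right w z y, hd.trans (half_pow_le l.le_succ)]⟩

/-- Continuity from a compact graph: the part of `G` at distance at least `ε` from `y` has a compact
projection, which does not contain `x`. -/
theorem exists_dist_lt_of_mem_graph {G : Set (X × Y)} (hG : IsCompact G) {x : X} {y : Y}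
    (hxy : ∀ y', (x, y') ∈ G → y' = y) {ε : ℝ} (hε : 0 < ε) :
    ∃ δ > 0, ∀ p ∈ G, dist p.1 x < δ → dist p.2 y < ε := by
  have hK : IsCompact (G ∩ {p | ε ≤ dist p.2 y}) :=
    hG.inter_right (isClosed_le continuous_const (continuous_snd.dist continuous_const))
  have hcl := (hK.image continuous_fst).isClosed.isOpen_compl
  obtain ⟨δ, hδ, hball⟩ := Metric.isOpen_iff.1 hcl x (by
    rintro ⟨⟨x', y'⟩, ⟨hp, hd⟩, rfl⟩
    rw [Set.mem_ofPred_eq, hxy y' hp, dist_self] at hd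
    exact absurd hd (not_le.2 hε))
  refine ⟨δ, hδ, fun p hp hd => ?_⟩
  by_contra hc
  exact hball (Metric.mem_ball.2 hd) ⟨p, ⟨hp, not_lt.1 hc⟩, rfl⟩

/-- Any good approximation `v` of `y` is eventually confirmed: near `x` the set `G` lies close to
`y`, so at high precision every index `b` whose rectangle meets `G` is close to `v`. -/
theorem Approximates.exists_extends {G : Set (X × Y)} (hG : IsCompact G) {g : List ℕ} {x : X}
    {y : Y} (hxy : ∀ y', (x, y') ∈ G → y' = y) (h : Approximates Q g y) {u : ℕ → ℕ}
    (hu : P.IsPointName u x) : ∃ v k, Extends P Q G g v k (u k) := by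
  obtain ⟨v, hv, z, hz, hd⟩ := Q.exists_index g.length y
  have h2 := half_pow_succ g.length
  have h' : Approximates Q (g ++ [v]) y :=
    approximates_append.2 ⟨h, hv, z, hz, by linarith [half_pow_pos g.length]⟩
  -- In units of `2^(-g.length)`: error 1/2 of `v`, oscillation of `G` below 1/4, and radius plus
  -- margin together below 1/4, both being `2^(-k-1)`.
  obtain ⟨δ, hδ, hδG⟩ := exists_dist_lt_of_mem_graph hG hxy (half_pow_pos (g.length + 2))
  obtain ⟨k, hk⟩ := exists_half_pow_lt (lt_min hδ (half_pow_pos (g.length + 2)))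
  obtain ⟨hk1, hk2⟩ := lt_min_iff.1 hk
  refine ⟨v, k + 1, fun p hp => (h' p hp).1, h'.exists_near, fun b _ => ?_⟩
  by_contra! hc
  obtain ⟨hb, hm, hn⟩ := hc
  obtain ⟨w, hw⟩ := (PFun.mem_dom _ _).1 hb
  obtain ⟨-, a, ha, had⟩ := hu (k + 1)
  -- Any stage containing both indices yields an index of the pair in the product.
  obtain ⟨m, hm1, hm2⟩ : ∃ m, u (k + 1) < 2 ^ P.D m ∧ b < 2 ^ Q.D m :=
    ⟨u (k + 1) + b, ((Nat.le_add_right _ _).trans P.strictMono.le_apply).trans_lt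
      Nat.lt_two_pow_self, ((Nat.le_add_left _ _).trans Q.strictMono.le_apply).trans_lt
      Nat.lt_two_pow_self⟩
  obtain ⟨i, -, hi⟩ := exists_unpairIndex P Q m hm1 hm2
  have hmi := hm i hi
  simp only [Misses, not_forall, not_lt] at hmi
  obtain ⟨q, hq, p, hp, hqp⟩ := hmi
  rw [mem_prod_enum, hi] at hq
  rw [Part.mem_unique ha hq.1] at had
  rw [Part.mem_unique hw hq.2] at hw
  rw [Prod.dist_eq, max_le_iff] at hqp
  have h3 := half_pow_succ k
  have h4 := hδG p hp (by linarith [dist_triangle_left p.1 x q.1])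
  refine hn ⟨q.2, hq.2, z, hz, ?_⟩
  have h5 := half_pow_succ (g.length + 1)
  linarith [dist_triangle q.2 p.2 y, dist_triangle_right q.2 z y]

theorem isComputableMap_of_isComputableSet_mapGraph [CompactSpace X] [CompactSpace Y]
    (hP : P.ComputablyCompact) (hQ : Q.ComputablyCompact) {W : Set X} (hW : W.Nonempty) {Λ : W → Y}
    (h : (P.prod Q).IsComputableSet (mapGraph Λ)) : IsComputableMap P Q Λ := by
  obtain ⟨hG, hre, -⟩ := (hP.prod hQ).isComputableSet_iff.1 h
  obtain ⟨test, htest, hT⟩ := (extends_re hP hQ hre).exists_primrec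
  obtain ⟨M, hM⟩ := StreamMachine.exists_printed_iff
    (F := fun s => searchSeq test s s.length)
    ((primrec_searchSeq htest).comp Primrec.id Primrec.list_length).to_comp
    searchSeq_length_isPrefix
  refine ⟨M, _, ⟨fun s _ => ?_, fun s _ t _ hst => searchSeq_length_isPrefix hst,
    fun x u hu => ?_⟩, fun _ u _ s => hM u s⟩
  · refine searchSeq_induction (p := (· ∈ Q.initials Set.univ)) ?_
      (fun g v k w _ _ ht => ((hT (g, v, k, s.getD k 0)).2 ⟨w, ht⟩).mem_initials) le_rfl
    -- The empty list is an initial segment of a name only if `Y` has a point.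
    obtain ⟨x, hx⟩ := hW
    exact mem_initials_iff.2 ⟨by simp [indexed], Λ ⟨x, hx⟩, trivial, by simp [indexed, ballInter]⟩
  · have hxG : ((x : X), Λ x) ∈ mapGraph Λ := ⟨x, rfl⟩
    have happ : ∀ m,
        Approximates Q (searchSeq test (seqPrefix u m) (seqPrefix u m).length) (Λ x) := by
      intro m
      refine searchSeq_induction (p := fun g => Approximates Q g (Λ x))
        (by simp [Approximates, indexed]) (fun g v k w hg hk ht => ?_) le_rfl
      rw [length_seqPrefix] at hk
      have hext := (hT (g, v, k, (seqPrefix u m).getD k 0)).2 ⟨w, ht⟩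
      have huk : (seqPrefix u m).getD k 0 = u k := by simp [List.getD, getElem?_seqPrefix hk]
      simp only [huk] at hext
      exact approximates_append.2 ⟨hg, hext.1 (v, g.length) (mem_indexed.2 (by simp)),
        hext.dist_lt hxG (hu k).2⟩
    have hlen : ∀ n, ∃ m, n ≤ (searchSeq test (seqPrefix u m) (seqPrefix u m).length).length := by
      simp only [length_seqPrefix] at happ ⊢
      refine exists_le_length_searchSeq fun m => ?_
      obtain ⟨v, k, hext⟩ := (happ m).exists_extends hG (by
        rintro y' ⟨x', hx'⟩
        simp only [Prod.mk.injEq] at hx'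
        rw [← hx'.2, Subtype.ext hx'.1]) hu
      obtain ⟨w, hw⟩ := (hT (_, v, k, u k)).1 hext
      exact ⟨v, k, w, hw⟩
    refine ⟨hlen, ?_⟩
    choose m hm using hlen
    -- Entry `i` is the same at all stages where it exists, so the limit name may read it off at
    -- stage `m (i + 1)`.
    have hget : ∀ (i n : ℕ), i < (searchSeq test (seqPrefix u n) (seqPrefix u n).length).length →
        (searchSeq test (seqPrefix u n) (seqPrefix u n).length)[i]? =
          some ((searchSeq test (seqPrefix u (m (i + 1))) (seqPrefix u (m (i + 1))).length).getD
            i 0) := by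
      intro i n hi
      have hi' := hm (i + 1)
      rw [List.getD_eq_getElem _ _ hi', List.getElem?_eq_getElem hi]
      rcases le_total n (m (i + 1)) with hle | hle
      · exact congrArg some ((searchSeq_length_isPrefix (seqPrefix_isPrefix u hle)).getElem hi)
      · exact congrArg some
          ((searchSeq_length_isPrefix (seqPrefix_isPrefix u hle)).getElem hi').symm
    refine ⟨fun i => (searchSeq test (seqPrefix u (m (i + 1)))
      (seqPrefix u (m (i + 1))).length).getD i 0, fun i => ?_, fun n => ?_⟩
    · obtain ⟨h1, z, hz, hd⟩ := happ (m (i + 1)) (_, i) (mem_indexed.2 (hget i _ (hm (i + 1))))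
      exact ⟨h1, z, hz, hd.le⟩
    · refine List.ext_getElem? fun i => ?_
      by_cases hi : i < (searchSeq test (seqPrefix u n) (seqPrefix u n).length).length
      · rw [hget i n hi, getElem?_seqPrefix hi]
      · rw [List.getElem?_eq_none (not_lt.1 hi),
          List.getElem?_eq_none (by rwa [length_seqPrefix, ← not_lt])]

end Graph

/-! ### The theorem -/

theorem theorem1 {X Y : Type*} [MetricSpace X] [CompactSpace X] [MetricSpace Y] [CompactSpace Y]
    (P : Presentation X) (Q : Presentation Y)
    (hP : P.ComputablyCompact) (hQ : Q.ComputablyCompact)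
    (hR : P.HasRecursiveRounding) (hS : Q.HasRecursiveRounding) :
    -- (a)
    (P.IsComputableSet (Set.univ : Set X) ∧
      (∀ V W : Set X, P.IsComputableSet V → P.IsComputableSet W → P.IsComputableSet (V ∪ W)) ∧
      (∀ V W : Set X, P.IsCoComputableSet V → P.IsCoComputableSet W →
        P.IsCoComputableSet (V ∪ W)) ∧
      (∀ V W : Set X, P.IsCoComputableSet V → P.IsCoComputableSet W →
        P.IsCoComputableSet (V ∩ W))) ∧
    -- (b)
    (∀ x : X, (P.IsComputablePoint x ↔ P.IsCoComputableSet {x}) ∧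
      (P.IsComputablePoint x ↔ P.IsComputableSet {x})) ∧
    ∀ W : Set X, IsCompact W → W.Nonempty →
      -- (c)
      (P.IsComputableSet W → ∃ x ∈ W, P.IsComputablePoint x) ∧
      -- (h)
      (W = closure (interior W) → P.IsCoComputableSet W → P.IsCoComputableSet (interior W)ᶜ →
        P.IsComputableSet W ∧ P.IsComputableSet (interior W)ᶜ) ∧
      ∀ Λ : W → Y,
        -- (d)
        (∀ M : StreamMachine, M.ComputesMap P Q Λ →
          (∃ T : ℕ → ℕ, Monotone T ∧ M.RunsInTime P W T) ∧
          (∀ T : ℕ → ℕ, M.RunsInTime P W T →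
            BinaryModulusEstimate Λ (fun n => T (n + 1) + 1) ∧
            (Monotone T → IsBinaryModulus Λ (fun n => T (n + 1) + 1)))) ∧
        -- (e)
        (P.IsCoComputableSet W →
          REPred (fun s : List ℕ => ¬ s ∈ P.initials W) ∧
          ∀ M : StreamMachine, M.ComputesMap P Q Λ →
            ∃ μ : ℕ → ℕ, Computable μ ∧ IsBinaryModulus Λ μ ∧ M.RunsInTime P W μ) ∧
        -- (f)
        (IsComputableMap P Q Λ → P.IsCoComputableSet W → ∀ V : Set Y, Q.IsCoComputableSet V →
          P.IsCoComputableSet (Subtype.val '' (Λ ⁻¹' V))) ∧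
        -- (g)
        (IsComputableMap P Q Λ → P.IsComputableSet W → Q.IsComputableSet (Set.range Λ)) ∧
        -- (j)
        ((P.IsComputableSet W → IsComputableMap P Q Λ →
            (P.prod Q).IsComputableSet (mapGraph Λ)) ∧
          ((P.prod Q).IsComputableSet (mapGraph Λ) → IsComputableMap P Q Λ)) := by
  refine ⟨⟨hP.isComputableSet_univ, fun V W hV hW => hP.isComputableSet_union hV hW,
    fun V W hV hW => hP.isCoComputableSet_union hV hW,
    fun V W hV hW => hP.isCoComputableSet_inter hV hW⟩, fun x => ?_, fun W hWc hne => ?_⟩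
  · exact ⟨⟨fun hx => hx.isComputableSet_singleton.isCoComputableSet,
      hP.isComputablePoint_of_singleton⟩, ⟨fun hx => hx.isComputableSet_singleton,
      fun hx => hP.isComputablePoint_of_singleton hx.isCoComputableSet⟩⟩
  refine ⟨fun hW => hP.exists_isComputablePoint hR hW hne,
    fun hreg hW hI => hP.isComputableSet_of_regular hreg hW hI, fun Λ => ⟨fun M hM => ?_,
    fun hW => ⟨hP.not_mem_initials_re' hW, fun M hM => hM.exists_computable_modulus hP hW⟩,
    fun hΛ hW V hV => hΛ.isCoComputableSet_preimage hP hQ hW hV,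
    fun hΛ hW => hΛ.isComputableSet_range hP hQ hW,
    fun hW hΛ => hΛ.isComputableSet_mapGraph hP hQ hW,
    isComputableMap_of_isComputableSet_mapGraph hP hQ hne⟩⟩
  exact ⟨hM.exists_runsInTime hWc,
    fun T hT => ⟨hM.binaryModulusEstimate hT, hM.isBinaryModulus hT⟩⟩
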